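/- Let $p>0$ and $\beta\in\mathbb R$, put $Q(x)=1+|x|^{4p}$ for $x\in\mathbb R^4$, and let $|\mathbb S^4|$ denote the volume of the standard unit $4$-sphere. Call $u$ a normal solution with total curvature $\beta$ if $Qe^{4u}\in L^1(\mathbb R^4)$, $$u(x)=\frac{2}{3!\,|\mathbb S^4|}\int_{\mathbb R^4}\log\frac{|y|}{|x-y|}\,\bigl(1+|y|^{4p}\bigr)e^{4u(y)}\,dy+C\qquad\text{for all }x\in\mathbb R^4$$ with some constant $C\in\mathbb R$, and $$\frac{2}{3!\,|\mathbb S^4|}\int_{\mathbb R^4}\bigl(1+|x|^{4p}\bigr)e^{4u(x)}\,dx=\beta .$$ Then there exists a normal solution $u:\mathbb R^4\to\mathbb R$ with total curvature $\beta$ that is radially symmetric about the origin, of class $C^4$, and of class $C^\infty$ whenever $Q$ is of class $C^\infty$, if and only if $$\max\{2,2p\}<\beta<2+2p .$$ -/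

import Mathlib

open MeasureTheory
open scoped ContDiff

noncomputable section

/-- The volume `|𝕊ⁿ|` of the standard unit `n`-sphere in `ℝⁿ⁺¹`. -/
def sphereVolume (n : ℕ) : ℝ :=
  ((volume : Measure (EuclideanSpace ℝ (Fin (n + 1)))).toSphere).real Set.univ

/-- The normalising constant `2 / ((n-1)! |𝕊ⁿ|)`, used for `n ≥ 1`. -/
def normalConst (n : ℕ) : ℝ :=
  2 / ((Nat.factorial (n - 1) : ℝ) * sphereVolume n)

/-- The curvature function `Q(x) = 1 + |x|^{np}` on `ℝⁿ`. -/
def powerCurvature (n : ℕ) (p : ℝ) (x : EuclideanSpace ℝ (Fin n)) : ℝ :=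
  1 + ‖x‖ ^ ((n : ℝ) * p)

/-- `u` is a normal solution with curvature function `Q`: `Q e^{nu}` is integrable on `ℝⁿ` and, for
some constant `C` and every `x`,
`u(x) = 2 / ((n-1)! |𝕊ⁿ|) ∫ log (|y| / |x - y|) Q(y) e^{n u(y)} dy + C`.
(For continuous `Q` and `u` the integrand is automatically integrable for every `x`, because
the kernel tends to `0` as `|y| → ∞` and its singularities are logarithmic.) -/
def IsNormalSolution (n : ℕ) (Q u : EuclideanSpace ℝ (Fin n) → ℝ) : Prop :=
  Integrable (fun y => Q y * Real.exp (n * u y)) ∧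
    ∃ C : ℝ, ∀ x, u x =
      normalConst n *
        (∫ y, Real.log (‖y‖ / ‖x - y‖) * (Q y * Real.exp (n * u y))) + C

/-- The normalised total curvature `2 / ((n-1)! |𝕊ⁿ|) ∫ Q e^{nu} dx`. -/
def totalCurvature (n : ℕ) (Q u : EuclideanSpace ℝ (Fin n) → ℝ) : ℝ :=
  normalConst n * ∫ x, Q x * Real.exp (n * u x)

/-- Radial symmetry about the origin. -/
def IsRadial {n : ℕ} (u : EuclideanSpace ℝ (Fin n) → ℝ) : Prop :=
  ∀ x y, ‖x‖ = ‖y‖ → u x = u y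

end

/-!
Averaging `log (|y| / |x - y|)` over the spheres `|y| = s` turns the equation for a radial normal
solution `u(x) = U(|x|)` into an integral equation on the half-line, with a density
`(c + d s ^ (4 p)) e ^ (4 U s) s ^ 3`. Testing the equation against `r U'` gives the Pohozaev
identity `H + (1 + p) T = (H + T) ^ 2 / 2` for the masses `H` and `T` of the two parts of the
density. Monotonicity of the flux kernel moreover gives `H < 2`, and these two facts confine
`H + T` to the stated interval.

Conversely, the initial value problem `U = b r ^ 2 + (Δ ^ 2)⁻¹ (Q e ^ (4 U))` is a Volterra integral
equation, and for exactly one `b ≤ 0` the growth `r ^ 2` cancels, which makes `U` a normal solution.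
For the curvatures `(1 - τ) + τ s ^ (4 p)`, `0 ≤ τ ≤ 1`, it depends continuously on `τ`, but by
Fatou's lemma the masses are only lower semicontinuous: mass may escape to infinity. Since the
Pohozaev identity makes `T` an increasing and `H` a decreasing function of `H + T`, both
`H + T ≤ β` and `H + T ≥ β` are upper bounds for one of the masses, hence closed conditions on `τ`.
They cover `[0, 1]`, but `τ = 0` (where `H = 2`, `T = 0`) and `τ = 1` (where `H = 0`, `T = 2 + 2 p`)
satisfy one of them each, so by connectedness both hold at some `0 < τ < 1`. A dilation and an
additive constant then make the two coefficients equal.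

For regularity, a radial function is of class `C ^ k` as soon as it differs from an even polynomial
by a function whose derivatives up to order `k` are `o(r ^ (k - j))` at the origin. Inverting the
radial bilaplacian raises this order by four.
-/

section Kernel

open Set Filter Topology

/-- The spherical mean of `log |x - y| - log |y|` over `|y| = s` in `ℝ⁴`, as a function of
`t = |x| / s`. -/
noncomputable def logKernel (t : ℝ) : ℝ :=
  if t ≤ 1 then t ^ 2 / 4 else Real.log t + (t ^ 2)⁻¹ / 4

/-- The logarithmic derivative `t * logKernel' t`. -/
noncomputable def fluxKernel (t : ℝ) : ℝ :=
  if t ≤ 1 then t ^ 2 / 2 else 1 - (t ^ 2)⁻¹ / 2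

/-- The kernel of the Volterra operator inverting the radial bilaplacian. -/
noncomputable def volterraKernel (t : ℝ) : ℝ :=
  if t ≤ 1 then 0 else (t ^ 2 - (t ^ 2)⁻¹) / 4 - Real.log t

lemma logKernel_eq (t : ℝ) : logKernel t = t ^ 2 / 4 - volterraKernel t := by
  unfold logKernel volterraKernel; split_ifs <;> ring

lemma continuous_volterraKernel : Continuous volterraKernel := by
  have h : volterraKernel =
      fun t => (fun u : ℝ => (u ^ 2 - (u ^ 2)⁻¹) / 4 - Real.log u) (max t 1) := by
    ext t
    unfold volterraKernel
    split_ifs with ht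
    · simp [max_eq_right ht]
    · simp [max_eq_left (not_le.1 ht).le]
  rw [h]
  have hpos : ∀ t : ℝ, max t 1 ≠ 0 := fun t => (lt_of_lt_of_le one_pos (le_max_right t 1)).ne'
  have hc : Continuous fun t : ℝ => max t 1 := continuous_id.max continuous_const
  exact (((hc.pow 2).sub ((hc.pow 2).inv₀ fun t => pow_ne_zero 2 (hpos t))).div_const 4).sub
    (hc.log hpos)

lemma continuous_logKernel : Continuous logKernel := by
  rw [show logKernel = fun t => t ^ 2 / 4 - volterraKernel t from funext logKernel_eq]
  exact ((continuous_pow 2).div_const 4).sub continuous_volterraKernel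

lemma continuous_fluxKernel : Continuous fluxKernel := by
  have h : fluxKernel = fun t => t ^ 2 / 2 - (max t 1 ^ 2 / 2 - (1 - (max t 1 ^ 2)⁻¹ / 2)) := by
    ext t
    unfold fluxKernel
    split_ifs with ht
    · rw [max_eq_right ht]; norm_num
    · rw [max_eq_left (not_le.1 ht).le]; ring
  rw [h]
  have hpos : ∀ t : ℝ, max t 1 ≠ 0 := fun t => (lt_of_lt_of_le one_pos (le_max_right t 1)).ne'
  have hc : Continuous fun t : ℝ => max t 1 := continuous_id.max continuous_const
  exact ((continuous_pow 2).div_const 2).sub (((hc.pow 2).div_const 2).sub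
    (continuous_const.sub (((hc.pow 2).inv₀ fun t => pow_ne_zero 2 (hpos t)).div_const 2)))

lemma volterraKernel_nonneg (t : ℝ) : 0 ≤ volterraKernel t := by
  unfold volterraKernel
  split_ifs with ht
  · exact le_rfl
  · have ht := not_le.1 ht
    have : 0 < t := by linarith
    have h_sinh : Real.log (t ^ 2) ≤ Real.sinh (Real.log (t ^ 2)) :=
      Real.self_le_sinh_iff.2 (Real.log_nonneg (by nlinarith))
    rw [Real.sinh_log (by positivity), Real.log_pow] at h_sinh
    push_cast at h_sinh
    linarith

lemma logKernel_nonneg (t : ℝ) : 0 ≤ logKernel t := by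
  unfold logKernel
  split_ifs with ht
  · positivity
  · have := Real.log_nonneg (not_le.1 ht).le
    positivity

lemma volterraKernel_le (t : ℝ) : volterraKernel t ≤ t ^ 2 / 4 := by
  have := logKernel_nonneg t
  rw [logKernel_eq] at this
  linarith

lemma logKernel_le {t : ℝ} (h0 : 0 ≤ t) : logKernel t ≤ 1 + t := by
  unfold logKernel
  split_ifs with ht
  · nlinarith
  · have := not_le.1 ht
    have h_log := Real.log_le_sub_one_of_pos (by linarith : 0 < t)
    have h_inv : (t ^ 2)⁻¹ ≤ 1 := inv_le_one_of_one_le₀ (by nlinarith)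
    linarith

lemma log_le_logKernel {t : ℝ} (h0 : 0 < t) : Real.log t ≤ logKernel t := by
  unfold logKernel
  split_ifs with ht
  · have := Real.log_nonpos h0.le ht
    nlinarith [sq_nonneg t]
  · have : 0 ≤ (t ^ 2)⁻¹ := by positivity
    linarith

lemma fluxKernel_pos {t : ℝ} (h0 : 0 < t) : 0 < fluxKernel t := by
  unfold fluxKernel
  split_ifs with ht
  · positivity
  · have := not_le.1 ht
    have h_inv : (t ^ 2)⁻¹ ≤ 1 := inv_le_one_of_one_le₀ (by nlinarith)
    linarith

lemma fluxKernel_nonneg (t : ℝ) : 0 ≤ fluxKernel t := by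
  rcases le_or_gt t 0 with ht | ht
  · rw [fluxKernel, if_pos (ht.trans zero_le_one)]
    positivity
  · exact (fluxKernel_pos ht).le

lemma fluxKernel_le_one {t : ℝ} (h0 : 0 ≤ t) : fluxKernel t ≤ 1 := by
  unfold fluxKernel
  split_ifs
  · nlinarith
  · have : 0 ≤ (t ^ 2)⁻¹ := by positivity
    linarith

lemma fluxKernel_add_inv {t : ℝ} (h0 : 0 < t) : fluxKernel t + fluxKernel t⁻¹ = 1 := by
  unfold fluxKernel
  rcases lt_trichotomy t 1 with h | h | h
  · rw [if_pos h.le, if_neg (not_le.2 (one_lt_inv_iff₀.2 ⟨h0, h⟩))]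
    simp
  · subst h; norm_num
  · rw [if_neg (not_le.2 h), if_pos (inv_le_one_of_one_le₀ h.le)]
    simp

lemma hasDerivAt_ite_le {f g : ℝ → ℝ} {f' c : ℝ} (hf : HasDerivAt f f' c)
    (hg : HasDerivAt g f' c) (hfg : f c = g c) :
    HasDerivAt (fun x => if x ≤ c then f x else g x) f' c := by
  have h_left : HasDerivWithinAt (fun x => if x ≤ c then f x else g x) f' (Iic c) c :=
    hf.hasDerivWithinAt.congr (fun x hx => if_pos hx) (if_pos le_rfl)
  have h_right : HasDerivWithinAt (fun x => if x ≤ c then f x else g x) f' (Ici c) c := by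
    refine hg.hasDerivWithinAt.congr (fun x hx => ?_) (by rw [if_pos le_rfl, hfg])
    rcases eq_or_lt_of_le (mem_Ici.1 hx) with rfl | hx
    · rw [if_pos le_rfl, hfg]
    · rw [if_neg hx.not_ge]
  rw [← hasDerivWithinAt_univ, ← Iic_union_Ici]
  exact h_left.union h_right

lemma hasDerivAt_logKernel {t : ℝ} (h0 : 0 < t) :
    HasDerivAt logKernel (fluxKernel t / t) t := by
  have h_inner : HasDerivAt (fun u : ℝ => u ^ 2 / 4) (t / 2) t :=
    ((hasDerivAt_pow 2 t).div_const 4).congr_deriv (by norm_num; ring)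
  have h_outer : HasDerivAt (fun u : ℝ => Real.log u + (u ^ 2)⁻¹ / 4)
      (1 / t - 1 / (2 * t ^ 3)) t := by
    refine ((Real.hasDerivAt_log h0.ne').add
      (((hasDerivAt_pow 2 t).fun_inv (pow_ne_zero 2 h0.ne')).div_const 4)).congr_deriv ?_
    field_simp
    norm_num
    ring
  rcases lt_trichotomy t 1 with h | rfl | h
  · refine (h_inner.congr_of_eventuallyEq ?_).congr_deriv ?_
    · filter_upwards [gt_mem_nhds h] with u hu
      rw [logKernel, if_pos hu.le]
    · rw [fluxKernel, if_pos h.le]; field_simp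
  · refine (hasDerivAt_ite_le h_inner (h_outer.congr_deriv ?_) ?_).congr_deriv ?_
    · norm_num
    · norm_num
    · norm_num [fluxKernel]
  · refine (h_outer.congr_of_eventuallyEq ?_).congr_deriv ?_
    · filter_upwards [lt_mem_nhds h] with u hu
      rw [logKernel, if_neg (not_le.2 hu)]
    · rw [fluxKernel, if_neg (not_le.2 h)]; field_simp

end Kernel

section Potential

open Set Filter Topology

lemma measurable_logKernel_div (r : ℝ) : Measurable fun s : ℝ => logKernel (r / s) :=
  continuous_logKernel.measurable.comp (measurable_const.div measurable_id)

lemma measurable_fluxKernel_div (r : ℝ) : Measurable fun s : ℝ => fluxKernel (r / s) :=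
  continuous_fluxKernel.measurable.comp (measurable_const.div measurable_id)

lemma integrableOn_logKernel_mul {a : ℝ → ℝ} (ha : IntegrableOn a (Ioi 0))
    (ha' : IntegrableOn (fun s => a s / s) (Ioi 0)) {r : ℝ} (hr : 0 ≤ r) :
    IntegrableOn (fun s => logKernel (r / s) * a s) (Ioi 0) := by
  refine ((ha.norm.add (ha'.norm.const_mul r))).mono'
    ((measurable_logKernel_div r).aestronglyMeasurable.mul ha.aestronglyMeasurable) ?_
  filter_upwards [ae_restrict_mem measurableSet_Ioi] with s hs
  have hs : 0 < s := hs
  rw [norm_mul, Real.norm_of_nonneg (logKernel_nonneg _)]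
  calc logKernel (r / s) * ‖a s‖ ≤ (1 + r / s) * ‖a s‖ :=
        mul_le_mul_of_nonneg_right (logKernel_le (by positivity)) (norm_nonneg _)
    _ = ‖a s‖ + r * ‖a s / s‖ := by
        rw [norm_div, Real.norm_of_nonneg hs.le]; ring

lemma integrableOn_fluxKernel_mul {a : ℝ → ℝ} (ha : IntegrableOn a (Ioi 0)) {r : ℝ}
    (hr : 0 ≤ r) : IntegrableOn (fun s => fluxKernel (r / s) * a s) (Ioi 0) := by
  refine ha.norm.mono'
    ((measurable_fluxKernel_div r).aestronglyMeasurable.mul ha.aestronglyMeasurable) ?_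
  filter_upwards [ae_restrict_mem measurableSet_Ioi] with s hs
  have hs : 0 < s := hs
  rw [norm_mul, Real.norm_of_nonneg (fluxKernel_nonneg _)]
  exact mul_le_of_le_one_left (norm_nonneg _) (fluxKernel_le_one (by positivity))

lemma hasDerivAt_integral_logKernel {a : ℝ → ℝ} (ha : IntegrableOn a (Ioi 0))
    (ha' : IntegrableOn (fun s => a s / s) (Ioi 0)) {r : ℝ} (hr : 0 < r) :
    HasDerivAt (fun r => ∫ s in Ioi 0, logKernel (r / s) * a s)
      ((∫ s in Ioi 0, fluxKernel (r / s) * a s) / r) r := by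
  have key := (hasDerivAt_integral_of_dominated_loc_of_deriv_le
    (μ := volume.restrict (Ioi (0 : ℝ))) (F := fun r s => logKernel (r / s) * a s)
    (F' := fun r s => fluxKernel (r / s) * a s / r) (bound := fun s => ‖a s‖ * (2 / r))
    (x₀ := r) (s := Ioi (r / 2)) (Ioi_mem_nhds (by linarith)) ?_
    (integrableOn_logKernel_mul ha ha' hr.le) ?_ ?_ ?_ ?_).2
  · rwa [integral_div] at key
  · exact Eventually.of_forall fun x =>
      (measurable_logKernel_div x).aestronglyMeasurable.mul ha.aestronglyMeasurable
  · exact ((integrableOn_fluxKernel_mul ha hr.le).div_const r).aestronglyMeasurable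
  · filter_upwards [ae_restrict_mem measurableSet_Ioi] with s hs x hx
    have hs : 0 < s := hs
    have hx0 : 0 < x := (half_pos hr).trans hx
    rw [norm_div, norm_mul, Real.norm_of_nonneg (fluxKernel_nonneg _), Real.norm_of_nonneg hx0.le,
      div_eq_mul_inv]
    have h_inv : x⁻¹ ≤ 2 / r := by
      rw [inv_le_comm₀ hx0 (by positivity), inv_div]; exact (mem_Ioi.1 hx).le
    exact mul_le_mul (mul_le_of_le_one_left (norm_nonneg _) (fluxKernel_le_one (by positivity)))
      h_inv (by positivity) (norm_nonneg _)
  · exact ha.norm.mul_const _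
  · filter_upwards [ae_restrict_mem measurableSet_Ioi] with s hs x hx
    have hs : 0 < s := hs
    have hx0 : 0 < x := (half_pos hr).trans hx
    have h_comp : HasDerivAt (fun x => logKernel (x / s))
        (fluxKernel (x / s) / (x / s) * (1 / s)) x :=
      HasDerivAt.comp x (hasDerivAt_logKernel (by positivity)) ((hasDerivAt_id x).div_const s)
    refine (h_comp.mul_const (a s)).congr_deriv ?_
    field_simp

/-- The pairing `∫∫ f(s) k(s / σ) g(σ) dσ ds` over `(0, ∞)²`, with `k` the flux kernel. -/
noncomputable def fluxPairing (f g : ℝ → ℝ) : ℝ :=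
  ∫ s in Ioi 0, f s * ∫ σ in Ioi 0, fluxKernel (s / σ) * g σ

lemma ae_pos_restrict_prod_Ioi :
    ∀ᵐ z : ℝ × ℝ ∂((volume.restrict (Ioi 0)).prod (volume.restrict (Ioi 0))),
      0 < z.1 ∧ 0 < z.2 := by
  rw [Measure.prod_restrict]
  exact ae_restrict_mem (measurableSet_Ioi.prod measurableSet_Ioi)

lemma integrable_fluxKernel_prod {f g : ℝ → ℝ} (hf : IntegrableOn f (Ioi 0))
    (hg : IntegrableOn g (Ioi 0)) :
    Integrable (fun z : ℝ × ℝ => f z.1 * (fluxKernel (z.1 / z.2) * g z.2))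
      ((volume.restrict (Ioi 0)).prod (volume.restrict (Ioi 0))) := by
  have hm : Measurable fun z : ℝ × ℝ => fluxKernel (z.1 / z.2) :=
    continuous_fluxKernel.measurable.comp (measurable_fst.div measurable_snd)
  have hfg := Integrable.mul_prod hf hg
  have h_bound : Integrable (fun z : ℝ × ℝ => fluxKernel (z.1 / z.2) * (f z.1 * g z.2))
      ((volume.restrict (Ioi 0)).prod (volume.restrict (Ioi 0))) := by
    refine hfg.norm.mono' (hm.aestronglyMeasurable.mul hfg.aestronglyMeasurable) ?_
    filter_upwards [ae_pos_restrict_prod_Ioi] with z hz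
    rw [norm_mul, Real.norm_of_nonneg (fluxKernel_nonneg _)]
    exact mul_le_of_le_one_left (norm_nonneg _) (fluxKernel_le_one (div_pos hz.1 hz.2).le)
  exact h_bound.congr (Eventually.of_forall fun z => mul_left_comm _ _ _)

lemma fluxPairing_eq_prod {f g : ℝ → ℝ} (hf : IntegrableOn f (Ioi 0))
    (hg : IntegrableOn g (Ioi 0)) :
    fluxPairing f g = ∫ z, f z.1 * (fluxKernel (z.1 / z.2) * g z.2)
      ∂((volume.restrict (Ioi 0)).prod (volume.restrict (Ioi 0))) := by
  rw [integral_prod _ (integrable_fluxKernel_prod hf hg), fluxPairing]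
  simp_rw [integral_const_mul]

lemma fluxPairing_add_swap {f g : ℝ → ℝ} (hf : IntegrableOn f (Ioi 0))
    (hg : IntegrableOn g (Ioi 0)) :
    fluxPairing f g + fluxPairing g f = (∫ s in Ioi 0, f s) * ∫ s in Ioi 0, g s := by
  have hswap : ∫ z, g z.1 * (fluxKernel (z.1 / z.2) * f z.2)
      ∂((volume.restrict (Ioi (0 : ℝ))).prod (volume.restrict (Ioi (0 : ℝ)))) =
      ∫ z, g z.2 * (fluxKernel (z.2 / z.1) * f z.1)
      ∂((volume.restrict (Ioi (0 : ℝ))).prod (volume.restrict (Ioi (0 : ℝ)))) :=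
    (integral_prod_swap (fun z : ℝ × ℝ => g z.1 * (fluxKernel (z.1 / z.2) * f z.2))).symm
  have hint : Integrable (fun z : ℝ × ℝ => g z.2 * (fluxKernel (z.2 / z.1) * f z.1))
      ((volume.restrict (Ioi (0 : ℝ))).prod (volume.restrict (Ioi (0 : ℝ)))) :=
    (integrable_fluxKernel_prod hg hf).swap
  rw [fluxPairing_eq_prod hf hg, fluxPairing_eq_prod hg hf, hswap,
    ← integral_add (integrable_fluxKernel_prod hf hg) hint,
    ← integral_prod_mul]
  refine integral_congr_ae ?_
  filter_upwards [ae_pos_restrict_prod_Ioi] with z hz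
  have h_sum := fluxKernel_add_inv (div_pos hz.1 hz.2)
  rw [inv_div] at h_sum
  linear_combination f z.1 * g z.2 * h_sum

lemma integrableOn_mul_flux {f g : ℝ → ℝ} (hf : IntegrableOn f (Ioi 0))
    (hg : IntegrableOn g (Ioi 0)) :
    IntegrableOn (fun s => f s * ∫ σ in Ioi 0, fluxKernel (s / σ) * g σ) (Ioi 0) := by
  have := (integrable_fluxKernel_prod hf hg).integral_prod_left
  simp_rw [integral_const_mul] at this
  exact this

lemma fluxPairing_self {f : ℝ → ℝ} (hf : IntegrableOn f (Ioi 0)) :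
    fluxPairing f f = (∫ s in Ioi 0, f s) ^ 2 / 2 := by
  have := fluxPairing_add_swap hf hf
  linarith

lemma fluxPairing_add_right {f g h : ℝ → ℝ} (hf : IntegrableOn f (Ioi 0))
    (hg : IntegrableOn g (Ioi 0)) (hh : IntegrableOn h (Ioi 0)) :
    fluxPairing f (fun s => g s + h s) = fluxPairing f g + fluxPairing f h := by
  unfold fluxPairing
  rw [← integral_add (integrableOn_mul_flux hf hg) (integrableOn_mul_flux hf hh)]
  refine setIntegral_congr_fun measurableSet_Ioi fun s hs => ?_
  have hs : 0 < s := hs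
  simp only
  rw [← mul_add, ← integral_add (integrableOn_fluxKernel_mul hg hs.le)
    (integrableOn_fluxKernel_mul hh hs.le)]
  simp_rw [mul_add]

lemma setIntegral_Ioi_pos {h : ℝ → ℝ} (hi : IntegrableOn h (Ioi 0)) (h0 : ∀ s, 0 < s → 0 < h s) :
    0 < ∫ s in Ioi 0, h s := by
  rw [setIntegral_pos_iff_support_of_nonneg_ae
    ((ae_restrict_mem measurableSet_Ioi).mono fun s hs => (h0 s hs).le) hi]
  have : Function.support h ∩ Ioi 0 = Ioi 0 :=
    inter_eq_self_of_subset_right fun s hs => (h0 s hs).ne'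
  simp [this]

lemma fluxPairing_pos {f g : ℝ → ℝ} (hf : IntegrableOn f (Ioi 0))
    (hg : IntegrableOn g (Ioi 0)) (hf0 : ∀ s, 0 < s → 0 < f s) (hg0 : ∀ s, 0 < s → 0 < g s) :
    0 < fluxPairing f g := by
  refine setIntegral_Ioi_pos (integrableOn_mul_flux hf hg) fun s hs => mul_pos (hf0 s hs) ?_
  exact setIntegral_Ioi_pos (integrableOn_fluxKernel_mul hg hs.le) fun σ hσ =>
    mul_pos (fluxKernel_pos (div_pos hs hσ)) (hg0 σ hσ)
end Potential

section Pohozaev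

open Set Filter Topology

/-- The density `Q(s) e^{4U(s)} s³` of the mass of the profile `U` with curvature profile `Q`, with
respect to the radius. -/
noncomputable def radialDensity (Q U : ℝ → ℝ) (s : ℝ) : ℝ :=
  Q s * Real.exp (4 * U s) * s ^ 3

/-- The total mass of the profile `U` with curvature profile `Q`. -/
noncomputable def radialMass (Q U : ℝ → ℝ) : ℝ :=
  ∫ s in Ioi 0, radialDensity Q U s

lemma eq_zero_of_tendsto_of_integrableOn_div {f : ℝ → ℝ} {a m : ℝ}
    (hlim : Tendsto f atTop (𝓝 m)) (hint : IntegrableOn (fun r => f r / r) (Ioi a)) : m = 0 := by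
  by_contra hm
  obtain ⟨R, hR⟩ := eventually_atTop.1
    (hlim.norm.eventually (lt_mem_nhds (half_lt_self (norm_pos_iff.2 hm))))
  refine not_integrableOn_Ioi_inv (a := max a (max R 1)) ?_
  have hsub : Ioi (max a (max R 1)) ⊆ Ioi a := Ioi_subset_Ioi (le_max_left _ _)
  refine ((hint.mono_set hsub).norm.const_mul (2 / ‖m‖)).mono'
    measurable_inv.aestronglyMeasurable ?_
  filter_upwards [ae_restrict_mem measurableSet_Ioi] with r hr
  have hRr : R ≤ r := (le_max_left _ _).trans ((le_max_right _ _).trans (mem_Ioi.1 hr).le)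
  have hr0 : 0 < r :=
    one_pos.trans_le ((le_max_right _ _).trans ((le_max_right _ _).trans (mem_Ioi.1 hr).le))
  have hm0 : 0 < ‖m‖ := norm_pos_iff.2 hm
  have h_half := hR r hRr
  rw [norm_inv, norm_div, Real.norm_of_nonneg hr0.le, inv_eq_one_div, ← mul_div_assoc]
  refine div_le_div_of_nonneg_right ?_ hr0.le
  rw [div_mul_eq_mul_div, le_div_iff₀ hm0]
  linarith

lemma radialDensity_rpow_mul_self (κ q : ℝ) (U : ℝ → ℝ) {r : ℝ} (hr : 0 < r) :
    κ * r ^ (q + 4) * Real.exp (4 * U r) = radialDensity (fun s => κ * s ^ q) U r * r := by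
  rw [radialDensity, show q + 4 = q + (4 : ℕ) by norm_num, Real.rpow_add hr, Real.rpow_natCast]
  ring

lemma hasDerivAt_rpow_mul_exp {κ q D r : ℝ} {U : ℝ → ℝ} (hr : 0 < r)
    (hU : HasDerivAt U (-(D / r)) r) :
    HasDerivAt (fun x => κ * x ^ (q + 4) * Real.exp (4 * U x))
      ((q + 4) * radialDensity (fun s => κ * s ^ q) U r -
        4 * (radialDensity (fun s => κ * s ^ q) U r * D)) r := by
  refine (((Real.hasDerivAt_rpow_const (p := q + 4) (Or.inl hr.ne')).const_mul κ).mul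
    ((hU.const_mul 4).exp)).congr_deriv ?_
  rw [radialDensity, show q + 4 - 1 = q + (3 : ℕ) by push_cast; ring, Real.rpow_add hr,
    show q + 4 = q + (4 : ℕ) by push_cast; ring, Real.rpow_add hr, Real.rpow_natCast,
    Real.rpow_natCast]
  field_simp
  push_cast
  ring

lemma continuousWithinAt_rpow_mul_exp_zero {κ q C : ℝ} {U : ℝ → ℝ} (hq : 0 < q)
    (hU : ∀ r, 0 < r → U r ≤ C) :
    ContinuousWithinAt (fun r => κ * r ^ q * Real.exp (4 * U r)) (Ici 0) 0 := by
  have h_bound : Tendsto (fun r : ℝ => |κ| * r ^ q * Real.exp (4 * C)) (𝓝[Ici 0] 0) (𝓝 0) := by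
    have h_cont : Continuous fun r : ℝ => |κ| * r ^ q * Real.exp (4 * C) :=
      (continuous_const.mul (Real.continuous_rpow_const hq.le)).mul continuous_const
    have h_tendsto := h_cont.tendsto 0
    simp only [Real.zero_rpow hq.ne', mul_zero, zero_mul] at h_tendsto
    exact h_tendsto.mono_left nhdsWithin_le_nhds
  rw [ContinuousWithinAt, Real.zero_rpow hq.ne', mul_zero, zero_mul]
  refine squeeze_zero_norm' ?_ h_bound
  filter_upwards [self_mem_nhdsWithin] with r hr
  rw [norm_mul, norm_mul, Real.norm_of_nonneg (Real.exp_pos _).le, Real.norm_eq_abs,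
    Real.norm_of_nonneg (Real.rpow_nonneg hr _)]
  rcases eq_or_lt_of_le (mem_Ici.1 hr) with rfl | hr0
  · simp [Real.zero_rpow hq.ne']
  · gcongr
    exact hU r hr0

/-- Integrate the derivative of `κ r^{q+4} e^{4U}` over `(0, ∞)`; the boundary terms vanish. -/
theorem pohozaev_identity {a U : ℝ → ℝ} {C κ q : ℝ} (hq : -4 < q) (ha : IntegrableOn a (Ioi 0))
    (ha' : IntegrableOn (fun s => a s / s) (Ioi 0)) (ha0 : ∀ s, 0 < s → 0 ≤ a s)
    (hU : ∀ r, 0 < r → U r = C - ∫ s in Ioi 0, logKernel (r / s) * a s)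
    (hw : IntegrableOn (radialDensity (fun s => κ * s ^ q) U) (Ioi 0)) :
    (1 + q / 4) * radialMass (fun s => κ * s ^ q) U =
      fluxPairing (radialDensity (fun s => κ * s ^ q) U) a := by
  set w : ℝ → ℝ := radialDensity (fun s => κ * s ^ q) U with hw_def
  set D : ℝ → ℝ := fun s => ∫ σ in Ioi 0, fluxKernel (s / σ) * a σ
  set F : ℝ → ℝ := fun r => κ * r ^ (q + 4) * Real.exp (4 * U r) with hF
  have hU' : ∀ r, 0 < r → HasDerivAt U (-(D r / r)) r := fun r hr => by
    refine ((hasDerivAt_integral_logKernel ha ha' hr).const_sub C).congr_of_eventuallyEq ?_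
    filter_upwards [lt_mem_nhds hr] with x hx using hU x hx
  have hF' : ∀ r ∈ Ioi (0 : ℝ), HasDerivAt F ((q + 4) * w r - 4 * (w r * D r)) r :=
    fun r hr => hasDerivAt_rpow_mul_exp hr (hU' r hr)
  have hwD : IntegrableOn (fun s => w s * D s) (Ioi 0) := integrableOn_mul_flux hw ha
  have hF'_int : IntegrableOn (fun r => (q + 4) * w r - 4 * (w r * D r)) (Ioi 0) :=
    (hw.const_mul _).sub (hwD.const_mul _)
  have hU_le : ∀ r, 0 < r → U r ≤ C := fun r hr => by
    rw [hU r hr, sub_le_self_iff]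
    exact setIntegral_nonneg measurableSet_Ioi fun s hs =>
      mul_nonneg (logKernel_nonneg _) (ha0 s hs)
  have hF_cont : ContinuousWithinAt F (Ici 0) 0 :=
    continuousWithinAt_rpow_mul_exp_zero (by linarith) hU_le
  have hF_zero : F 0 = 0 := by simp [hF, Real.zero_rpow (by linarith : q + 4 ≠ 0)]
  have hF_lim := tendsto_limUnder_of_hasDerivAt_of_integrableOn_Ioi hF' hF'_int
  rw [eq_zero_of_tendsto_of_integrableOn_div hF_lim (hw.congr_fun (fun r hr => by
    simp only [hF, hw_def, radialDensity_rpow_mul_self κ q U hr,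
      mul_div_cancel_right₀ _ (ne_of_gt (mem_Ioi.1 hr))])
    measurableSet_Ioi)] at hF_lim
  have h_ftc := integral_Ioi_of_hasDerivAt_of_tendsto hF_cont hF' hF'_int hF_lim
  rw [hF_zero, integral_sub (hw.const_mul _) (hwD.const_mul _), integral_const_mul,
    integral_const_mul] at h_ftc
  change (1 + q / 4) * ∫ s in Ioi 0, w s = ∫ s in Ioi 0, w s * D s
  linarith

end Pohozaev

section RadialNormal

open Set Filter Topology

/-- Radial profiles `U` of normal solutions with curvature profile `Q`, the dimensional constant
being absorbed into `Q`. -/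
structure IsRadialNormal (Q U : ℝ → ℝ) : Prop where
  continuous : Continuous U
  integrable : IntegrableOn (radialDensity Q U) (Ioi 0)
  exists_eq : ∃ C, ∀ r, 0 ≤ r → U r = C - ∫ s in Ioi 0, logKernel (r / s) * radialDensity Q U s

/-- The curvature profile `c + d s^{4p}`; the paper's `1 + |x|^{4p}` up to the choice of `c` and
`d`, which rescaling makes available. -/
noncomputable def powerProfile (p c d s : ℝ) : ℝ :=
  c + d * s ^ (4 * p)

/-- The mass contributed by the constant part of the profile `c + d s^{4p}`. -/
noncomputable def headMass (c : ℝ) (U : ℝ → ℝ) : ℝ :=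
  radialMass (fun _ => c) U

/-- The mass contributed by the growing part of the profile `c + d s^{4p}`. -/
noncomputable def tailMass (p d : ℝ) (U : ℝ → ℝ) : ℝ :=
  radialMass (fun s => d * s ^ (4 * p)) U

variable {Q U : ℝ → ℝ} {p c d : ℝ}

lemma continuous_radialDensity (hQ : Continuous Q) (hU : Continuous U) :
    Continuous (radialDensity Q U) :=
  (hQ.mul (Real.continuous_exp.comp (continuous_const.mul hU))).mul (continuous_pow 3)

lemma radialDensity_nonneg {s : ℝ} (hQ : 0 ≤ Q s) (hs : 0 ≤ s) : 0 ≤ radialDensity Q U s := by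
  unfold radialDensity
  positivity

lemma radialDensity_pos {s : ℝ} (hQ : 0 < Q s) (hs : 0 < s) : 0 < radialDensity Q U s := by
  unfold radialDensity
  positivity

lemma radialMass_nonneg (hQ : ∀ s, 0 < s → 0 ≤ Q s) : 0 ≤ radialMass Q U :=
  setIntegral_nonneg measurableSet_Ioi fun s hs => radialDensity_nonneg (hQ s hs) (le_of_lt hs)

lemma radialMass_pos (h : IntegrableOn (radialDensity Q U) (Ioi 0)) (hQ : ∀ s, 0 < s → 0 < Q s) :
    0 < radialMass Q U :=
  setIntegral_Ioi_pos h fun s hs => radialDensity_pos (hQ s hs) hs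

lemma integrableOn_radialDensity_div (hQ : Continuous Q) (hU : Continuous U)
    (h : IntegrableOn (radialDensity Q U) (Ioi 0)) :
    IntegrableOn (fun s => radialDensity Q U s / s) (Ioi 0) := by
  have h_cont : Continuous fun s : ℝ => Q s * Real.exp (4 * U s) * s ^ 2 :=
    (hQ.mul (Real.continuous_exp.comp (continuous_const.mul hU))).mul (continuous_pow 2)
  have h_eq : ∀ s ∈ Ioi (0 : ℝ), Q s * Real.exp (4 * U s) * s ^ 2 = radialDensity Q U s / s :=
    fun s hs => by
      have : s ≠ 0 := ne_of_gt hs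
      rw [radialDensity]
      field_simp
  refine IntegrableOn.congr_fun ?_ h_eq measurableSet_Ioi
  rw [← Ioc_union_Ioi_eq_Ioi zero_le_one]
  refine IntegrableOn.union
    ((h_cont.integrableOn_Icc (a := 0) (b := 1)).mono_set Ioc_subset_Icc_self) ?_
  refine (h.mono_set (Ioi_subset_Ioi zero_le_one)).norm.mono' h_cont.aestronglyMeasurable ?_
  filter_upwards [ae_restrict_mem measurableSet_Ioi] with s hs
  have hs1 : 1 < s := hs
  rw [radialDensity, norm_mul, norm_mul _ (s ^ 3), Real.norm_of_nonneg (by positivity : 0 ≤ s ^ 2),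
    Real.norm_of_nonneg (by positivity : 0 ≤ s ^ 3)]
  gcongr
  · exact hs1.le
  · norm_num

lemma continuous_powerProfile (hp : 0 ≤ p) (c d : ℝ) : Continuous (powerProfile p c d) :=
  continuous_const.add (continuous_const.mul (Real.continuous_rpow_const (by positivity)))

lemma powerProfile_nonneg (hc : 0 ≤ c) (hd : 0 ≤ d) {s : ℝ} (hs : 0 ≤ s) :
    0 ≤ powerProfile p c d s := by
  unfold powerProfile
  positivity

lemma headMass_nonneg (hc : 0 ≤ c) (U : ℝ → ℝ) : 0 ≤ headMass c U :=
  radialMass_nonneg fun _ _ => hc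

lemma tailMass_nonneg (p : ℝ) (hd : 0 ≤ d) (U : ℝ → ℝ) : 0 ≤ tailMass p d U :=
  radialMass_nonneg fun _ hs => mul_nonneg hd (Real.rpow_nonneg hs.le _)

theorem IsRadialNormal.pohozaev_rpow (h : IsRadialNormal Q U) (hQ : Continuous Q)
    (hQ0 : ∀ s, 0 < s → 0 ≤ Q s) {κ q : ℝ} (hq : -4 < q)
    (hκ : IntegrableOn (radialDensity (fun s => κ * s ^ q) U) (Ioi 0)) :
    (1 + q / 4) * radialMass (fun s => κ * s ^ q) U =
      fluxPairing (radialDensity (fun s => κ * s ^ q) U) (radialDensity Q U) := by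
  obtain ⟨C, hC⟩ := h.exists_eq
  exact pohozaev_identity hq h.integrable
    (integrableOn_radialDensity_div hQ h.continuous h.integrable)
    (fun s hs => radialDensity_nonneg (hQ0 s hs) hs.le) (fun r hr => hC r hr.le) hκ

lemma IsRadialNormal.integrable_head (h : IsRadialNormal (powerProfile p c d) U) (hc : 0 ≤ c)
    (hd : 0 ≤ d) : IntegrableOn (radialDensity (fun _ => c) U) (Ioi 0) := by
  refine h.integrable.mono'
    (continuous_radialDensity continuous_const h.continuous).aestronglyMeasurable ?_
  filter_upwards [ae_restrict_mem measurableSet_Ioi] with s hs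
  have hs : 0 < s := hs
  rw [Real.norm_of_nonneg (radialDensity_nonneg hc hs.le), radialDensity, radialDensity,
    powerProfile]
  gcongr
  exact le_add_of_nonneg_right (by positivity)

lemma radialDensity_powerProfile (p c d : ℝ) (U : ℝ → ℝ) (s : ℝ) :
    radialDensity (powerProfile p c d) U s =
      radialDensity (fun _ => c) U s + radialDensity (fun s => d * s ^ (4 * p)) U s := by
  simp only [radialDensity, powerProfile]
  ring

lemma IsRadialNormal.integrable_tail (h : IsRadialNormal (powerProfile p c d) U) (hc : 0 ≤ c)
    (hd : 0 ≤ d) : IntegrableOn (radialDensity (fun s => d * s ^ (4 * p)) U) (Ioi 0) :=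
  (h.integrable.sub (h.integrable_head hc hd)).congr (Eventually.of_forall fun s =>
    sub_eq_of_eq_add' (radialDensity_powerProfile p c d U s))

lemma IsRadialNormal.radialMass_eq (h : IsRadialNormal (powerProfile p c d) U) (hc : 0 ≤ c)
    (hd : 0 ≤ d) : radialMass (powerProfile p c d) U = headMass c U + tailMass p d U := by
  rw [headMass, tailMass, radialMass, radialMass, radialMass,
    ← integral_add (h.integrable_head hc hd) (h.integrable_tail hc hd)]
  exact integral_congr_ae (Eventually.of_forall (radialDensity_powerProfile p c d U))

lemma IsRadialNormal.fluxPairing_eq (h : IsRadialNormal (powerProfile p c d) U) (hc : 0 ≤ c)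
    (hd : 0 ≤ d) {f : ℝ → ℝ} (hf : IntegrableOn f (Ioi 0)) :
    fluxPairing f (radialDensity (powerProfile p c d) U) =
      fluxPairing f (radialDensity (fun _ => c) U) +
        fluxPairing f (radialDensity (fun s => d * s ^ (4 * p)) U) := by
  rw [← fluxPairing_add_right hf (h.integrable_head hc hd) (h.integrable_tail hc hd)]
  exact congrArg _ (funext (radialDensity_powerProfile p c d U))

lemma IsRadialNormal.headMass_eq (h : IsRadialNormal (powerProfile p c d) U) (hp : 0 ≤ p)
    (hc : 0 ≤ c) (hd : 0 ≤ d) : headMass c U = headMass c U ^ 2 / 2 +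
      fluxPairing (radialDensity (fun _ => c) U) (radialDensity (fun s => d * s ^ (4 * p)) U) := by
  have h_head := h.integrable_head hc hd
  have h_const : (fun s : ℝ => c * s ^ (0 : ℝ)) = fun _ => c := by simp
  have h_poh := h.pohozaev_rpow (continuous_powerProfile hp c d)
    (fun s hs => powerProfile_nonneg hc hd hs.le) (κ := c) (q := 0) (by norm_num)
    (by rwa [h_const])
  rwa [h_const, zero_div, add_zero, one_mul, h.fluxPairing_eq hc hd h_head,
    fluxPairing_self h_head] at h_poh

lemma IsRadialNormal.tailMass_eq (h : IsRadialNormal (powerProfile p c d) U) (hp : 0 ≤ p)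
    (hc : 0 ≤ c) (hd : 0 ≤ d) : (1 + p) * tailMass p d U =
      fluxPairing (radialDensity (fun s => d * s ^ (4 * p)) U) (radialDensity (fun _ => c) U) +
        tailMass p d U ^ 2 / 2 := by
  have h_tail := h.integrable_tail hc hd
  have h_poh := h.pohozaev_rpow (continuous_powerProfile hp c d)
    (fun s hs => powerProfile_nonneg hc hd hs.le) (by linarith) h_tail
  rwa [mul_div_cancel_left₀ p four_ne_zero, h.fluxPairing_eq hc hd h_tail,
    fluxPairing_self h_tail] at h_poh

theorem IsRadialNormal.pohozaev (h : IsRadialNormal (powerProfile p c d) U) (hp : 0 ≤ p)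
    (hc : 0 ≤ c) (hd : 0 ≤ d) : headMass c U + (1 + p) * tailMass p d U =
      (headMass c U + tailMass p d U) ^ 2 / 2 := by
  have h_swap := fluxPairing_add_swap (h.integrable_head hc hd) (h.integrable_tail hc hd)
  rw [← radialMass, ← radialMass, ← headMass, ← tailMass] at h_swap
  linear_combination h.headMass_eq hp hc hd + h.tailMass_eq hp hc hd + h_swap

lemma IsRadialNormal.headMass_pos (h : IsRadialNormal (powerProfile p c d) U) (hc : 0 < c)
    (hd : 0 ≤ d) : 0 < headMass c U :=
  radialMass_pos (h.integrable_head hc.le hd) fun _ _ => hc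

lemma IsRadialNormal.tailMass_pos (h : IsRadialNormal (powerProfile p c d) U) (hc : 0 ≤ c)
    (hd : 0 < d) : 0 < tailMass p d U :=
  radialMass_pos (h.integrable_tail hc hd.le) fun _ hs => mul_pos hd (Real.rpow_pos_of_pos hs _)

lemma IsRadialNormal.headMass_lt_two (h : IsRadialNormal (powerProfile p c d) U) (hp : 0 ≤ p)
    (hc : 0 < c) (hd : 0 < d) : headMass c U < 2 := by
  have h_cross : 0 < fluxPairing (radialDensity (fun _ => c) U)
      (radialDensity (fun s => d * s ^ (4 * p)) U) :=
    fluxPairing_pos (h.integrable_head hc.le hd.le) (h.integrable_tail hc.le hd.le)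
      (fun s hs => radialDensity_pos hc hs)
      (fun s hs => radialDensity_pos (mul_pos hd (Real.rpow_pos_of_pos hs _)) hs)
  nlinarith [h.headMass_eq hp hc.le hd.le, h.headMass_pos hc hd.le]

theorem IsRadialNormal.mass_mem_Ioo (h : IsRadialNormal (powerProfile p c d) U) (hp : 0 < p)
    (hc : 0 < c) (hd : 0 < d) :
    headMass c U + tailMass p d U ∈ Ioo (max 2 (2 * p)) (2 + 2 * p) := by
  have h_poh := h.pohozaev hp.le hc.le hd.le
  have h_head_lt := h.headMass_lt_two hp.le hc hd
  have h_head_pos := h.headMass_pos hc hd.le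
  have h_tail_pos := h.tailMass_pos hc.le hd
  set x := headMass c U
  set y := tailMass p d U
  have hpx : 0 < p * x := mul_pos hp h_head_pos
  have hpy : 0 < p * y := mul_pos hp h_tail_pos
  refine ⟨max_lt (by nlinarith) ?_, by nlinarith⟩
  have h_factor : (x + y - 2) * (x + y - 2 * p) = 2 * p * (2 - x) := by
    linear_combination -2 * h_poh
  have h_prod_pos : 0 < 2 * p * (2 - x) := by
    have : 0 < 2 - x := by linarith
    positivity
  nlinarith [h_factor, h_prod_pos]

lemma IsRadialNormal.mass_le (h : IsRadialNormal (powerProfile p c d) U) (hp : 0 ≤ p)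
    (hc : 0 ≤ c) (hd : 0 ≤ d) : headMass c U + tailMass p d U ≤ 2 + 2 * p := by
  by_contra! h_lt
  have h_head : 0 ≤ p * headMass c U := mul_nonneg hp (headMass_nonneg hc U)
  nlinarith [h.pohozaev hp hc hd, tailMass_nonneg p hd U]

end RadialNormal

section Volterra

open Set Filter Topology

/-- The truncated exponential nonlinearity `e^{4 min(u, 0)}`. -/
noncomputable def cappedExp (u : ℝ) : ℝ := Real.exp (4 * min u 0)

lemma cappedExp_pos (u : ℝ) : 0 < cappedExp u := Real.exp_pos _

lemma cappedExp_le_one (u : ℝ) : cappedExp u ≤ 1 :=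
  Real.exp_le_one_iff.2 (by linarith [min_le_right u 0])

lemma cappedExp_mono : Monotone cappedExp := fun u v h =>
  Real.exp_le_exp.2 (by linarith [min_le_min_right 0 h])

lemma cappedExp_le_exp (u : ℝ) : cappedExp u ≤ Real.exp (4 * u) :=
  Real.exp_le_exp.2 (by linarith [min_le_left u 0])

lemma cappedExp_of_nonpos {u : ℝ} (h : u ≤ 0) : cappedExp u = Real.exp (4 * u) := by
  rw [cappedExp, min_eq_left h]

lemma continuous_cappedExp : Continuous cappedExp :=
  Real.continuous_exp.comp (continuous_const.mul (continuous_id.min continuous_const))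

lemma abs_cappedExp_sub_le (u v : ℝ) : |cappedExp u - cappedExp v| ≤ 4 * |u - v| := by
  wlog h : v ≤ u generalizing u v
  · rw [abs_sub_comm, abs_sub_comm u]; exact this v u (not_le.1 h).le
  rw [abs_of_nonneg (sub_nonneg.2 (cappedExp_mono h)), abs_of_nonneg (sub_nonneg.2 h)]
  have h_mul : cappedExp v = cappedExp u * Real.exp (4 * min v 0 - 4 * min u 0) := by
    rw [cappedExp, cappedExp, ← Real.exp_add]; congr 1; ring
  have h_exp := Real.add_one_le_exp (4 * min v 0 - 4 * min u 0)
  have h_min : min u 0 - min v 0 ≤ u - v := by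
    rcases min_cases u 0 with h | h <;> rcases min_cases v 0 with h' | h' <;> linarith
  have h_min_mono : min v 0 ≤ min u 0 := min_le_min_right 0 h
  rw [h_mul]
  nlinarith [h_exp, h_min, h_min_mono, cappedExp_le_one u, cappedExp_pos u]

lemma volterraKernel_mul_nonneg {s : ℝ} (hs : 0 < s) (r : ℝ) :
    0 ≤ volterraKernel (r / s) * s ^ 3 := mul_nonneg (volterraKernel_nonneg _) (by positivity)

lemma volterraKernel_of_le {r s : ℝ} (hs : 0 < s) (h : r ≤ s) : volterraKernel (r / s) = 0 := by
  rw [volterraKernel, if_pos ((div_le_one hs).2 h)]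

lemma volterraKernel_mul_le (r : ℝ) {s : ℝ} (hs : 0 < s) :
    volterraKernel (r / s) * s ^ 3 ≤ r ^ 2 * (s / 4) := by
  have h := mul_le_mul_of_nonneg_right (volterraKernel_le (r / s)) (by positivity : 0 ≤ s ^ 3)
  refine h.trans (le_of_eq ?_)
  field_simp

/-- For `r ≤ R`, a majorant of the integrand of the Volterra operator at radius `r`. -/
noncomputable def volterraMajorant (R : ℝ) (Q : ℝ → ℝ) : ℝ → ℝ :=
  (Ioc 0 R).indicator fun s => R ^ 2 * (s / 4) * |Q s|

/-- The Volterra operator `u ↦ b r² + (Δ²)⁻¹ (Q e^{4 min(u, 0)})`. -/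
noncomputable def volterraOp (b : ℝ) (Q u : ℝ → ℝ) (r : ℝ) : ℝ :=
  b * r ^ 2 + ∫ s in Ioi 0, volterraKernel (r / s) * s ^ 3 * (Q s * cappedExp (u s))

lemma integrableOn_volterraMajorant {Q : ℝ → ℝ} (hQ : Continuous Q) (R : ℝ) :
    IntegrableOn (volterraMajorant R Q) (Ioi 0) := by
  have h_cont : Continuous fun s : ℝ => R ^ 2 * (s / 4) * |Q s| :=
    (continuous_const.mul (continuous_id.div_const 4)).mul hQ.abs
  exact ((integrable_indicator_iff measurableSet_Ioc).2
    (h_cont.integrableOn_Icc.mono_set Ioc_subset_Icc_self)).integrableOn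

lemma norm_volterra_integrand_le {r R s v : ℝ} (Q : ℝ → ℝ) (hr : r ≤ R) (hs : 0 < s)
    (hv : 0 ≤ v) (hv1 : v ≤ 1) :
    ‖volterraKernel (r / s) * s ^ 3 * (Q s * v)‖ ≤ volterraMajorant R Q s := by
  have h_nonneg : 0 ≤ volterraMajorant R Q s :=
    indicator_nonneg (fun s hs => mul_nonneg
      (mul_nonneg (sq_nonneg R) (div_nonneg hs.1.le zero_le_four)) (abs_nonneg _)) s
  rcases le_or_gt r s with hrs | hsr
  · rwa [volterraKernel_of_le hs hrs, zero_mul, zero_mul, norm_zero]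
  · rw [volterraMajorant, indicator_of_mem (show s ∈ Ioc 0 R from ⟨hs, hsr.le.trans hr⟩), norm_mul,
      norm_mul (Q s), Real.norm_of_nonneg (volterraKernel_mul_nonneg hs r),
      Real.norm_of_nonneg hv, Real.norm_eq_abs]
    refine mul_le_mul ((volterraKernel_mul_le r hs).trans ?_)
      (mul_le_of_le_one_right (abs_nonneg _) hv1) (mul_nonneg (abs_nonneg _) hv) (by positivity)
    have : 0 ≤ r := (hs.trans hsr).le
    gcongr

lemma aestronglyMeasurable_volterra {Q u : ℝ → ℝ} (hQ : Continuous Q) (hu : Measurable u) (r : ℝ)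
    (μ : Measure ℝ) : AEStronglyMeasurable
      (fun s => volterraKernel (r / s) * s ^ 3 * (Q s * cappedExp (u s))) μ :=
  (((continuous_volterraKernel.measurable.comp (measurable_const.div measurable_id)).mul
    (measurable_id.pow_const 3)).mul
    (hQ.measurable.mul (continuous_cappedExp.measurable.comp hu))).aestronglyMeasurable

lemma integrableOn_volterra {Q u : ℝ → ℝ} (hQ : Continuous Q) (hu : Measurable u) (r : ℝ) :
    IntegrableOn (fun s => volterraKernel (r / s) * s ^ 3 * (Q s * cappedExp (u s))) (Ioi 0) := by
  refine (integrableOn_volterraMajorant hQ |r|).mono' (aestronglyMeasurable_volterra hQ hu r _) ?_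
  filter_upwards [ae_restrict_mem measurableSet_Ioi] with s hs
  exact norm_volterra_integrand_le Q (le_abs_self r) hs (cappedExp_pos _).le
    (cappedExp_le_one _)

lemma continuous_volterraOp {Q u : ℝ → ℝ} (b : ℝ) (hQ : Continuous Q) (hu : Measurable u) :
    Continuous (volterraOp b Q u) := by
  refine (continuous_const.mul (continuous_pow 2)).add (continuous_iff_continuousAt.2 fun r => ?_)
  refine continuousAt_of_dominated
    (bound := volterraMajorant (|r| + 1) Q)
    (Eventually.of_forall fun x => aestronglyMeasurable_volterra hQ hu x _) ?_
    (integrableOn_volterraMajorant hQ _) ?_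
  · filter_upwards [gt_mem_nhds (lt_add_one r)] with x hx
    filter_upwards [ae_restrict_mem measurableSet_Ioi] with s hs
    exact norm_volterra_integrand_le Q
      (hx.le.trans (by linarith [le_abs_self r])) hs (cappedExp_pos _).le (cappedExp_le_one _)
  · exact Eventually.of_forall fun s => (((continuous_volterraKernel.comp (continuous_id.div_const
      s)).mul continuous_const).mul continuous_const).continuousAt

lemma volterraOp_mono {Q u v : ℝ → ℝ} {b c : ℝ} (hQ : Continuous Q) (hQ0 : ∀ s, 0 < s → 0 ≤ Q s)
    (hu : Measurable u) (hv : Measurable v) (hbc : b ≤ c) (h : ∀ s, 0 < s → u s ≤ v s) (r : ℝ) :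
    volterraOp b Q u r ≤ volterraOp c Q v r := by
  refine add_le_add (mul_le_mul_of_nonneg_right hbc (sq_nonneg r))
    (setIntegral_mono_on (integrableOn_volterra hQ hu r) (integrableOn_volterra hQ hv r)
      measurableSet_Ioi fun s hs => ?_)
  exact mul_le_mul_of_nonneg_left (mul_le_mul_of_nonneg_left (cappedExp_mono (h s hs)) (hQ0 s hs))
    (volterraKernel_mul_nonneg hs r)

/-- Picard iterates of the Volterra operator, starting from `b r²`. -/
noncomputable def volterraIter (b : ℝ) (Q : ℝ → ℝ) : ℕ → ℝ → ℝ
  | 0 => fun r => b * r ^ 2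
  | n + 1 => volterraOp b Q (volterraIter b Q n)

lemma continuous_volterraIter (b : ℝ) {Q : ℝ → ℝ} (hQ : Continuous Q) (n : ℕ) :
    Continuous (volterraIter b Q n) := by
  induction n with
  | zero => exact continuous_const.mul (continuous_pow 2)
  | succ n ih => exact continuous_volterraOp b hQ ih.measurable

lemma volterraIter_le_succ (b : ℝ) {Q : ℝ → ℝ} (hQ : Continuous Q)
    (hQ0 : ∀ s, 0 < s → 0 ≤ Q s) (n : ℕ) (r : ℝ) :
    volterraIter b Q n r ≤ volterraIter b Q (n + 1) r := by
  induction n generalizing r with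
  | zero =>
    refine le_add_of_nonneg_right (setIntegral_nonneg measurableSet_Ioi fun s hs => ?_)
    exact mul_nonneg (volterraKernel_mul_nonneg hs r) (mul_nonneg (hQ0 s hs) (cappedExp_pos _).le)
  | succ n ih =>
    exact volterraOp_mono hQ hQ0 (continuous_volterraIter b hQ n).measurable
      (continuous_volterraIter b hQ (n + 1)).measurable le_rfl (fun s _ => ih s) r

lemma volterraIter_mono (b : ℝ) {Q : ℝ → ℝ} (hQ : Continuous Q)
    (hQ0 : ∀ s, 0 < s → 0 ≤ Q s) (r : ℝ) : Monotone fun n => volterraIter b Q n r :=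
  monotone_nat_of_le_succ fun n => volterraIter_le_succ b hQ hQ0 n r

lemma bddAbove_volterraIter (b : ℝ) {Q : ℝ → ℝ} (hQ : Continuous Q)
    (hQ0 : ∀ s, 0 < s → 0 ≤ Q s) (r : ℝ) : BddAbove (range fun n => volterraIter b Q n r) := by
  refine ⟨b * r ^ 2 + ∫ s in Ioi 0, volterraMajorant |r| Q s, ?_⟩
  rintro _ ⟨n, rfl⟩
  refine (volterraIter_le_succ b hQ hQ0 n r).trans (add_le_add le_rfl ?_)
  refine setIntegral_mono_on
    (integrableOn_volterra hQ (continuous_volterraIter b hQ n).measurable r)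
    (integrableOn_volterraMajorant hQ |r|) measurableSet_Ioi fun s hs => (le_abs_self _).trans ?_
  exact norm_volterra_integrand_le Q (le_abs_self r) hs (cappedExp_pos _).le
    (cappedExp_le_one _)

/-- The solution of the Volterra equation `u = volterraOp b Q u`. -/
noncomputable def volterraSol (b : ℝ) (Q : ℝ → ℝ) (r : ℝ) : ℝ := ⨆ n, volterraIter b Q n r

variable {b b' : ℝ} {Q Q' : ℝ → ℝ}

lemma tendsto_volterraIter (b : ℝ) (hQ : Continuous Q) (hQ0 : ∀ s, 0 < s → 0 ≤ Q s) (r : ℝ) :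
    Tendsto (fun n => volterraIter b Q n r) atTop (𝓝 (volterraSol b Q r)) :=
  tendsto_atTop_ciSup (volterraIter_mono b hQ hQ0 r) (bddAbove_volterraIter b hQ hQ0 r)

lemma volterraIter_le_sol (b : ℝ) (hQ : Continuous Q) (hQ0 : ∀ s, 0 < s → 0 ≤ Q s) (n : ℕ)
    (r : ℝ) : volterraIter b Q n r ≤ volterraSol b Q r :=
  le_ciSup (bddAbove_volterraIter b hQ hQ0 r) n

lemma measurable_volterraSol (b : ℝ) (hQ : Continuous Q) : Measurable (volterraSol b Q) :=
  Measurable.iSup fun n => (continuous_volterraIter b hQ n).measurable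

lemma volterraSol_eq (b : ℝ) (hQ : Continuous Q) (hQ0 : ∀ s, 0 < s → 0 ≤ Q s) :
    volterraSol b Q = volterraOp b Q (volterraSol b Q) := by
  ext r
  refine tendsto_nhds_unique ((tendsto_add_atTop_iff_nat 1).2 (tendsto_volterraIter b hQ hQ0 r)) ?_
  refine tendsto_const_nhds.add (tendsto_integral_of_dominated_convergence
    (volterraMajorant |r| Q)
    (fun n => aestronglyMeasurable_volterra hQ (continuous_volterraIter b hQ n).measurable r _)
    (integrableOn_volterraMajorant hQ |r|) (fun n => ?_) ?_)
  · filter_upwards [ae_restrict_mem measurableSet_Ioi] with s hs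
    exact norm_volterra_integrand_le Q (le_abs_self r) hs (cappedExp_pos _).le
      (cappedExp_le_one _)
  · refine Eventually.of_forall fun s => tendsto_const_nhds.mul (tendsto_const_nhds.mul ?_)
    exact (continuous_cappedExp.tendsto _).comp (tendsto_volterraIter b hQ hQ0 s)

lemma continuous_volterraSol (b : ℝ) (hQ : Continuous Q) (hQ0 : ∀ s, 0 < s → 0 ≤ Q s) :
    Continuous (volterraSol b Q) := by
  rw [volterraSol_eq b hQ hQ0]
  exact continuous_volterraOp b hQ (measurable_volterraSol b hQ)

lemma volterraSol_mono (hQ : Continuous Q) (hQ0 : ∀ s, 0 < s → 0 ≤ Q s) (h : b ≤ b') (r : ℝ) :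
    volterraSol b Q r ≤ volterraSol b' Q r := by
  refine le_of_tendsto_of_tendsto' (tendsto_volterraIter b hQ hQ0 r)
    (tendsto_volterraIter b' hQ hQ0 r) fun n => ?_
  induction n generalizing r with
  | zero => exact mul_le_mul_of_nonneg_right h (sq_nonneg r)
  | succ n ih =>
    exact volterraOp_mono hQ hQ0 (continuous_volterraIter b hQ n).measurable
      (continuous_volterraIter b' hQ n).measurable h (fun s _ => ih s) r

lemma le_exp_of_le_add_integral {d : ℝ → ℝ} (hd : Continuous d) (hd0 : ∀ r, 0 ≤ d r) {ε C R : ℝ}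
    (hC : 0 < C) (h : ∀ r ∈ Icc 0 R, d r ≤ ε + C * ∫ s in (0 : ℝ)..r, d s) :
    ∀ r ∈ Icc 0 R, d r ≤ ε * Real.exp (C * r) := by
  intro r hr
  have hder : ∀ x, HasDerivAt (fun r => ∫ s in (0 : ℝ)..r, d s) (d x) x := fun x =>
    intervalIntegral.integral_hasDerivAt_right (hd.intervalIntegrable _ _)
      (hd.stronglyMeasurableAtFilter _ _) hd.continuousAt
  have hnn : ∀ x, 0 ≤ x → 0 ≤ ∫ s in (0 : ℝ)..x, d s := fun x hx =>
    intervalIntegral.integral_nonneg hx fun s _ => hd0 s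
  have h_gronwall := norm_le_gronwallBound_of_norm_deriv_right_le
    (f := fun r => ∫ s in (0 : ℝ)..r, d s) (f' := d) (δ := 0) (K := C) (ε := ε) (a := 0) (b := R)
    (fun x _ => (hder x).continuousAt.continuousWithinAt)
    (fun x _ => (hder x).hasDerivWithinAt) (by simp) (fun x hx => by
      rw [Real.norm_of_nonneg (hd0 x), Real.norm_of_nonneg (hnn x hx.1)]
      linarith [h x ⟨hx.1, hx.2.le⟩]) r hr
  rw [Real.norm_of_nonneg (hnn r hr.1), gronwallBound_of_K_ne_0 hC.ne',
    sub_zero] at h_gronwall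
  simp only [zero_mul, zero_add] at h_gronwall
  have h_mul := mul_le_mul_of_nonneg_left h_gronwall hC.le
  rw [← mul_assoc, mul_div_cancel₀ _ hC.ne'] at h_mul
  linarith [h r hr]

lemma volterraSol_sub_eq (b b' : ℝ) (hQ : Continuous Q) (hQ0 : ∀ s, 0 < s → 0 ≤ Q s)
    (hQ' : Continuous Q') (hQ0' : ∀ s, 0 < s → 0 ≤ Q' s) (r : ℝ) :
    volterraSol b Q r - volterraSol b' Q' r = (b - b') * r ^ 2 +
      ∫ s in Ioi 0, volterraKernel (r / s) * s ^ 3 *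
        (Q s * cappedExp (volterraSol b Q s) - Q' s * cappedExp (volterraSol b' Q' s)) := by
  have h_eq : volterraSol b Q r = volterraOp b Q (volterraSol b Q) r :=
    congrFun (volterraSol_eq b hQ hQ0) r
  have h_eq' : volterraSol b' Q' r = volterraOp b' Q' (volterraSol b' Q') r :=
    congrFun (volterraSol_eq b' hQ' hQ0') r
  rw [h_eq, h_eq', volterraOp, volterraOp]
  simp_rw [mul_sub (volterraKernel _ * _)]
  rw [integral_sub (integrableOn_volterra hQ (measurable_volterraSol b hQ) r)
    (integrableOn_volterra hQ' (measurable_volterraSol b' hQ') r)]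
  ring

lemma abs_integral_volterraKernel_mul_le {f g : ℝ → ℝ} (hg : Continuous g) {r R : ℝ}
    (hr : r ∈ Icc 0 R) (hfg : ∀ s ∈ Ioc 0 r, |f s| ≤ g s) :
    |∫ s in Ioi 0, volterraKernel (r / s) * s ^ 3 * f s| ≤
      R ^ 3 / 4 * ∫ s in (0 : ℝ)..r, g s := by
  have hR : 0 ≤ R := hr.1.trans hr.2
  have h_int : IntegrableOn (fun s => R ^ 3 / 4 * g s) (Ioc 0 r) :=
    (continuous_const.mul hg).integrableOn_Icc.mono_set Ioc_subset_Icc_self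
  have h_nonneg : ∀ s, 0 ≤ (Ioc 0 r).indicator (fun s => R ^ 3 / 4 * g s) s :=
    indicator_nonneg fun s hs => mul_nonneg (by positivity) ((abs_nonneg _).trans (hfg s hs))
  rw [← intervalIntegral.integral_const_mul, intervalIntegral.integral_of_le hr.1,
    ← integral_indicator measurableSet_Ioc, ← Real.norm_eq_abs]
  refine (norm_integral_le_of_norm_le (g := (Ioc 0 r).indicator fun s => R ^ 3 / 4 * g s)
    ((integrable_indicator_iff measurableSet_Ioc).2 h_int).integrableOn ?_).trans
    (setIntegral_le_integral ((integrable_indicator_iff measurableSet_Ioc).2 h_int)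
      (Eventually.of_forall h_nonneg))
  filter_upwards [ae_restrict_mem measurableSet_Ioi] with s hs
  have hs : 0 < s := hs
  rcases le_or_gt s r with hsr | hrs
  · have hsr' : s ∈ Ioc 0 r := ⟨hs, hsr⟩
    rw [indicator_of_mem hsr', norm_mul, Real.norm_of_nonneg (volterraKernel_mul_nonneg hs r)]
    refine mul_le_mul ((volterraKernel_mul_le r hs).trans ?_) (hfg s hsr') (norm_nonneg _)
      (by positivity)
    calc r ^ 2 * (s / 4) ≤ R ^ 2 * (R / 4) := by
          gcongr
          exacts [hr.1, hr.2, hsr.trans hr.2]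
      _ = R ^ 3 / 4 := by ring
  · rw [volterraKernel_of_le hs hrs.le, zero_mul, zero_mul, norm_zero]
    exact h_nonneg s

lemma abs_mul_cappedExp_sub_le {q : ℝ} (hq : 0 ≤ q) (q' u v : ℝ) :
    |q * cappedExp u - q' * cappedExp v| ≤ |q - q'| + q * (4 * |u - v|) := by
  rw [show q * cappedExp u - q' * cappedExp v =
    (q - q') * cappedExp v + q * (cappedExp u - cappedExp v) by ring]
  refine (abs_add_le _ _).trans (add_le_add ?_ ?_)
  · rw [abs_mul, abs_of_pos (cappedExp_pos _)]
    exact mul_le_of_le_one_right (abs_nonneg _) (cappedExp_le_one _)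
  · rw [abs_mul, abs_of_nonneg hq]
    exact mul_le_mul_of_nonneg_left (abs_cappedExp_sub_le _ _) hq

lemma abs_volterraSol_sub_le (hQ : Continuous Q) (hQ0 : ∀ s, 0 < s → 0 ≤ Q s)
    (hQ' : Continuous Q') (hQ0' : ∀ s, 0 < s → 0 ≤ Q' s) {R M δ : ℝ} (hR : 0 < R) (hM : 0 < M)
    (hQM : ∀ s ∈ Ioc 0 R, Q s ≤ M) (hδ : ∀ s ∈ Ioc 0 R, |Q s - Q' s| ≤ δ) :
    ∀ r ∈ Icc 0 R, |volterraSol b Q r - volterraSol b' Q' r| ≤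
      (|b - b'| * R ^ 2 + δ * R ^ 4) * Real.exp (M * R ^ 3 * r) := by
  set u := volterraSol b Q
  set v := volterraSol b' Q'
  have hd : Continuous fun r => |u r - v r| :=
    ((continuous_volterraSol b hQ hQ0).sub (continuous_volterraSol b' hQ' hQ0')).abs
  have hδ0 : 0 ≤ δ := (abs_nonneg _).trans (hδ R ⟨hR, le_rfl⟩)
  refine le_exp_of_le_add_integral hd (fun r => abs_nonneg _) (by positivity) fun r hr => ?_
  have h_kernel := abs_integral_volterraKernel_mul_le (R := R)
    (f := fun s => Q s * cappedExp (u s) - Q' s * cappedExp (v s))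
    (g := fun s => δ + 4 * M * |u s - v s|)
    (continuous_const.add (continuous_const.mul hd)) hr fun s hs => by
      have hsR : s ∈ Ioc 0 R := ⟨hs.1, hs.2.trans hr.2⟩
      calc |Q s * cappedExp (u s) - Q' s * cappedExp (v s)|
          ≤ |Q s - Q' s| + Q s * (4 * |u s - v s|) :=
            abs_mul_cappedExp_sub_le (hQ0 s hs.1) _ _ _
        _ ≤ δ + M * (4 * |u s - v s|) :=
            add_le_add (hδ s hsR) (mul_le_mul_of_nonneg_right (hQM s hsR) (by positivity))
        _ = δ + 4 * M * |u s - v s| := by ring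
  have h_int : IntervalIntegrable (fun s => 4 * M * |u s - v s|) volume 0 r :=
    (continuous_const.mul hd).intervalIntegrable _ _
  rw [intervalIntegral.integral_add intervalIntegrable_const h_int,
    intervalIntegral.integral_const_mul,
    intervalIntegral.integral_const, smul_eq_mul, sub_zero] at h_kernel
  have h_diff := volterraSol_sub_eq b b' hQ hQ0 hQ' hQ0' r
  have h_sq : |b - b'| * r ^ 2 ≤ |b - b'| * R ^ 2 :=
    mul_le_mul_of_nonneg_left (pow_le_pow_left₀ hr.1 hr.2 2) (abs_nonneg _)
  have h_rδ : r * δ * R ^ 3 ≤ R * δ * R ^ 3 := by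
    have := hr.2
    gcongr
  have hδR : 0 ≤ δ * R ^ 4 := by positivity
  rw [h_diff]
  refine (abs_add_le _ _).trans ?_
  rw [abs_mul, abs_of_nonneg (sq_nonneg r)]
  linarith

end Volterra

section Shooting

open Set Filter Topology

variable {p b b' m : ℝ} {Q u v : ℝ → ℝ}

/-- The profiles for which the shooting problem is solved, uniformly in `Q`. -/
structure IsAdmissibleProfile (p : ℝ) (Q : ℝ → ℝ) : Prop where
  continuous : Continuous Q
  nonneg : ∀ s, 0 < s → 0 ≤ Q s
  le : ∀ s, 0 < s → Q s ≤ 1 + s ^ (4 * p)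

/-- The density whose integral over `(0, ∞)` is the coefficient of `r²` in the expansion of
`(Δ²)⁻¹ (Q e^{4 min(u, 0)})` at infinity. -/
noncomputable def momentDensity (Q u : ℝ → ℝ) (s : ℝ) : ℝ :=
  s / 4 * (Q s * cappedExp (u s))

/-- For `m < 0`, an integrable majorant of `momentDensity Q u` as soon as `u ≤ m s²`. -/
noncomputable def gaussianMoment (p m s : ℝ) : ℝ :=
  s / 4 * ((1 + s ^ (4 * p)) * Real.exp (4 * (m * s ^ 2)))

lemma integrableOn_gaussianMoment (hp : -(1 / 2) < p) (hm : m < 0) :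
    IntegrableOn (gaussianMoment p m) (Ioi 0) := by
  have h_head := integrableOn_rpow_mul_exp_neg_mul_sq (b := -(4 * m)) (by linarith)
    (s := 1) (by norm_num)
  have h_tail := integrableOn_rpow_mul_exp_neg_mul_sq (b := -(4 * m)) (by linarith)
    (s := 1 + 4 * p) (by linarith)
  refine IntegrableOn.congr_fun ((h_head.add h_tail).const_mul (1 / 4)) (fun s hs => ?_)
    measurableSet_Ioi
  have hs : 0 < s := hs
  simp only [Pi.add_apply]
  rw [gaussianMoment, Real.rpow_add hs, Real.rpow_one,
    show -(-(4 * m)) * s ^ 2 = 4 * (m * s ^ 2) by ring]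
  ring

lemma momentDensity_le_gaussianMoment {s : ℝ} (hQ : Q s ≤ 1 + s ^ (4 * p)) (hs : 0 < s)
    (hus : u s ≤ m * s ^ 2) : momentDensity Q u s ≤ gaussianMoment p m s := by
  have h_exp : cappedExp (u s) ≤ Real.exp (4 * (m * s ^ 2)) :=
    (cappedExp_le_exp _).trans (Real.exp_le_exp.2 (by linarith))
  have := (cappedExp_pos (u s)).le
  rw [momentDensity, gaussianMoment]
  gcongr

lemma momentDensity_nonneg {s : ℝ} (hQ : 0 ≤ Q s) (hs : 0 < s) : 0 ≤ momentDensity Q u s :=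
  mul_nonneg (by positivity) (mul_nonneg hQ (cappedExp_pos _).le)

lemma momentDensity_mono {s : ℝ} (hQ : 0 ≤ Q s) (hs : 0 < s) (huv : u s ≤ v s) :
    momentDensity Q u s ≤ momentDensity Q v s :=
  mul_le_mul_of_nonneg_left (mul_le_mul_of_nonneg_left (cappedExp_mono huv) hQ) (by positivity)

lemma measurable_momentDensity (hQ : Continuous Q) (hu : Measurable u) :
    Measurable (momentDensity Q u) :=
  (measurable_id.div_const 4).mul (hQ.measurable.mul (continuous_cappedExp.measurable.comp hu))

lemma continuous_momentDensity (hQ : Continuous Q) (hu : Continuous u) :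
    Continuous (momentDensity Q u) :=
  (continuous_id.div_const 4).mul (hQ.mul (continuous_cappedExp.comp hu))

lemma integrableOn_momentDensity (hp : -(1 / 2) < p) (hm : m < 0) (hQ : IsAdmissibleProfile p Q)
    (hu : Measurable u) (h : ∀ s, 0 < s → u s ≤ m * s ^ 2) :
    IntegrableOn (momentDensity Q u) (Ioi 0) := by
  refine (integrableOn_gaussianMoment hp hm).mono'
    (measurable_momentDensity hQ.continuous hu).aestronglyMeasurable ?_
  filter_upwards [ae_restrict_mem measurableSet_Ioi] with s hs
  rw [Real.norm_of_nonneg (momentDensity_nonneg (hQ.nonneg s hs) hs)]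
  exact momentDensity_le_gaussianMoment (hQ.le s hs) hs (h s hs)

lemma volterraOp_le (hQ : Continuous Q) (hQ0 : ∀ s, 0 < s → 0 ≤ Q s) (hu : Measurable u)
    (hi : IntegrableOn (momentDensity Q u) (Ioi 0)) (r : ℝ) :
    volterraOp b Q u r ≤ (b + ∫ s in Ioi 0, momentDensity Q u s) * r ^ 2 := by
  rw [add_mul, volterraOp, ← integral_mul_const]
  refine add_le_add le_rfl (setIntegral_mono_on (integrableOn_volterra hQ hu r) (hi.mul_const _)
    measurableSet_Ioi fun s hs => ?_)
  have := mul_le_mul_of_nonneg_right (volterraKernel_mul_le r hs)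
    (mul_nonneg (hQ0 s hs) (cappedExp_pos (u s)).le)
  rw [momentDensity]
  linarith

/-- `m r²` is a barrier: an upper bound by it propagates along the Picard iteration. -/
lemma volterraSol_le (hp : -(1 / 2) < p) (hm : m < 0) (hbm : b ≤ m)
    (hQ : IsAdmissibleProfile p Q)
    (h_moment : ∀ v : ℝ → ℝ, Measurable v → (∀ s, 0 < s → v s ≤ m * s ^ 2) →
      (∀ s, 0 < s → v s ≤ volterraSol b Q s) → b + ∫ s in Ioi 0, momentDensity Q v s ≤ m)
    (r : ℝ) : volterraSol b Q r ≤ m * r ^ 2 := by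
  refine le_of_tendsto' (tendsto_volterraIter b hQ.continuous hQ.nonneg r) fun n => ?_
  induction n generalizing r with
  | zero => exact mul_le_mul_of_nonneg_right hbm (sq_nonneg r)
  | succ n ih =>
    have h_meas := (continuous_volterraIter b hQ.continuous n).measurable
    refine (volterraOp_le hQ.continuous hQ.nonneg h_meas (integrableOn_momentDensity hp hm hQ
      h_meas fun s _ => ih s) r).trans (mul_le_mul_of_nonneg_right ?_ (sq_nonneg r))
    exact h_moment _ h_meas (fun s _ => ih s)
      fun s _ => volterraIter_le_sol b hQ.continuous hQ.nonneg n s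

/-- The total moment of the Volterra solution, possibly infinite. -/
noncomputable def volterraMoment (b : ℝ) (Q : ℝ → ℝ) : ENNReal :=
  ∫⁻ s in Ioi 0, ENNReal.ofReal (momentDensity Q (volterraSol b Q) s)

/-- The shooting condition: `b r²` exactly cancels the quadratic growth of the Volterra integral,
which turns the Volterra solution into a logarithmic potential. -/
structure IsBalanced (b : ℝ) (Q : ℝ → ℝ) : Prop where
  nonpos : b ≤ 0
  moment_eq : volterraMoment b Q = ENNReal.ofReal (-b)

lemma volterraMoment_mono (hQ : Continuous Q) (hQ0 : ∀ s, 0 < s → 0 ≤ Q s)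
    (h : b ≤ b') : volterraMoment b Q ≤ volterraMoment b' Q :=
  setLIntegral_mono' measurableSet_Ioi fun s hs => ENNReal.ofReal_le_ofReal
    (momentDensity_mono (hQ0 s hs) hs (volterraSol_mono hQ hQ0 h s))

lemma ae_momentDensity_nonneg (hQ0 : ∀ s, 0 < s → 0 ≤ Q s) (u : ℝ → ℝ) :
    ∀ᵐ s ∂volume.restrict (Ioi 0), 0 ≤ momentDensity Q u s :=
  (ae_restrict_mem measurableSet_Ioi).mono fun s hs => momentDensity_nonneg (hQ0 s hs) hs

lemma volterraMoment_eq_ofReal (hQ0 : ∀ s, 0 < s → 0 ≤ Q s)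
    (hi : IntegrableOn (momentDensity Q (volterraSol b Q)) (Ioi 0)) :
    volterraMoment b Q = ENNReal.ofReal (∫ s in Ioi 0, momentDensity Q (volterraSol b Q) s) :=
  (ofReal_integral_eq_lintegral_ofReal hi (ae_momentDensity_nonneg hQ0 _)).symm

lemma integrableOn_momentDensity_of_volterraMoment_lt_top (hQ : Continuous Q)
    (hQ0 : ∀ s, 0 < s → 0 ≤ Q s) (h : volterraMoment b Q < ⊤) :
    IntegrableOn (momentDensity Q (volterraSol b Q)) (Ioi 0) := by
  refine ⟨(measurable_momentDensity hQ (measurable_volterraSol b hQ)).aestronglyMeasurable, ?_⟩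
  rwa [hasFiniteIntegral_iff_ofReal (ae_momentDensity_nonneg hQ0 _)]

lemma IsBalanced.integrableOn (h : IsBalanced b Q) (hQ : Continuous Q)
    (hQ0 : ∀ s, 0 < s → 0 ≤ Q s) : IntegrableOn (momentDensity Q (volterraSol b Q)) (Ioi 0) :=
  integrableOn_momentDensity_of_volterraMoment_lt_top hQ hQ0
    (h.moment_eq ▸ ENNReal.ofReal_lt_top)

lemma isBalanced_iff_integral_eq (hQ0 : ∀ s, 0 < s → 0 ≤ Q s)
    (hi : IntegrableOn (momentDensity Q (volterraSol b Q)) (Ioi 0)) :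
    IsBalanced b Q ↔ ∫ s in Ioi 0, momentDensity Q (volterraSol b Q) s = -b := by
  have h_nonneg : 0 ≤ ∫ s in Ioi 0, momentDensity Q (volterraSol b Q) s :=
    integral_nonneg_of_ae (ae_momentDensity_nonneg hQ0 _)
  refine ⟨fun h => ?_, fun h => ⟨by linarith, by rw [volterraMoment_eq_ofReal hQ0 hi, h]⟩⟩
  have h_eq := h.moment_eq
  rwa [volterraMoment_eq_ofReal hQ0 hi,
    ENNReal.ofReal_eq_ofReal_iff h_nonneg (neg_nonneg.2 h.nonpos)] at h_eq

lemma IsBalanced.unique (h : IsBalanced b Q) (h' : IsBalanced b' Q) (hQ : Continuous Q)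
    (hQ0 : ∀ s, 0 < s → 0 ≤ Q s) : b = b' := by
  wlog hle : b ≤ b' generalizing b b'
  · exact (this h' h (not_le.1 hle).le).symm
  have h_mono := volterraMoment_mono hQ hQ0 hle
  rw [h.moment_eq, h'.moment_eq, ENNReal.ofReal_le_ofReal_iff (neg_nonneg.2 h'.nonpos)] at h_mono
  linarith

/-- A lower bound for the shooting parameter that is uniform in the curvature profile. -/
noncomputable def shootingBound (p : ℝ) : ℝ :=
  max 1 (2 * ∫ s in Ioi 0, gaussianMoment p (-(1 / 2)) s)

lemma integral_momentDensity_le_gaussianMoment (hp : -(1 / 2) < p) (hm : m < 0)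
    (hQ : IsAdmissibleProfile p Q) (hu : Measurable u) (h : ∀ s, 0 < s → u s ≤ m * s ^ 2)
    {R : ℝ} (hR : 0 ≤ R) :
    ∫ s in Ioi R, momentDensity Q u s ≤ ∫ s in Ioi R, gaussianMoment p m s :=
  setIntegral_mono_on
    ((integrableOn_momentDensity hp hm hQ hu h).mono_set (Ioi_subset_Ioi hR))
    ((integrableOn_gaussianMoment hp hm).mono_set (Ioi_subset_Ioi hR)) measurableSet_Ioi
    fun s hs => have hs0 : 0 < s := hR.trans_lt hs
      momentDensity_le_gaussianMoment (hQ.le s hs0) hs0 (h s hs0)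

lemma volterraMoment_shootingBound_le (hp : -(1 / 2) < p) (hQ : IsAdmissibleProfile p Q) :
    volterraMoment (-shootingBound p) Q ≤ ENNReal.ofReal (shootingBound p / 2) := by
  set B := shootingBound p
  have hB1 : 1 ≤ B := le_max_left _ _
  have hB2 : 2 * ∫ s in Ioi 0, gaussianMoment p (-(1 / 2)) s ≤ B := le_max_right _ _
  have hmB : -(B / 2) < 0 := by linarith
  have h_moment : ∀ v : ℝ → ℝ, Measurable v → (∀ s, 0 < s → v s ≤ -(B / 2) * s ^ 2) →
      ∫ s in Ioi 0, momentDensity Q v s ≤ B / 2 := fun v hv h => by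
    have h_half : ∀ s, 0 < s → v s ≤ -(1 / 2) * s ^ 2 := fun s hs =>
      (h s hs).trans (mul_le_mul_of_nonneg_right (by linarith) (sq_nonneg s))
    linarith [integral_momentDensity_le_gaussianMoment hp (by norm_num) hQ hv h_half le_rfl]
  have h_meas := measurable_volterraSol (-B) hQ.continuous
  have h_barrier : ∀ r, volterraSol (-B) Q r ≤ -(B / 2) * r ^ 2 :=
    volterraSol_le hp hmB (by linarith) hQ fun v hv h _ => by linarith [h_moment v hv h]
  rw [volterraMoment_eq_ofReal hQ.nonneg
    (integrableOn_momentDensity hp hmB hQ h_meas fun s _ => h_barrier s)]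
  exact ENNReal.ofReal_le_ofReal (h_moment _ h_meas fun s _ => h_barrier s)

lemma tendsto_integral_Ioc_momentDensity {ι : Type*} {l : Filter ι} [l.IsCountablyGenerated]
    {F q : ι → ℝ → ℝ} (hp : 0 ≤ p) (hq : ∀ i, IsAdmissibleProfile p (q i))
    (hF : ∀ i, Measurable (F i)) (hqQ : ∀ s, 0 < s → Tendsto (fun i => q i s) l (𝓝 (Q s)))
    (hFu : ∀ s, 0 < s → Tendsto (fun i => F i s) l (𝓝 (u s))) (R : ℝ) :
    Tendsto (fun i => ∫ s in Ioc 0 R, momentDensity (q i) (F i) s) l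
      (𝓝 (∫ s in Ioc 0 R, momentDensity Q u s)) := by
  have h_cont : Continuous fun s : ℝ => s / 4 * (1 + s ^ (4 * p)) :=
    (continuous_id.div_const 4).mul
      (continuous_const.add (Real.continuous_rpow_const (by positivity)))
  refine tendsto_integral_filter_of_dominated_convergence (fun s : ℝ => s / 4 * (1 + s ^ (4 * p)))
    (Eventually.of_forall fun i =>
      (measurable_momentDensity (hq i).continuous (hF i)).aestronglyMeasurable)
    (Eventually.of_forall fun i => ?_) (h_cont.integrableOn_Icc.mono_set Ioc_subset_Icc_self) ?_
  · filter_upwards [ae_restrict_mem measurableSet_Ioc] with s hs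
    have hs0 : 0 < s := hs.1
    rw [Real.norm_of_nonneg (momentDensity_nonneg ((hq i).nonneg s hs0) hs0)]
    exact mul_le_mul_of_nonneg_left ((mul_le_of_le_one_right ((hq i).nonneg s hs0)
      (cappedExp_le_one _)).trans ((hq i).le s hs0)) (by positivity)
  · filter_upwards [ae_restrict_mem measurableSet_Ioc] with s hs
    exact tendsto_const_nhds.mul ((hqQ s hs.1).mul
      ((continuous_cappedExp.tendsto _).comp (hFu s hs.1)))

lemma tendsto_volterraSol {ι : Type*} {l : Filter ι} {β : ι → ℝ} {q : ι → ℝ → ℝ}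
    (hq : ∀ i, Continuous (q i)) (hq0 : ∀ i s, 0 < s → 0 ≤ q i s) (hQ : Continuous Q)
    (hQ0 : ∀ s, 0 < s → 0 ≤ Q s) (hβ : Tendsto β l (𝓝 b)) {r M : ℝ} (hr : 0 < r) (hM : 0 < M)
    (hQM : ∀ s ∈ Ioc 0 r, Q s ≤ M) {δ : ι → ℝ} (hδ : Tendsto δ l (𝓝 0))
    (hqδ : ∀ i, ∀ s ∈ Ioc 0 r, |Q s - q i s| ≤ δ i) :
    Tendsto (fun i => volterraSol (β i) (q i) r) l (𝓝 (volterraSol b Q r)) := by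
  rw [tendsto_iff_dist_tendsto_zero]
  have h_bound : Tendsto
      (fun i => (|b - β i| * r ^ 2 + δ i * r ^ 4) * Real.exp (M * r ^ 3 * r)) l (𝓝 0) := by
    have h_lim := ((((tendsto_const_nhds (x := b)).sub hβ).abs.mul_const (r ^ 2)).add
      (hδ.mul_const (r ^ 4))).mul_const (Real.exp (M * r ^ 3 * r))
    simpa only [sub_self, abs_zero, zero_mul, add_zero] using h_lim
  refine squeeze_zero (fun _ => dist_nonneg) (fun i => ?_) h_bound
  rw [dist_comm, Real.dist_eq]
  exact abs_volterraSol_sub_le hQ hQ0 (hq i) (hq0 i) hr hM hQM (hqδ i) r ⟨hr.le, le_rfl⟩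

lemma IsAdmissibleProfile.le_of_mem_Ioc (hp : 0 ≤ p) (hQ : IsAdmissibleProfile p Q) {s R : ℝ}
    (hs : s ∈ Ioc 0 R) : Q s ≤ 1 + R ^ (4 * p) :=
  (hQ.le s hs.1).trans (add_le_add le_rfl (Real.rpow_le_rpow hs.1.le hs.2 (by positivity)))

lemma tendsto_volterraSol_param {ι : Type*} {l : Filter ι} {β : ι → ℝ} (hp : 0 ≤ p)
    (hQ : IsAdmissibleProfile p Q) (hβ : Tendsto β l (𝓝 b)) {r : ℝ} (hr : 0 < r) :
    Tendsto (fun i => volterraSol (β i) Q r) l (𝓝 (volterraSol b Q r)) :=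
  tendsto_volterraSol (fun _ => hQ.continuous) (fun _ => hQ.nonneg) hQ.continuous hQ.nonneg hβ hr
    (M := 1 + r ^ (4 * p)) (by positivity) (fun _ => hQ.le_of_mem_Ioc hp)
    (tendsto_const_nhds (x := (0 : ℝ))) (fun _ s _ => by simp)

lemma integral_momentDensity_le_add (hp : -(1 / 2) < p) (hm : m < 0)
    (hQ : IsAdmissibleProfile p Q) (hu : Measurable u) (hv : Continuous v)
    (hum : ∀ s, 0 < s → u s ≤ m * s ^ 2) (huv : ∀ s, 0 < s → u s ≤ v s) {R : ℝ} (hR : 0 ≤ R) :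
    ∫ s in Ioi 0, momentDensity Q u s ≤
      (∫ s in Ioc 0 R, momentDensity Q v s) + ∫ s in Ioi R, gaussianMoment p m s := by
  have h_int := integrableOn_momentDensity hp hm hQ hu hum
  rw [← intervalIntegral.integral_interval_add_Ioi h_int (h_int.mono_set (Ioi_subset_Ioi hR)),
    intervalIntegral.integral_of_le hR]
  refine add_le_add (setIntegral_mono_on (h_int.mono_set Ioc_subset_Ioi_self)
    ((continuous_momentDensity hQ.continuous hv).integrableOn_Icc.mono_set Ioc_subset_Icc_self)
    measurableSet_Ioc fun s hs => ?_)
    (integral_momentDensity_le_gaussianMoment hp hm hQ hu hum hR)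
  exact momentDensity_mono (hQ.nonneg s hs.1) hs.1 (huv s hs.1)

/-- If the moment beyond `R` of the barrier `m r²` and that of the solution up to `R` add up to at
most `m - b`, then the barrier holds and hence also bounds the moment of the solution. -/
lemma volterraMoment_le_of_moments_le (hp : -(1 / 2) < p) (hm : m < 0) (hbm : b ≤ m)
    (hQ : IsAdmissibleProfile p Q) {R : ℝ} (hR : 0 ≤ R)
    (h : (∫ s in Ioc 0 R, momentDensity Q (volterraSol b Q) s) +
      ∫ s in Ioi R, gaussianMoment p m s ≤ m - b) :
    volterraMoment b Q ≤ ENNReal.ofReal (m - b) := by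
  have h_cont := continuous_volterraSol b hQ.continuous hQ.nonneg
  have h_moment : ∀ v : ℝ → ℝ, Measurable v → (∀ s, 0 < s → v s ≤ m * s ^ 2) →
      (∀ s, 0 < s → v s ≤ volterraSol b Q s) → ∫ s in Ioi 0, momentDensity Q v s ≤ m - b :=
    fun v hv hvm hvs => (integral_momentDensity_le_add hp hm hQ hv h_cont hvm hvs hR).trans h
  have h_barrier : ∀ r, volterraSol b Q r ≤ m * r ^ 2 := volterraSol_le hp hm hbm hQ
    fun v hv hvm hvs => by linarith [h_moment v hv hvm hvs]
  rw [volterraMoment_eq_ofReal hQ.nonneg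
    (integrableOn_momentDensity hp hm hQ h_cont.measurable fun s _ => h_barrier s)]
  exact ENNReal.ofReal_le_ofReal
    (h_moment _ h_cont.measurable (fun s _ => h_barrier s) fun s _ => le_rfl)

lemma exists_volterraMoment_le_of_lt (hp : 0 ≤ p) (hQ : IsAdmissibleProfile p Q)
    (h : volterraMoment b Q < ENNReal.ofReal (-b)) :
    ∃ b' > b, b' ≤ 0 ∧ volterraMoment b' Q ≤ ENNReal.ofReal (-b') := by
  have hp' : -(1 / 2) < p := by linarith
  have hi := integrableOn_momentDensity_of_volterraMoment_lt_top hQ.continuous hQ.nonneg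
    (h.trans ENNReal.ofReal_lt_top)
  rw [volterraMoment_eq_ofReal hQ.nonneg hi, ENNReal.ofReal_lt_ofReal_iff_of_nonneg
    (integral_nonneg_of_ae (ae_momentDensity_nonneg hQ.nonneg _))] at h
  set J := ∫ s in Ioi 0, momentDensity Q (volterraSol b Q) s
  set m := (b + J) / 2 with hm
  have hm0 : m < 0 := by linarith
  have hJ0 : 0 ≤ J := integral_nonneg_of_ae (ae_momentDensity_nonneg hQ.nonneg _)
  obtain ⟨R, h_tail, hR⟩ : ∃ R, ∫ s in Ioi R, gaussianMoment p m s < -m / 4 ∧ 0 < R :=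
    (((tendsto_integral_Ioi_zero tendsto_id).eventually
      (gt_mem_nhds (by linarith : 0 < -m / 4))).and (eventually_gt_atTop 0)).exists
  have h_head_lim : Tendsto
      (fun β => ∫ s in Ioc 0 R, momentDensity Q (volterraSol β Q) s) (𝓝[>] b)
      (𝓝 (∫ s in Ioc 0 R, momentDensity Q (volterraSol b Q) s)) :=
    tendsto_integral_Ioc_momentDensity hp (fun _ => hQ)
      (fun β => measurable_volterraSol β hQ.continuous) (fun s _ => tendsto_const_nhds)
      (fun s hs => tendsto_volterraSol_param hp hQ (tendsto_id.mono_left nhdsWithin_le_nhds) hs) R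
  have h_head_le : ∫ s in Ioc 0 R, momentDensity Q (volterraSol b Q) s ≤ J :=
    setIntegral_mono_set hi (ae_momentDensity_nonneg hQ.nonneg _) Ioc_subset_Ioi_self.eventuallyLE
  have h_near : ∀ᶠ β in 𝓝[>] b, β < b + -m / 4 :=
    mem_nhdsWithin_of_mem_nhds (gt_mem_nhds (by linarith))
  obtain ⟨b', ⟨h_head, hb'_lt⟩, hb'_gt⟩ :=
    (((h_head_lim.eventually (gt_mem_nhds (show _ < J + -m / 4 by linarith))).and h_near).and
      self_mem_nhdsWithin).exists
  refine ⟨b', hb'_gt, by linarith, (volterraMoment_le_of_moments_le hp' hm0 (by linarith) hQ hR.le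
    (by linarith)).trans (ENNReal.ofReal_le_ofReal (by linarith))⟩

lemma volterraMoment_le_liminf (hp : 0 ≤ p) (hQ : IsAdmissibleProfile p Q) {β : ℕ → ℝ}
    (hβ : Tendsto β atTop (𝓝 b)) :
    volterraMoment b Q ≤ liminf (fun n => volterraMoment (β n) Q) atTop := by
  refine le_trans (le_of_eq ?_) (lintegral_liminf_le fun n => (measurable_momentDensity
    hQ.continuous (measurable_volterraSol (β n) hQ.continuous)).ennreal_ofReal)
  refine setLIntegral_congr_fun measurableSet_Ioi fun s hs => (Tendsto.liminf_eq ?_).symm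
  exact (ENNReal.continuous_ofReal.tendsto _).comp (tendsto_const_nhds.mul
    (tendsto_const_nhds.mul ((continuous_cappedExp.tendsto _).comp
      (tendsto_volterraSol_param hp hQ hβ hs))))

theorem exists_isBalanced (hp : 0 ≤ p) (hQ : IsAdmissibleProfile p Q) :
    ∃ b, -shootingBound p ≤ b ∧ IsBalanced b Q := by
  have h_one_le : 1 ≤ shootingBound p := le_max_left _ _
  set S := {b : ℝ | b ≤ 0 ∧ volterraMoment b Q ≤ ENNReal.ofReal (-b)}
  have h_mem : -shootingBound p ∈ S :=
    ⟨by linarith, (volterraMoment_shootingBound_le (by linarith) hQ).trans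
      (ENNReal.ofReal_le_ofReal (by linarith))⟩
  have h_bdd : BddAbove S := ⟨0, fun b hb => hb.1⟩
  obtain ⟨β, -, hβ, hβS⟩ := exists_seq_tendsto_sSup ⟨_, h_mem⟩ h_bdd
  have h_lim : Tendsto (fun n => ENNReal.ofReal (-β n)) atTop (𝓝 (ENNReal.ofReal (-sSup S))) :=
    (ENNReal.continuous_ofReal.tendsto _).comp hβ.neg
  have h_le : volterraMoment (sSup S) Q ≤ ENNReal.ofReal (-sSup S) := by
    rw [← h_lim.liminf_eq]
    exact (volterraMoment_le_liminf hp hQ hβ).trans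
      (liminf_le_liminf (Eventually.of_forall fun n => (hβS n).2))
  refine ⟨sSup S, le_csSup h_bdd h_mem, csSup_le ⟨_, h_mem⟩ fun b hb => hb.1,
    h_le.eq_of_not_lt fun h_lt => ?_⟩
  obtain ⟨b', hb', h_mem'⟩ := exists_volterraMoment_le_of_lt hp hQ h_lt
  exact hb'.not_ge (le_csSup h_bdd h_mem')

end Shooting

section Balanced

open Set Filter Topology

variable {p b : ℝ} {Q U : ℝ → ℝ}

lemma logKernel_mul_eq_sub_volterraKernel (Q u : ℝ → ℝ) (r : ℝ) {s : ℝ} (hs : s ≠ 0) :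
    logKernel (r / s) * (Q s * cappedExp (u s) * s ^ 3) =
      r ^ 2 * momentDensity Q u s - volterraKernel (r / s) * s ^ 3 * (Q s * cappedExp (u s)) := by
  rw [logKernel_eq, momentDensity]
  field_simp

lemma IsBalanced.integrableOn_logKernel_mul (h : IsBalanced b Q) (hQ : Continuous Q)
    (hQ0 : ∀ s, 0 < s → 0 ≤ Q s) (r : ℝ) :
    IntegrableOn (fun s => logKernel (r / s) * (Q s * cappedExp (volterraSol b Q s) * s ^ 3))
      (Ioi 0) :=
  IntegrableOn.congr_fun (((h.integrableOn hQ hQ0).const_mul (r ^ 2)).sub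
    (integrableOn_volterra hQ (measurable_volterraSol b hQ) r))
    (fun _ hs => (logKernel_mul_eq_sub_volterraKernel _ _ r (ne_of_gt hs)).symm) measurableSet_Ioi

lemma IsBalanced.volterraSol_eq_neg_integral (h : IsBalanced b Q) (hQ : Continuous Q)
    (hQ0 : ∀ s, 0 < s → 0 ≤ Q s) (r : ℝ) : volterraSol b Q r =
      -∫ s in Ioi 0, logKernel (r / s) * (Q s * cappedExp (volterraSol b Q s) * s ^ 3) := by
  have hi := h.integrableOn hQ hQ0
  have h_sol := congrFun (volterraSol_eq b hQ hQ0) r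
  rw [volterraOp] at h_sol
  rw [setIntegral_congr_fun measurableSet_Ioi fun s hs =>
      logKernel_mul_eq_sub_volterraKernel Q (volterraSol b Q) r (ne_of_gt hs),
    integral_sub (hi.const_mul _) (integrableOn_volterra hQ (measurable_volterraSol b hQ) r),
    integral_const_mul, (isBalanced_iff_integral_eq hQ0 hi).1 h]
  linarith

lemma IsBalanced.volterraSol_nonpos (h : IsBalanced b Q) (hQ : Continuous Q)
    (hQ0 : ∀ s, 0 < s → 0 ≤ Q s) (r : ℝ) : volterraSol b Q r ≤ 0 := by
  rw [h.volterraSol_eq_neg_integral hQ hQ0 r, neg_nonpos]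
  exact setIntegral_nonneg measurableSet_Ioi fun s hs => mul_nonneg (logKernel_nonneg _)
    (mul_nonneg (mul_nonneg (hQ0 s hs) (cappedExp_pos _).le) (pow_nonneg (le_of_lt hs) 3))

lemma integral_Ioc_mul_log_le_integral_logKernel {f : ℝ → ℝ} (hf : ∀ s, 0 < s → 0 ≤ f s)
    {r R : ℝ} (hR : 0 < R) (hr : R < r) (hfR : IntegrableOn f (Ioc 0 R))
    (hK : IntegrableOn (fun s => logKernel (r / s) * f s) (Ioi 0)) :
    (∫ s in Ioc 0 R, f s) * Real.log (r / R) ≤ ∫ s in Ioi 0, logKernel (r / s) * f s := by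
  have hr0 : 0 < r := hR.trans hr
  calc (∫ s in Ioc 0 R, f s) * Real.log (r / R) = ∫ s in Ioc 0 R, Real.log (r / R) * f s := by
        rw [integral_const_mul, mul_comm]
    _ ≤ ∫ s in Ioc 0 R, logKernel (r / s) * f s := by
        refine setIntegral_mono_on (hfR.const_mul _) (hK.mono_set Ioc_subset_Ioi_self)
          measurableSet_Ioc fun s hs => mul_le_mul_of_nonneg_right ?_ (hf s hs.1)
        refine le_trans ?_ (log_le_logKernel (div_pos hr0 hs.1))
        exact Real.log_le_log (by positivity) (div_le_div_of_nonneg_left hr0.le hs.1 hs.2)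
    _ ≤ ∫ s in Ioi 0, logKernel (r / s) * f s :=
        setIntegral_mono_set hK ((ae_restrict_mem measurableSet_Ioi).mono fun s hs =>
          mul_nonneg (logKernel_nonneg _) (hf s hs)) Ioc_subset_Ioi_self.eventuallyLE

lemma radialDensity_le_rpow {r R : ℝ} (hp : 0 ≤ p) (hR : 1 ≤ R) (hr : R < r)
    (hQ : Q r ≤ 1 + r ^ (4 * p)) (hU : U r ≤ -((p + 2) * Real.log (r / R))) :
    radialDensity Q U r ≤ 2 * R ^ (4 * (p + 2)) * r ^ (-5 : ℝ) := by
  have hR0 : 0 < R := by linarith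
  have hr0 : 0 < r := by linarith
  have h_profile : Q r ≤ 2 * r ^ (4 * p) := by
    have : 1 ≤ r ^ (4 * p) := Real.one_le_rpow (by linarith) (by positivity)
    linarith
  have h_exp : Real.exp (4 * U r) ≤ R ^ (4 * (p + 2)) * r ^ (-(4 * (p + 2))) := by
    calc Real.exp (4 * U r) ≤ (r / R) ^ (-(4 * (p + 2))) := by
          rw [Real.rpow_def_of_pos (by positivity)]
          exact Real.exp_le_exp.2 (by linarith)
      _ = R ^ (4 * (p + 2)) * r ^ (-(4 * (p + 2))) := by
          rw [Real.div_rpow hr0.le hR0.le, Real.rpow_neg hR0.le, div_inv_eq_mul, mul_comm]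
  calc radialDensity Q U r
      ≤ 2 * r ^ (4 * p) * (R ^ (4 * (p + 2)) * r ^ (-(4 * (p + 2)))) * r ^ 3 := by
        unfold radialDensity; gcongr
    _ = 2 * R ^ (4 * (p + 2)) * (r ^ (4 * p) * r ^ (-(4 * (p + 2))) * r ^ (3 : ℝ)) := by
        rw [show (3 : ℝ) = (3 : ℕ) by norm_num, Real.rpow_natCast]; ring
    _ = 2 * R ^ (4 * (p + 2)) * r ^ (-5 : ℝ) := by
        rw [← Real.rpow_add hr0, ← Real.rpow_add hr0]; congr 2; ring

lemma integrableOn_Ioi_of_integral_Ioc_le {f : ℝ → ℝ} (hf : Continuous f)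
    (hf0 : ∀ s, 0 < s → 0 ≤ f s) {A : ℝ} (hA : ∀ᶠ R in atTop, ∫ s in Ioc 0 R, f s ≤ A) :
    IntegrableOn f (Ioi 0) := by
  refine integrableOn_Ioi_of_intervalIntegral_norm_bounded A 0
    (fun R => hf.integrableOn_Icc.mono_set Ioc_subset_Icc_self) (tendsto_id (α := ℝ)) ?_
  filter_upwards [hA, eventually_ge_atTop 0] with R hRA hR
  rw [id, intervalIntegral.integral_of_le hR]
  refine le_trans (le_of_eq ?_) hRA
  exact setIntegral_congr_fun measurableSet_Ioc fun s hs => Real.norm_of_nonneg (hf0 s hs.1)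

/- Either the mass exceeds `p + 2` on some ball, and then `U` is so negative outside that the
density is integrable, or the mass is at most `p + 2` anyway. -/
lemma integrableOn_radialDensity_of_eq_neg_integral (hp : 0 ≤ p) (hQ : IsAdmissibleProfile p Q)
    (hU : Continuous U)
    (hK : ∀ r, IntegrableOn (fun s => logKernel (r / s) * radialDensity Q U s) (Ioi 0))
    (h : ∀ r, U r = -∫ s in Ioi 0, logKernel (r / s) * radialDensity Q U s) :
    IntegrableOn (radialDensity Q U) (Ioi 0) := by
  have h_cont := continuous_radialDensity hQ.continuous hU
  have h_nonneg : ∀ s, 0 < s → 0 ≤ radialDensity Q U s := fun s hs =>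
    radialDensity_nonneg (hQ.nonneg s hs) hs.le
  by_cases h_mass : ∃ R, 1 ≤ R ∧ p + 2 < ∫ s in Ioc 0 R, radialDensity Q U s
  · obtain ⟨R, hR1, hR⟩ := h_mass
    have hR0 : 0 < R := by linarith
    have h_int : IntegrableOn (radialDensity Q U) (Ioc 0 R) :=
      h_cont.integrableOn_Icc.mono_set Ioc_subset_Icc_self
    have h_decay : ∀ r, R < r → U r ≤ -((p + 2) * Real.log (r / R)) := fun r hr => by
      have h_log : 0 ≤ Real.log (r / R) := Real.log_nonneg ((one_le_div hR0).2 hr.le)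
      rw [h r, neg_le_neg_iff]
      exact (mul_le_mul_of_nonneg_right hR.le h_log).trans
        (integral_Ioc_mul_log_le_integral_logKernel h_nonneg hR0 hr h_int (hK r))
    rw [← Ioc_union_Ioi_eq_Ioi hR0.le]
    refine h_int.union (((integrableOn_Ioi_rpow_of_lt (show (-5 : ℝ) < -1 by norm_num)
      hR0).const_mul (2 * R ^ (4 * (p + 2)))).mono' h_cont.aestronglyMeasurable ?_)
    filter_upwards [ae_restrict_mem measurableSet_Ioi] with r hr
    have hr0 : 0 < r := hR0.trans hr
    rw [Real.norm_of_nonneg (h_nonneg r hr0)]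
    exact radialDensity_le_rpow hp hR1 hr (hQ.le r hr0) (h_decay r hr)
  · push Not at h_mass
    exact integrableOn_Ioi_of_integral_Ioc_le h_cont h_nonneg
      ((eventually_ge_atTop 1).mono h_mass)

theorem isRadialNormal_volterraSol (hp : 0 ≤ p) (hQ : IsAdmissibleProfile p Q)
    (h : IsBalanced b Q) : IsRadialNormal Q (volterraSol b Q) := by
  have h_density : (fun s => Q s * cappedExp (volterraSol b Q s) * s ^ 3) =
      radialDensity Q (volterraSol b Q) := funext fun s => by
    rw [radialDensity, cappedExp_of_nonpos (h.volterraSol_nonpos hQ.continuous hQ.nonneg s)]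
  have h_int := h.integrableOn_logKernel_mul hQ.continuous hQ.nonneg
  have h_eq := h.volterraSol_eq_neg_integral hQ.continuous hQ.nonneg
  simp only [congrFun h_density] at h_int h_eq
  have h_cont := continuous_volterraSol b hQ.continuous hQ.nonneg
  exact ⟨h_cont, integrableOn_radialDensity_of_eq_neg_integral hp hQ h_cont h_int h_eq,
    0, fun r _ => (h_eq r).trans (zero_sub _).symm⟩

lemma integral_Ioi_momentDensity_le (hQ : Continuous Q) (hQ0 : ∀ s, 0 < s → 0 ≤ Q s)
    {u : ℝ → ℝ} (hu : Measurable u) (hi : IntegrableOn (radialDensity Q u) (Ioi 0)) {R : ℝ}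
    (hR : 0 < R) : ∫ s in Ioi R, momentDensity Q u s ≤ radialMass Q u / (4 * R ^ 2) := by
  have h_le : ∀ s ∈ Ioi R, momentDensity Q u s ≤ radialDensity Q u s / (4 * R ^ 2) := by
    intro s (hs : R < s)
    have hs0 : 0 < s := hR.trans hs
    have h_weight : s / 4 ≤ s ^ 3 / (4 * R ^ 2) := by
      rw [div_le_div_iff₀ (by norm_num) (by positivity)]
      have : R ^ 2 ≤ s ^ 2 := pow_le_pow_left₀ hR.le hs.le 2
      nlinarith
    calc momentDensity Q u s ≤ s ^ 3 / (4 * R ^ 2) * (Q s * Real.exp (4 * u s)) :=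
          mul_le_mul h_weight (mul_le_mul_of_nonneg_left (cappedExp_le_exp _) (hQ0 s hs0))
            (mul_nonneg (hQ0 s hs0) (cappedExp_pos _).le) (by positivity)
      _ = radialDensity Q u s / (4 * R ^ 2) := by rw [radialDensity]; ring
  have hiR : IntegrableOn (fun s => radialDensity Q u s / (4 * R ^ 2)) (Ioi R) :=
    (hi.mono_set (Ioi_subset_Ioi hR.le)).div_const _
  have h_int : IntegrableOn (momentDensity Q u) (Ioi R) := by
    refine hiR.mono' (measurable_momentDensity hQ hu).aestronglyMeasurable ?_
    filter_upwards [ae_restrict_mem measurableSet_Ioi] with s hs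
    have hs0 : 0 < s := hR.trans hs
    rw [Real.norm_of_nonneg (momentDensity_nonneg (hQ0 s hs0) hs0)]
    exact h_le s hs
  refine (setIntegral_mono_on h_int hiR measurableSet_Ioi h_le).trans ?_
  rw [integral_div]
  refine div_le_div_of_nonneg_right (setIntegral_mono_set hi ?_
    (Ioi_subset_Ioi hR.le).eventuallyLE) (by positivity)
  exact (ae_restrict_mem measurableSet_Ioi).mono fun s hs =>
    radialDensity_nonneg (hQ0 s hs) (le_of_lt hs)

lemma integral_Ioi_eq_of_integral_Ioc_bounds {f : ℝ → ℝ} (hi : IntegrableOn f (Ioi 0)) {a : ℝ}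
    {ε : ℝ → ℝ} (hε : Tendsto ε atTop (𝓝 0)) (h_le : ∀ R, 0 < R → ∫ s in Ioc 0 R, f s ≤ a)
    (h_ge : ∀ R, 0 < R → a ≤ (∫ s in Ioc 0 R, f s) + ε R) : ∫ s in Ioi 0, f s = a := by
  have h_lim := intervalIntegral_tendsto_integral_Ioi 0 hi tendsto_id
  have h_lower : Tendsto (fun R => a - ε R) atTop (𝓝 a) := by simpa using hε.const_sub a
  refine tendsto_nhds_unique h_lim
    (tendsto_of_tendsto_of_tendsto_of_le_of_le' h_lower tendsto_const_nhds ?_ ?_)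
  all_goals
    filter_upwards [eventually_gt_atTop 0] with R hR
    rw [id, intervalIntegral.integral_of_le hR.le]
  · linarith [h_ge R hR]
  · exact h_le R hR

/- The uniform mass bound prevents moment from escaping to infinity. -/
lemma isBalanced_of_tendsto (hp : 0 ≤ p) (hQ : IsAdmissibleProfile p Q) {β : ℕ → ℝ}
    {q : ℕ → ℝ → ℝ} (hq : ∀ n, IsAdmissibleProfile p (q n)) (h : ∀ n, IsBalanced (β n) (q n))
    (hβ : Tendsto β atTop (𝓝 b)) (hqQ : ∀ s, 0 < s → Tendsto (fun n => q n s) atTop (𝓝 (Q s)))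
    (h_sol : ∀ s, 0 < s →
      Tendsto (fun n => volterraSol (β n) (q n) s) atTop (𝓝 (volterraSol b Q s)))
    {A : ℝ} (hA : ∀ n, radialMass (q n) (volterraSol (β n) (q n)) ≤ A) : IsBalanced b Q := by
  have h_meas := fun n => measurable_volterraSol (β n) (hq n).continuous
  have h_int := fun n => (h n).integrableOn (hq n).continuous (hq n).nonneg
  have h_head := tendsto_integral_Ioc_momentDensity hp hq h_meas hqQ h_sol
  have h_nonneg : ∀ s, 0 < s → 0 ≤ momentDensity Q (volterraSol b Q) s := fun s hs =>
    momentDensity_nonneg (hQ.nonneg s hs) hs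
  have h_split : ∀ n R, 0 < R →
      -β n = (∫ s in Ioc 0 R, momentDensity (q n) (volterraSol (β n) (q n)) s) +
        ∫ s in Ioi R, momentDensity (q n) (volterraSol (β n) (q n)) s := fun n R hR => by
    rw [← (isBalanced_iff_integral_eq (hq n).nonneg (h_int n)).1 (h n),
      ← intervalIntegral.integral_interval_add_Ioi (h_int n)
        ((h_int n).mono_set (Ioi_subset_Ioi hR.le)), intervalIntegral.integral_of_le hR.le]
  have h_le : ∀ R, 0 < R → ∫ s in Ioc 0 R, momentDensity Q (volterraSol b Q) s ≤ -b := by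
    refine fun R hR => le_of_tendsto_of_tendsto' (h_head R) hβ.neg fun n => ?_
    rw [h_split n R hR]
    exact le_add_of_nonneg_right (setIntegral_nonneg measurableSet_Ioi fun s hs =>
      momentDensity_nonneg ((hq n).nonneg s (hR.trans hs)) (hR.trans hs))
  have h_ge : ∀ R, 0 < R →
      -b ≤ (∫ s in Ioc 0 R, momentDensity Q (volterraSol b Q) s) + A / (4 * R ^ 2) := by
    refine fun R hR => le_of_tendsto_of_tendsto' hβ.neg ((h_head R).add_const _) fun n => ?_
    rw [h_split n R hR]
    refine add_le_add le_rfl ((integral_Ioi_momentDensity_le (hq n).continuous (hq n).nonneg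
      (h_meas n) (isRadialNormal_volterraSol hp (hq n) (h n)).integrable hR).trans ?_)
    exact div_le_div_of_nonneg_right (hA n) (by positivity)
  have hi := integrableOn_Ioi_of_integral_Ioc_le (continuous_momentDensity hQ.continuous
    (continuous_volterraSol b hQ.continuous hQ.nonneg)) h_nonneg
    ((eventually_gt_atTop 0).mono h_le)
  refine (isBalanced_iff_integral_eq hQ.nonneg hi).2
    (integral_Ioi_eq_of_integral_Ioc_bounds hi (tendsto_const_nhds.div_atTop ?_) h_le h_ge)
  exact (tendsto_pow_atTop (by norm_num)).const_mul_atTop (by norm_num)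

end Balanced

section Family

open Set Filter Topology

variable {p b c d τ β : ℝ} {Q U : ℝ → ℝ}

lemma isAdmissibleProfile_powerProfile (hp : 0 ≤ p) (hc : c ∈ Icc 0 1) (hd : d ∈ Icc 0 1) :
    IsAdmissibleProfile p (powerProfile p c d) :=
  ⟨continuous_powerProfile hp c d, fun _ hs => powerProfile_nonneg hc.1 hd.1 hs.le, fun _ hs =>
    add_le_add hc.2 (mul_le_of_le_one_left (Real.rpow_nonneg hs.le _) hd.2)⟩

/-- The profiles `(1 - τ) + τ s^{4p}`, `0 ≤ τ ≤ 1`, joining the two extreme masses. -/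
noncomputable def familyProfile (p τ : ℝ) : ℝ → ℝ :=
  powerProfile p (1 - τ) τ

lemma isAdmissibleProfile_familyProfile (hp : 0 ≤ p) (hτ : τ ∈ Icc 0 1) :
    IsAdmissibleProfile p (familyProfile p τ) :=
  isAdmissibleProfile_powerProfile hp ⟨by linarith [hτ.2], by linarith [hτ.1]⟩ hτ

lemma abs_familyProfile_sub_le (hp : 0 ≤ p) (τ τ' : ℝ) {s R : ℝ} (hs : s ∈ Ioc 0 R) :
    |familyProfile p τ s - familyProfile p τ' s| ≤ |τ - τ'| * (1 + R ^ (4 * p)) := by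
  have h_sub : familyProfile p τ s - familyProfile p τ' s = (τ - τ') * (s ^ (4 * p) - 1) := by
    unfold familyProfile powerProfile; ring
  have h_nonneg : 0 ≤ s ^ (4 * p) := Real.rpow_nonneg hs.1.le _
  have h_le : s ^ (4 * p) ≤ R ^ (4 * p) := Real.rpow_le_rpow hs.1.le hs.2 (by positivity)
  rw [h_sub, abs_mul]
  exact mul_le_mul_of_nonneg_left (abs_le.2 ⟨by linarith, by linarith⟩) (abs_nonneg _)

lemma continuous_familyProfile_apply (p s : ℝ) : Continuous fun τ => familyProfile p τ s :=
  (continuous_const.sub continuous_id).add (continuous_id.mul continuous_const)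

lemma tendsto_volterraSol_familyProfile {ι : Type*} {l : Filter ι} (hp : 0 ≤ p)
    (hτ : τ ∈ Icc 0 1) {t β : ι → ℝ} (ht : ∀ i, t i ∈ Icc (0 : ℝ) 1) (htτ : Tendsto t l (𝓝 τ))
    (hβ : Tendsto β l (𝓝 b)) {s : ℝ} (hs : 0 < s) :
    Tendsto (fun i => volterraSol (β i) (familyProfile p (t i)) s) l
      (𝓝 (volterraSol b (familyProfile p τ) s)) := by
  have hQ := isAdmissibleProfile_familyProfile hp hτ
  have hq := fun i => isAdmissibleProfile_familyProfile hp (ht i)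
  refine tendsto_volterraSol (fun i => (hq i).continuous) (fun i => (hq i).nonneg) hQ.continuous
    hQ.nonneg hβ hs (M := 1 + s ^ (4 * p)) (by positivity) (fun _ => hQ.le_of_mem_Ioc hp)
    (δ := fun i => |τ - t i| * (1 + s ^ (4 * p))) ?_
    fun i _ => abs_familyProfile_sub_le hp _ _
  simpa using (htτ.const_sub τ).abs.mul_const (1 + s ^ (4 * p))

/-- The shooting parameter balancing the profile `Q`; meaningful for admissible `Q`, for which it
exists and is unique. -/
noncomputable def balancedParam (Q : ℝ → ℝ) : ℝ :=
  Classical.epsilon fun b => IsBalanced b Q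

lemma isBalanced_balancedParam (hp : 0 ≤ p) (hQ : IsAdmissibleProfile p Q) :
    IsBalanced (balancedParam Q) Q :=
  Classical.epsilon_spec ((exists_isBalanced hp hQ).imp fun _ h => h.2)

lemma balancedParam_mem_Icc (hp : 0 ≤ p) (hQ : IsAdmissibleProfile p Q) :
    balancedParam Q ∈ Icc (-shootingBound p) 0 := by
  obtain ⟨b, hb, h⟩ := exists_isBalanced hp hQ
  have h_bal := isBalanced_balancedParam hp hQ
  exact ⟨hb.trans_eq (h.unique h_bal hQ.continuous hQ.nonneg), h_bal.nonpos⟩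

/-- The radial normal solution, with potential vanishing at the origin, for the profile
`familyProfile p τ`. -/
noncomputable def familySol (p τ : ℝ) : ℝ → ℝ :=
  volterraSol (balancedParam (familyProfile p τ)) (familyProfile p τ)

lemma isRadialNormal_familySol (hp : 0 ≤ p) (hτ : τ ∈ Icc 0 1) :
    IsRadialNormal (powerProfile p (1 - τ) τ) (familySol p τ) :=
  have hQ := isAdmissibleProfile_familyProfile hp hτ
  isRadialNormal_volterraSol hp hQ (isBalanced_balancedParam hp hQ)

lemma radialMass_familySol_le (hp : 0 ≤ p) (hτ : τ ∈ Icc 0 1) :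
    radialMass (familyProfile p τ) (familySol p τ) ≤ 2 + 2 * p := by
  have hc : 0 ≤ 1 - τ := sub_nonneg.2 hτ.2
  have h := isRadialNormal_familySol hp hτ
  exact (h.radialMass_eq hc hτ.1).trans_le (h.mass_le hp hc hτ.1)

lemma tendsto_balancedParam_familyProfile (hp : 0 ≤ p) (hτ : τ ∈ Icc 0 1) {t : ℕ → ℝ}
    (ht : ∀ n, t n ∈ Icc (0 : ℝ) 1) (htτ : Tendsto t atTop (𝓝 τ)) :
    Tendsto (fun n => balancedParam (familyProfile p (t n))) atTop
      (𝓝 (balancedParam (familyProfile p τ))) := by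
  refine tendsto_of_subseq_tendsto fun φ hφ => ?_
  have hq := fun n => isAdmissibleProfile_familyProfile hp (ht (φ n))
  obtain ⟨b, -, ψ, hψ, h_lim⟩ :=
    isCompact_Icc.tendsto_subseq fun n => balancedParam_mem_Icc hp (hq n)
  refine ⟨ψ, ?_⟩
  have hQ := isAdmissibleProfile_familyProfile hp hτ
  have h_sub : Tendsto (fun n => t (φ (ψ n))) atTop (𝓝 τ) :=
    htτ.comp (hφ.comp hψ.tendsto_atTop)
  have h_bal : IsBalanced b (familyProfile p τ) :=
    isBalanced_of_tendsto hp hQ (fun n => hq (ψ n))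
      (fun n => isBalanced_balancedParam hp (hq (ψ n))) h_lim
      (fun s _ => ((continuous_familyProfile_apply p s).tendsto τ).comp h_sub)
      (fun s hs => tendsto_volterraSol_familyProfile hp hτ (fun n => ht _) h_sub h_lim hs)
      (fun n => radialMass_familySol_le hp (ht _))
  rwa [(isBalanced_balancedParam hp hQ).unique h_bal hQ.continuous hQ.nonneg]

lemma tendsto_familySol (hp : 0 ≤ p) (hτ : τ ∈ Icc 0 1) {t : ℕ → ℝ}
    (ht : ∀ n, t n ∈ Icc (0 : ℝ) 1) (htτ : Tendsto t atTop (𝓝 τ)) {s : ℝ} (hs : 0 < s) :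
    Tendsto (fun n => familySol p (t n) s) atTop (𝓝 (familySol p τ s)) :=
  tendsto_volterraSol_familyProfile hp hτ ht htτ
    (tendsto_balancedParam_familyProfile hp hτ ht htτ) hs

lemma radialMass_le_of_tendsto {q V : ℕ → ℝ → ℝ} {x : ℝ}
    (hq : ∀ n s, 0 < s → 0 ≤ q n s) (hi : ∀ n, IntegrableOn (radialDensity (q n) (V n)) (Ioi 0))
    (hQ : ∀ s, 0 < s → 0 ≤ Q s) (hiQ : IntegrableOn (radialDensity Q U) (Ioi 0))
    (hqQ : ∀ s, 0 < s → Tendsto (fun n => q n s) atTop (𝓝 (Q s)))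
    (hVU : ∀ s, 0 < s → Tendsto (fun n => V n s) atTop (𝓝 (U s)))
    (hx : ∀ n, radialMass (q n) (V n) ≤ x) : radialMass Q U ≤ x := by
  have h_lim : ∀ s, 0 < s → Tendsto (fun n => radialDensity (q n) (V n) s) atTop
      (𝓝 (radialDensity Q U s)) := fun s hs =>
    ((hqQ s hs).mul ((Real.continuous_exp.tendsto _).comp ((hVU s hs).const_mul 4))).mul_const _
  have h_ofReal : ∀ {P W : ℝ → ℝ}, (∀ s, 0 < s → 0 ≤ P s) →
      IntegrableOn (radialDensity P W) (Ioi 0) →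
      ENNReal.ofReal (radialMass P W) = ∫⁻ s in Ioi 0, ENNReal.ofReal (radialDensity P W s) :=
    fun hP h => ofReal_integral_eq_lintegral_ofReal h
      ((ae_restrict_mem measurableSet_Ioi).mono fun s hs => radialDensity_nonneg (hP s hs)
        (le_of_lt hs))
  rw [← ENNReal.ofReal_le_ofReal_iff ((radialMass_nonneg (hq 0)).trans (hx 0)), h_ofReal hQ hiQ]
  calc ∫⁻ s in Ioi 0, ENNReal.ofReal (radialDensity Q U s)
      = ∫⁻ s in Ioi 0, liminf (fun n => ENNReal.ofReal (radialDensity (q n) (V n) s)) atTop :=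
        setLIntegral_congr_fun measurableSet_Ioi fun s hs =>
          (((ENNReal.continuous_ofReal.tendsto _).comp (h_lim s hs)).liminf_eq).symm
    _ ≤ liminf (fun n => ∫⁻ s in Ioi 0, ENNReal.ofReal (radialDensity (q n) (V n) s)) atTop :=
        lintegral_liminf_le' fun n => (hi n).aemeasurable.ennreal_ofReal
    _ ≤ ENNReal.ofReal x := by
        refine liminf_le_of_le (by isBoundedDefault) fun y hy => ?_
        obtain ⟨n, hn⟩ := hy.exists
        exact hn.trans ((h_ofReal (hq n) (hi n)).symm.trans_le (ENNReal.ofReal_le_ofReal (hx n)))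

lemma isClosed_radialMass_familySol_le (hp : 0 ≤ p) {q : ℝ → ℝ → ℝ}
    (hq : ∀ s, 0 < s → Continuous fun τ => q τ s)
    (hq0 : ∀ τ ∈ Icc (0 : ℝ) 1, ∀ s, 0 < s → 0 ≤ q τ s)
    (hi : ∀ τ ∈ Icc (0 : ℝ) 1, IntegrableOn (radialDensity (q τ) (familySol p τ)) (Ioi 0))
    (x : ℝ) : IsClosed {τ | τ ∈ Icc (0 : ℝ) 1 ∧ radialMass (q τ) (familySol p τ) ≤ x} := by
  refine IsSeqClosed.isClosed fun t τ ht htτ => ?_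
  have hτ : τ ∈ Icc (0 : ℝ) 1 := isClosed_Icc.mem_of_tendsto htτ
    (Eventually.of_forall fun n => (ht n).1)
  exact ⟨hτ, radialMass_le_of_tendsto (fun n => hq0 _ (ht n).1) (fun n => hi _ (ht n).1)
    (hq0 τ hτ) (hi τ hτ) (fun s hs => ((hq s hs).tendsto τ).comp htτ)
    (fun s hs => tendsto_familySol hp hτ (fun n => (ht n).1) htτ hs) fun n => (ht n).2⟩

lemma isClosed_headMass_familySol_le (hp : 0 ≤ p) (x : ℝ) :
    IsClosed {τ | τ ∈ Icc (0 : ℝ) 1 ∧ headMass (1 - τ) (familySol p τ) ≤ x} :=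
  isClosed_radialMass_familySol_le hp (q := fun τ _ => 1 - τ)
    (fun _ _ => continuous_const.sub continuous_id) (fun _ hτ _ _ => sub_nonneg.2 hτ.2)
    (fun _ hτ => (isRadialNormal_familySol hp hτ).integrable_head (sub_nonneg.2 hτ.2) hτ.1) x

lemma isClosed_tailMass_familySol_le (hp : 0 ≤ p) (x : ℝ) :
    IsClosed {τ | τ ∈ Icc (0 : ℝ) 1 ∧ tailMass p τ (familySol p τ) ≤ x} :=
  isClosed_radialMass_familySol_le hp (q := fun τ s => τ * s ^ (4 * p))
    (fun _ _ => continuous_id.mul continuous_const)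
    (fun _ hτ _ hs => mul_nonneg hτ.1 (Real.rpow_nonneg hs.le _))
    (fun _ hτ => (isRadialNormal_familySol hp hτ).integrable_tail (sub_nonneg.2 hτ.2) hτ.1) x

lemma headMass_zero (U : ℝ → ℝ) : headMass 0 U = 0 := by
  simp [headMass, radialMass, radialDensity]

lemma tailMass_zero (p : ℝ) (U : ℝ → ℝ) : tailMass p 0 U = 0 := by
  simp [tailMass, radialMass, radialDensity]

lemma IsRadialNormal.headMass_eq_two (h : IsRadialNormal (powerProfile p c 0) U) (hp : 0 ≤ p)
    (hc : 0 < c) : headMass c U = 2 := by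
  have h_poh := h.pohozaev hp hc.le le_rfl
  rw [tailMass_zero] at h_poh
  have h_pos := h.headMass_pos hc le_rfl
  exact mul_left_cancel₀ h_pos.ne' (by linear_combination -2 * h_poh)

lemma IsRadialNormal.tailMass_eq_two_add (h : IsRadialNormal (powerProfile p 0 d) U) (hp : 0 ≤ p)
    (hd : 0 < d) : tailMass p d U = 2 + 2 * p := by
  have h_poh := h.pohozaev hp le_rfl hd.le
  rw [headMass_zero] at h_poh
  have h_pos := h.tailMass_pos le_rfl hd
  exact mul_left_cancel₀ h_pos.ne' (by linear_combination -2 * h_poh)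

lemma IsRadialNormal.mul_tailMass_eq (h : IsRadialNormal (powerProfile p c d) U) (hp : 0 ≤ p)
    (hc : 0 ≤ c) (hd : 0 ≤ d) : 2 * p * tailMass p d U =
      (headMass c U + tailMass p d U) * (headMass c U + tailMass p d U - 2) := by
  linear_combination 2 * h.pohozaev hp hc hd

lemma IsRadialNormal.mul_headMass_eq (h : IsRadialNormal (powerProfile p c d) U) (hp : 0 ≤ p)
    (hc : 0 ≤ c) (hd : 0 ≤ d) : 2 * p * headMass c U =
      (headMass c U + tailMass p d U) * (2 * p + 2 - (headMass c U + tailMass p d U)) := by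
  linear_combination -2 * h.pohozaev hp hc hd

lemma mul_sub_two_le_iff {m : ℝ} (hm : 1 < m) (hβ : 1 < β) :
    m * (m - 2) ≤ β * (β - 2) ↔ m ≤ β := by
  constructor <;> intro h <;> nlinarith

lemma mul_two_mul_add_two_sub_le_iff {m : ℝ} (hm : p + 1 < m) (hβ : p + 1 < β) :
    m * (2 * p + 2 - m) ≤ β * (2 * p + 2 - β) ↔ β ≤ m := by
  constructor <;> intro h <;> nlinarith

lemma IsRadialNormal.tailMass_le_iff (h : IsRadialNormal (powerProfile p c d) U) (hp : 0 < p)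
    (hc : 0 < c) (hd : 0 < d) (hβ : 2 < β) :
    tailMass p d U ≤ β * (β - 2) / (2 * p) ↔ headMass c U + tailMass p d U ≤ β := by
  have hm := (le_max_left _ _).trans_lt (h.mass_mem_Ioo hp hc hd).1
  rw [le_div_iff₀' (by positivity), h.mul_tailMass_eq hp.le hc.le hd.le,
    mul_sub_two_le_iff (by linarith) (by linarith)]

lemma IsRadialNormal.headMass_le_iff (h : IsRadialNormal (powerProfile p c d) U) (hp : 0 < p)
    (hc : 0 < c) (hd : 0 < d) (hβ : max 2 (2 * p) < β) :
    headMass c U ≤ β * (2 * p + 2 - β) / (2 * p) ↔ β ≤ headMass c U + tailMass p d U := by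
  have h_mass := (h.mass_mem_Ioo hp hc hd).1
  rw [max_lt_iff] at h_mass hβ
  rw [le_div_iff₀' (by positivity), h.mul_headMass_eq hp.le hc.le hd.le,
    mul_two_mul_add_two_sub_le_iff (by linarith) (by linarith)]

/- The two sublevel sets are closed by lower semicontinuity and cover `[0, 1]`, which is connected;
the extreme masses `2` and `2 + 2p` exclude the endpoints. -/
lemma exists_headMass_le_and_tailMass_le (hp : 0 ≤ p) {x y : ℝ} (hx : x ∈ Ico 0 2)
    (hy : y ∈ Ico 0 (2 + 2 * p))
    (h_cover : ∀ τ ∈ Ioo (0 : ℝ) 1,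
      headMass (1 - τ) (familySol p τ) ≤ x ∨ tailMass p τ (familySol p τ) ≤ y) :
    ∃ τ ∈ Ioo (0 : ℝ) 1, headMass (1 - τ) (familySol p τ) ≤ x ∧
      tailMass p τ (familySol p τ) ≤ y := by
  have hN := fun τ (hτ : τ ∈ Icc (0 : ℝ) 1) => isRadialNormal_familySol hp hτ
  have h_head_one : headMass (1 - 1) (familySol p 1) ≤ x := by
    rw [sub_self, headMass_zero]; exact hx.1
  have h_tail_zero : tailMass p 0 (familySol p 0) ≤ y := (tailMass_zero p _).trans_le hy.1
  have h_cover' : ∀ τ ∈ Icc (0 : ℝ) 1,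
      headMass (1 - τ) (familySol p τ) ≤ x ∨ tailMass p τ (familySol p τ) ≤ y := by
    intro τ hτ
    rcases hτ.1.eq_or_lt with rfl | hτ0
    · exact Or.inr h_tail_zero
    rcases hτ.2.eq_or_lt with rfl | hτ1
    · exact Or.inl h_head_one
    exact h_cover τ ⟨hτ0, hτ1⟩
  obtain ⟨τ, hτ, ⟨-, h_head⟩, -, h_tail⟩ := isPreconnected_closed_iff.1 isPreconnected_Icc _ _
    (isClosed_headMass_familySol_le hp x) (isClosed_tailMass_familySol_le hp y)
    (fun τ hτ => (h_cover' τ hτ).imp (And.intro hτ) (And.intro hτ))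
    ⟨1, right_mem_Icc.2 zero_le_one, right_mem_Icc.2 zero_le_one, h_head_one⟩
    ⟨0, left_mem_Icc.2 zero_le_one, left_mem_Icc.2 zero_le_one, h_tail_zero⟩
  refine ⟨τ, ⟨hτ.1.lt_of_ne' ?_, hτ.2.lt_of_ne ?_⟩, h_head, h_tail⟩
  · rintro rfl
    rw [sub_zero, (by simpa using hN 0 hτ : IsRadialNormal (powerProfile p 1 0)
      (familySol p 0)).headMass_eq_two hp one_pos] at h_head
    linarith [hx.2]
  · rintro rfl
    rw [(by simpa using hN 1 hτ : IsRadialNormal (powerProfile p 0 1)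
      (familySol p 1)).tailMass_eq_two_add hp one_pos] at h_tail
    linarith [hy.2]

/- By the Pohozaev identity, `m ≥ β` and `m ≤ β` for the total mass `m` are upper bounds for the
head mass and the tail mass respectively. -/
theorem exists_isRadialNormal_mass_eq (hp : 0 < p) (hβ : β ∈ Ioo (max 2 (2 * p)) (2 + 2 * p)) :
    ∃ c > 0, ∃ d > 0, ∃ U, IsRadialNormal (powerProfile p c d) U ∧
      headMass c U + tailMass p d U = β := by
  obtain ⟨hβ_lower, hβ_upper⟩ := hβ
  obtain ⟨hβ2, hβp⟩ := max_lt_iff.1 hβ_lower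
  have hN := fun τ (hτ : τ ∈ Ioo (0 : ℝ) 1) =>
    isRadialNormal_familySol hp.le (Ioo_subset_Icc_self hτ)
  have h_head_iff := fun τ (hτ : τ ∈ Ioo (0 : ℝ) 1) =>
    (hN τ hτ).headMass_le_iff hp (sub_pos.2 hτ.2) hτ.1 hβ_lower
  have h_tail_iff := fun τ (hτ : τ ∈ Ioo (0 : ℝ) 1) =>
    (hN τ hτ).tailMass_le_iff hp (sub_pos.2 hτ.2) hτ.1 hβ2
  have hx : β * (2 * p + 2 - β) / (2 * p) ∈ Ico 0 2 :=
    ⟨div_nonneg (mul_nonneg (by linarith) (by linarith)) (by linarith),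
      (div_lt_iff₀ (by linarith)).2 (by nlinarith)⟩
  have hy : β * (β - 2) / (2 * p) ∈ Ico 0 (2 + 2 * p) :=
    ⟨div_nonneg (mul_nonneg (by linarith) (by linarith)) (by linarith),
      (div_lt_iff₀ (by linarith)).2 (by nlinarith)⟩
  obtain ⟨τ, hτ, h_head, h_tail⟩ := exists_headMass_le_and_tailMass_le hp.le hx hy fun τ hτ => by
    rw [h_head_iff τ hτ, h_tail_iff τ hτ]
    exact le_total _ _
  exact ⟨1 - τ, sub_pos.2 hτ.2, τ, hτ.1, familySol p τ, hN τ hτ,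
    le_antisymm ((h_tail_iff τ hτ).1 h_tail) ((h_head_iff τ hτ).1 h_head)⟩

lemma integral_Ioi_mul_comp_mul_left (g : ℝ → ℝ) {a : ℝ} (ha : 0 < a) :
    ∫ s in Ioi 0, a * g (a * s) = ∫ s in Ioi 0, g s := by
  rw [integral_const_mul, integral_comp_mul_left_Ioi g 0 ha, mul_zero, smul_eq_mul,
    mul_inv_cancel_left₀ ha.ne']

section Rescaling

variable {Q' : ℝ → ℝ} {a η : ℝ}

lemma radialDensity_comp_mul_left_add {s : ℝ} (h : a ^ 4 * Q (a * s) = Q' s * Real.exp (4 * η)) :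
    radialDensity Q' (fun s => U (a * s) + η) s = a * radialDensity Q U (a * s) := by
  rw [radialDensity, radialDensity, mul_add, Real.exp_add]
  linear_combination -(Real.exp (4 * U (a * s)) * s ^ 3) * h

lemma radialMass_comp_mul_left_add (ha : 0 < a)
    (h : ∀ s, 0 < s → a ^ 4 * Q (a * s) = Q' s * Real.exp (4 * η)) :
    radialMass Q' (fun s => U (a * s) + η) = radialMass Q U := by
  rw [radialMass, radialMass, ← integral_Ioi_mul_comp_mul_left (radialDensity Q U) ha]
  exact setIntegral_congr_fun measurableSet_Ioi fun s hs =>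
    radialDensity_comp_mul_left_add (h s hs)

theorem IsRadialNormal.comp_mul_left_add (hU : IsRadialNormal Q U) (ha : 0 < a)
    (h : ∀ s, 0 < s → a ^ 4 * Q (a * s) = Q' s * Real.exp (4 * η)) :
    IsRadialNormal Q' fun s => U (a * s) + η := by
  have h_density : ∀ s ∈ Ioi (0 : ℝ), a * radialDensity Q U (a * s) =
      radialDensity Q' (fun s => U (a * s) + η) s := fun s hs =>
    (radialDensity_comp_mul_left_add (h s hs)).symm
  obtain ⟨C, hC⟩ := hU.exists_eq
  refine ⟨(hU.continuous.comp (continuous_const.mul continuous_id)).add continuous_const,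
    IntegrableOn.congr_fun (Integrable.const_mul ?_ a) h_density measurableSet_Ioi, C + η,
    fun r hr => ?_⟩
  · exact (integrableOn_Ioi_comp_mul_left_iff _ 0 ha).2 (by rw [mul_zero]; exact hU.integrable)
  · rw [hC (a * r) (by positivity), ← integral_Ioi_mul_comp_mul_left _ ha, add_sub_right_comm]
    congr 2
    refine setIntegral_congr_fun measurableSet_Ioi fun s hs => ?_
    rw [← h_density s hs, mul_div_mul_left _ _ ha.ne']
    ring

end Rescaling

theorem exists_isRadialNormal_radialMass_eq (hp : 0 < p) {κ : ℝ} (hκ : 0 < κ)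
    (hβ : β ∈ Ioo (max 2 (2 * p)) (2 + 2 * p)) :
    ∃ U, IsRadialNormal (powerProfile p κ κ) U ∧ radialMass (powerProfile p κ κ) U = β := by
  obtain ⟨c, hc, d, hd, U, hU, h_mass⟩ := exists_isRadialNormal_mass_eq hp hβ
  rw [← hU.radialMass_eq hc.le hd.le] at h_mass
  set a := (c / d) ^ (1 / (4 * p)) with ha
  have ha_pos : 0 < a := by positivity
  have ha_rpow : d * a ^ (4 * p) = c := by
    rw [ha, ← Real.rpow_mul (by positivity), one_div_mul_cancel (by positivity), Real.rpow_one]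
    field_simp
  set η := Real.log (a ^ 4 * c / κ) / 4 with hη
  have hη_exp : κ * Real.exp (4 * η) = a ^ 4 * c := by
    rw [hη, mul_div_cancel₀ _ (by norm_num : (4 : ℝ) ≠ 0), Real.exp_log (by positivity)]
    field_simp
  have h_profile : ∀ s, 0 < s →
      a ^ 4 * powerProfile p c d (a * s) = powerProfile p κ κ s * Real.exp (4 * η) := by
    intro s hs
    rw [powerProfile, powerProfile, Real.mul_rpow ha_pos.le hs.le]
    linear_combination a ^ 4 * s ^ (4 * p) * ha_rpow - (1 + s ^ (4 * p)) * hη_exp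
  exact ⟨_, hU.comp_mul_left_add ha_pos h_profile,
    (radialMass_comp_mul_left_add ha_pos h_profile).trans h_mass⟩

end Family

section Flat

open Set Filter Topology

/-- `E` is `k` times differentiable on `(0, ∞)` and its derivatives of order `j ≤ k` are
`o(r^{k-j})` at the origin. -/
def IsFlat : ℕ → (ℝ → ℝ) → Prop
  | 0, E => ContinuousOn E (Ioi 0) ∧ Tendsto E (𝓝[>] 0) (𝓝 0)
  | k + 1, E => ∃ E' : ℝ → ℝ, (∀ r, 0 < r → HasDerivAt E (E' r) r) ∧ IsFlat k E' ∧
      IsFlat k fun r => E r / r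

variable {E E₁ E₂ : ℝ → ℝ} {k m : ℕ}

lemma IsFlat.congr (h : IsFlat k E₁) (heq : ∀ r, 0 < r → E₁ r = E₂ r) : IsFlat k E₂ := by
  induction k generalizing E₁ E₂ with
  | zero =>
    refine ⟨h.1.congr fun r hr => (heq r hr).symm, h.2.congr' ?_⟩
    filter_upwards [self_mem_nhdsWithin] with r hr using heq r hr
  | succ k ih =>
    obtain ⟨E', hderiv, hflat', hflat_div⟩ := h
    refine ⟨E', fun r hr => (hderiv r hr).congr_of_eventuallyEq ?_, hflat',
      ih hflat_div fun r hr => by rw [heq r hr]⟩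
    filter_upwards [lt_mem_nhds hr] with x hx using (heq x hx).symm

lemma IsFlat.add (h₁ : IsFlat k E₁) (h₂ : IsFlat k E₂) : IsFlat k fun r => E₁ r + E₂ r := by
  induction k generalizing E₁ E₂ with
  | zero => exact ⟨h₁.1.add h₂.1, by simpa using h₁.2.add h₂.2⟩
  | succ k ih =>
    obtain ⟨F₁, hderiv₁, hflat₁, hflat_div₁⟩ := h₁
    obtain ⟨F₂, hderiv₂, hflat₂, hflat_div₂⟩ := h₂
    exact ⟨fun r => F₁ r + F₂ r, fun r hr => (hderiv₁ r hr).add (hderiv₂ r hr), ih hflat₁ hflat₂,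
      (ih hflat_div₁ hflat_div₂).congr fun r _ => by ring⟩

lemma IsFlat.const_mul (h : IsFlat k E) (c : ℝ) : IsFlat k fun r => c * E r := by
  induction k generalizing E with
  | zero => exact ⟨continuousOn_const.mul h.1, by simpa using h.2.const_mul c⟩
  | succ k ih =>
    obtain ⟨F, hderiv, hflat', hflat_div⟩ := h
    exact ⟨fun r => c * F r, fun r hr => (hderiv r hr).const_mul c, ih hflat',
      (ih hflat_div).congr fun r _ => by ring⟩

lemma IsFlat.of_succ (h : IsFlat (k + 1) E) : IsFlat k E := by
  induction k generalizing E with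
  | zero =>
    obtain ⟨F, hderiv, -, -, hdiv⟩ := h
    refine ⟨fun r hr => (hderiv r hr).continuousAt.continuousWithinAt, ?_⟩
    have hid : Tendsto (fun r : ℝ => r) (𝓝[>] 0) (𝓝 0) :=
      tendsto_id.mono_left nhdsWithin_le_nhds
    have hmul : Tendsto (fun r => r * (E r / r)) (𝓝[>] 0) (𝓝 0) := by simpa using hid.mul hdiv
    refine hmul.congr' ?_
    filter_upwards [self_mem_nhdsWithin] with r hr
    have : r ≠ 0 := ne_of_gt hr
    field_simp
  | succ k ih =>
    obtain ⟨F, hderiv, hflat', hflat_div⟩ := h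
    exact ⟨F, hderiv, ih hflat', ih hflat_div⟩

lemma IsFlat.zero (h : IsFlat k E) : IsFlat 0 E := by
  induction k with
  | zero => exact h
  | succ k ih => exact ih h.of_succ

lemma IsFlat.exists_continuous (h : IsFlat k E) :
    ∃ F : ℝ → ℝ, Continuous F ∧ F 0 = 0 ∧ ∀ r, 0 < r → F r = E r := by
  obtain ⟨hcont, hzero⟩ := h.zero
  refine ⟨fun r => if 0 < r then E r else 0, ?_, by simp, fun r hr => by simp [hr]⟩
  refine continuous_iff_continuousAt.2 fun r => ?_
  rcases lt_trichotomy r 0 with hr | rfl | hr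
  · refine continuousAt_const.congr (f := fun _ => (0 : ℝ)) ?_
    filter_upwards [gt_mem_nhds hr] with x hx
    simp [hx.le]
  · rw [ContinuousAt, ← nhdsLE_sup_nhdsGT, tendsto_sup]
    simp only [lt_self_iff_false, if_false]
    constructor
    · refine tendsto_const_nhds.congr' ?_
      filter_upwards [self_mem_nhdsWithin] with x hx
      simp [mem_Iic.1 hx]
    · refine hzero.congr' ?_
      filter_upwards [self_mem_nhdsWithin] with x hx
      simp [mem_Ioi.1 hx]
  · refine (hcont.continuousAt (Ioi_mem_nhds hr)).congr ?_
    filter_upwards [lt_mem_nhds hr] with x hx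
    simp [hx]

/-- The weighted radial mean `r⁻⁽ᵐ⁺¹⁾ ∫₀ʳ sᵐ f(s) ds`. -/
noncomputable def radialMean (m : ℕ) (f : ℝ → ℝ) (r : ℝ) : ℝ :=
  (∫ s in (0 : ℝ)..r, s ^ m * f s) / r ^ (m + 1)

lemma radialMean_congr {r : ℝ} (hr : 0 < r) (h : ∀ s, 0 < s → E₁ s = E₂ s) :
    radialMean m E₁ r = radialMean m E₂ r := by
  unfold radialMean
  congr 1
  refine intervalIntegral.integral_congr_ae (Eventually.of_forall fun s hs => ?_)
  rw [uIoc_of_le hr.le] at hs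
  rw [h s hs.1]

lemma hasDerivAt_radialMean_of_continuous {f : ℝ → ℝ} (hf : Continuous f) (m : ℕ) {r : ℝ}
    (hr : 0 < r) :
    HasDerivAt (radialMean m f) (f r / r - (m + 1) * (radialMean m f r / r)) r := by
  have hc : Continuous fun s : ℝ => s ^ m * f s := (continuous_pow m).mul hf
  have hint : HasDerivAt (fun r => ∫ s in (0 : ℝ)..r, s ^ m * f s) (r ^ m * f r) r :=
    intervalIntegral.integral_hasDerivAt_right (hc.intervalIntegrable _ _)
      (hc.stronglyMeasurableAtFilter _ _) hc.continuousAt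
  refine (hint.div (hasDerivAt_pow (m + 1) r) (by positivity)).congr_deriv ?_
  unfold radialMean
  rw [Nat.add_sub_cancel]
  have : r ≠ 0 := hr.ne'
  push_cast
  field_simp
  ring

lemma IsFlat.hasDerivAt_radialMean (h : IsFlat k E) (m : ℕ) {r : ℝ} (hr : 0 < r) :
    HasDerivAt (radialMean m E) (E r / r - (m + 1) * (radialMean m E r / r)) r := by
  obtain ⟨F, hF, -, hFE⟩ := h.exists_continuous
  have := hasDerivAt_radialMean_of_continuous hF m hr
  rw [hFE r hr, radialMean_congr hr hFE] at this
  refine this.congr_of_eventuallyEq ?_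
  filter_upwards [lt_mem_nhds hr] with x hx using (radialMean_congr hx hFE).symm

lemma radialMean_div {r : ℝ} (hr : 0 < r) (m : ℕ) (E : ℝ → ℝ) :
    radialMean m E r / r = radialMean (m + 1) (fun s => E s / s) r := by
  unfold radialMean
  have : ∫ s in (0 : ℝ)..r, s ^ (m + 1) * (E s / s) = ∫ s in (0 : ℝ)..r, s ^ m * E s := by
    refine intervalIntegral.integral_congr_ae (Eventually.of_forall fun s hs => ?_)
    rw [uIoc_of_le hr.le] at hs
    have : s ≠ 0 := hs.1.ne'
    field_simp
    ring
  rw [this, div_div, ← pow_succ]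

lemma tendsto_radialMean_zero (h : IsFlat 0 E) (m : ℕ) :
    Tendsto (radialMean m E) (𝓝[>] 0) (𝓝 0) := by
  rw [Metric.tendsto_nhds]
  intro ε hε
  obtain ⟨δ, hδ, hδE⟩ :=
    mem_nhdsGT_iff_exists_Ioo_subset.1 ((Metric.tendsto_nhds.1 h.2) (ε / 2) (half_pos hε))
  filter_upwards [Ioo_mem_nhdsGT hδ] with r ⟨hr0, hrδ⟩
  have hint : ‖∫ s in (0 : ℝ)..r, s ^ m * E s‖ ≤ r ^ m * (ε / 2) * |r - 0| := by
    refine intervalIntegral.norm_integral_le_of_norm_le_const fun s hs => ?_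
    rw [uIoc_of_le hr0.le] at hs
    have hE : dist (E s) 0 < ε / 2 := hδE ⟨hs.1, hs.2.trans_lt hrδ⟩
    rw [dist_zero_right] at hE
    rw [norm_mul, norm_pow, Real.norm_of_nonneg hs.1.le]
    exact mul_le_mul (pow_le_pow_left₀ hs.1.le hs.2 m) hE.le (norm_nonneg _) (by positivity)
  have hpow : 0 < r ^ (m + 1) := pow_pos hr0 _
  rw [sub_zero, abs_of_pos hr0] at hint
  rw [dist_zero_right, radialMean, norm_div, Real.norm_of_nonneg hpow.le, div_lt_iff₀ hpow]
  calc ‖∫ s in (0 : ℝ)..r, s ^ m * E s‖ ≤ r ^ m * (ε / 2) * r := hint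
    _ = ε / 2 * r ^ (m + 1) := by ring
    _ < ε * r ^ (m + 1) := mul_lt_mul_of_pos_right (half_lt_self hε) hpow

lemma isFlat_radialMean (h : IsFlat k E) (m : ℕ) : IsFlat k (radialMean m E) := by
  induction k generalizing E m with
  | zero =>
    exact ⟨fun r hr => (h.hasDerivAt_radialMean m hr).continuousAt.continuousWithinAt,
      tendsto_radialMean_zero h m⟩
  | succ k ih =>
    have hderiv := fun r (hr : 0 < r) => h.hasDerivAt_radialMean m hr
    obtain ⟨_, -, -, hflat_div⟩ := h
    have hmean_div : IsFlat k fun r => radialMean m E r / r :=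
      (ih hflat_div (m + 1)).congr fun r hr => (radialMean_div hr m E).symm
    exact ⟨_, hderiv, (hflat_div.add (hmean_div.const_mul (-(m + 1)))).congr fun r _ => by ring,
      hmean_div⟩

lemma IsFlat.of_deriv {V V' : ℝ → ℝ} (hd : ∀ r, 0 < r → HasDerivAt V (V' r) r)
    (h : IsFlat k V') (h0 : Tendsto V (𝓝[>] 0) (𝓝 0)) : IsFlat (k + 1) V := by
  refine ⟨V', hd, h, (isFlat_radialMean h 0).congr fun r hr => ?_⟩
  obtain ⟨F, hF, -, hFV⟩ := h.exists_continuous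
  rw [← radialMean_congr hr hFV]
  unfold radialMean
  simp only [pow_zero, one_mul, zero_add, pow_one]
  congr 1
  have hV : IsFlat 0 V := ⟨fun r hr => (hd r hr).continuousAt.continuousWithinAt, h0⟩
  obtain ⟨W, hW, hW0, hWV⟩ := hV.exists_continuous
  rw [intervalIntegral.integral_eq_sub_of_hasDerivAt_of_le (f := W) hr.le hW.continuousOn
    (fun x hx => ?_) (hF.intervalIntegrable _ _), hW0, sub_zero, hWV r hr]
  rw [hFV x hx.1]
  refine (hd x hx.1).congr_of_eventuallyEq ?_
  filter_upwards [lt_mem_nhds hx.1] with y hy using hWV y hy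

lemma IsFlat.hasDerivAt_pow_mul_radialMean (h : IsFlat k E) (m j : ℕ) {r : ℝ} (hr : 0 < r) :
    HasDerivAt (fun r => r ^ (j + 1) * radialMean m E r)
      (r ^ j * E r + ((j : ℝ) - m) * (r ^ j * radialMean m E r)) r := by
  refine ((hasDerivAt_pow (j + 1) r).mul (h.hasDerivAt_radialMean m hr)).congr_deriv ?_
  rw [Nat.add_sub_cancel]
  have : r ≠ 0 := hr.ne'
  push_cast
  field_simp
  ring

lemma IsFlat.mul_radialMean (h : IsFlat k E) (m : ℕ) :
    IsFlat (k + 1) fun r => r * radialMean m E r := by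
  refine ⟨_, fun r hr => ?_, h.add ((isFlat_radialMean h m).const_mul (-m)),
    (isFlat_radialMean h m).congr fun r hr => ?_⟩
  · have := h.hasDerivAt_pow_mul_radialMean m 0 hr
    simp only [zero_add, pow_one, pow_zero, one_mul, Nat.cast_zero, zero_sub] at this
    exact this
  · have : r ≠ 0 := hr.ne'
    field_simp

lemma IsFlat.sq_mul_radialMean (h : IsFlat k E) {α β γ : ℝ} (hs : α + β + γ = 0) :
    IsFlat (k + 2) fun r => r ^ 2 * (α * radialMean 1 E r + β * radialMean 3 E r +
      γ * radialMean 5 E r) := by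
  refine ⟨_, fun r hr => ?_, ((h.mul_radialMean 3).const_mul (-2 * β)).add
    ((h.mul_radialMean 5).const_mul (-4 * γ)), ((((h.mul_radialMean 1).const_mul α).add
    ((h.mul_radialMean 3).const_mul β)).add ((h.mul_radialMean 5).const_mul γ)).congr
    fun r hr => ?_⟩
  · have hderiv := ((((h.hasDerivAt_pow_mul_radialMean 1 1 hr).const_mul α).add
      ((h.hasDerivAt_pow_mul_radialMean 3 1 hr).const_mul β)).add
      ((h.hasDerivAt_pow_mul_radialMean 5 1 hr).const_mul γ))
    refine (hderiv.congr_deriv ?_).congr_of_eventuallyEq (Eventually.of_forall fun x => ?_)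
    · push_cast
      linear_combination r * E r * hs
    · simp only [Pi.add_apply]
      ring
  · have : r ≠ 0 := hr.ne'
    field_simp

/-- The operator `f ↦ u'` for the solution `u` of `Δ² u = f` in the radial variable. -/
noncomputable def biharmonicFlux (f : ℝ → ℝ) (r : ℝ) : ℝ :=
  r ^ 3 * (radialMean 1 f r / 2 - radialMean 3 f r + radialMean 5 f r / 2)

lemma isFlat_biharmonicFlux (h : IsFlat k E) : IsFlat (k + 3) (biharmonicFlux E) := by
  have hflat_deriv := h.sq_mul_radialMean (α := 1 / 2) (β := 1) (γ := -(3 / 2)) (by norm_num)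
  have hflat_div := h.sq_mul_radialMean (α := 1 / 2) (β := -1) (γ := 1 / 2) (by norm_num)
  refine ⟨_, fun r hr => ?_, hflat_deriv, hflat_div.congr fun r hr => ?_⟩
  · have hderiv := ((((h.hasDerivAt_pow_mul_radialMean 1 2 hr).const_mul (1 / 2)).sub
      (h.hasDerivAt_pow_mul_radialMean 3 2 hr)).add
      ((h.hasDerivAt_pow_mul_radialMean 5 2 hr).const_mul (1 / 2)))
    refine (hderiv.congr_deriv ?_).congr_of_eventuallyEq (Eventually.of_forall fun x => ?_)
    · push_cast
      ring
    · simp only [Pi.add_apply, Pi.sub_apply, biharmonicFlux]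
      ring
  · have : r ≠ 0 := hr.ne'
    unfold biharmonicFlux
    field_simp
    ring

end Flat

section EvenPolynomial

open Polynomial Set Filter Topology

lemma derivative_surjective {K : Type*} [Field K] [CharZero K] :
    Function.Surjective (derivative : K[X] → K[X]) := fun q => by
  induction q using Polynomial.induction_on' with
  | add p q hp hq =>
    obtain ⟨s, hs⟩ := hp
    obtain ⟨t, ht⟩ := hq
    exact ⟨s + t, by rw [derivative_add, hs, ht]⟩
  | monomial n a =>
    refine ⟨monomial (n + 1) (a / (n + 1)), ?_⟩
    rw [derivative_monomial, Nat.add_sub_cancel]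
    congr 1
    push_cast
    have : (n + 1 : K) ≠ 0 := Nat.cast_add_one_ne_zero n
    field_simp

lemma exists_add_two_mul_X_mul_derivative_eq {K : Type*} [Field K] [CharZero K] (q : K[X]) :
    ∃ s : K[X], s + 2 * X * derivative s = q := by
  induction q using Polynomial.induction_on' with
  | add p q hp hq =>
    obtain ⟨s, hs⟩ := hp
    obtain ⟨t, ht⟩ := hq
    exact ⟨s + t, by rw [derivative_add, ← hs, ← ht]; ring⟩
  | monomial n a =>
    refine ⟨C (a / (2 * n + 1)) * X ^ n, ?_⟩
    have hcoeff : (C (a / (2 * n + 1)) : K[X]) * (2 * n + 1) = C a := by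
      have : (2 * n + 1 : K) ≠ 0 := by exact_mod_cast Nat.succ_ne_zero (2 * n)
      rw [show (2 * n + 1 : K[X]) = C (2 * n + 1 : K) by
        rw [map_add, map_mul, map_ofNat, map_natCast, map_one], ← C_mul]
      congr 1
      field_simp
    rw [← C_mul_X_pow_eq_monomial, ← hcoeff]
    cases n with
    | zero => simp
    | succ n =>
      rw [derivative_C_mul_X_pow]
      simp only [Nat.add_sub_cancel, C_mul]
      push_cast
      simp only [map_add, map_natCast, map_one]
      ring

lemma continuous_eval_sq (q : ℝ[X]) : Continuous fun r : ℝ => q.eval (r ^ 2) :=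
  q.continuous.comp (continuous_pow 2)

lemma hasDerivAt_eval_sq (s : ℝ[X]) (r : ℝ) :
    HasDerivAt (fun r => s.eval (r ^ 2)) (2 * r * (derivative s).eval (r ^ 2)) r := by
  refine ((s.hasDerivAt (r ^ 2)).comp r (hasDerivAt_pow 2 r)).congr_deriv ?_
  push_cast
  ring

lemma odd_deriv_of_even {g : ℝ → ℝ} (hg : Function.Even g) : Function.Odd (deriv g) := fun x => by
  have := deriv_comp_neg g x
  rw [show (fun x => g (-x)) = g from funext hg] at this
  rw [this, neg_neg]

lemma even_deriv_of_odd {g : ℝ → ℝ} (hg : Function.Odd g) : Function.Even (deriv g) := fun x => by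
  have := deriv_comp_neg g x
  rw [show (fun x => g (-x)) = fun x => -g x from funext hg, deriv.fun_neg] at this
  exact (neg_injective this).symm

lemma tendsto_nhdsGT_zero {g : ℝ → ℝ} (hg : Continuous g) (hg0 : g 0 = 0) :
    Tendsto g (𝓝[>] 0) (𝓝 0) := by
  simpa only [hg0] using (hg.tendsto 0).mono_left nhdsWithin_le_nhds

lemma exists_isFlat_sub_eval_sq_of_deriv {k : ℕ} {g : ℝ → ℝ} {q : ℝ[X]}
    (hg : Differentiable ℝ g) (hq : IsFlat k fun r => deriv g r - r * q.eval (r ^ 2)) :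
    ∃ s : ℝ[X], IsFlat (k + 1) fun r => g r - s.eval (r ^ 2) := by
  obtain ⟨s, hs⟩ := derivative_surjective (C (1 / 2) * q)
  refine ⟨s + C (g 0 - s.eval 0), IsFlat.of_deriv (fun r _ => ?_) hq
    (tendsto_nhdsGT_zero (hg.continuous.sub (continuous_eval_sq _)) (by simp))⟩
  simp only [eval_add, eval_C]
  refine ((hg r).hasDerivAt.sub ((hasDerivAt_eval_sq s r).add_const _)).congr_deriv ?_
  rw [hs, eval_mul, eval_C]
  ring

lemma exists_isFlat_sub_mul_eval_sq_of_deriv {k : ℕ} {g : ℝ → ℝ} {q : ℝ[X]}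
    (hg : Differentiable ℝ g) (hg0 : g 0 = 0)
    (hq : IsFlat k fun r => deriv g r - q.eval (r ^ 2)) :
    ∃ s : ℝ[X], IsFlat (k + 1) fun r => g r - r * s.eval (r ^ 2) := by
  obtain ⟨s, hs⟩ := exists_add_two_mul_X_mul_derivative_eq q
  refine ⟨s, IsFlat.of_deriv (fun r _ => ?_) hq (tendsto_nhdsGT_zero
    (hg.continuous.sub (continuous_id.mul (continuous_eval_sq s))) (by simp [hg0]))⟩
  refine ((hg r).hasDerivAt.sub ((hasDerivAt_id r).mul (hasDerivAt_eval_sq s r))).congr_deriv ?_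
  rw [← hs]
  simp only [eval_add, eval_mul, eval_X, eval_ofNat, id]
  ring

/- The even and the odd case are proved together, since differentiation exchanges them. -/
lemma exists_isFlat_sub_eval_sq_and {k : ℕ} {g : ℝ → ℝ} (hg : ContDiff ℝ k g) :
    (Function.Even g → ∃ q : ℝ[X], IsFlat k fun r => g r - q.eval (r ^ 2)) ∧
    (Function.Odd g → ∃ q : ℝ[X], IsFlat k fun r => g r - r * q.eval (r ^ 2)) := by
  induction k generalizing g with
  | zero =>
    have hcont : Continuous g := hg.continuous
    refine ⟨fun _ => ⟨C (g 0), ?_⟩, fun hodd => ⟨0, ?_⟩⟩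
    · have hsub : Continuous fun r => g r - (C (g 0)).eval (r ^ 2) :=
        hcont.sub (continuous_eval_sq _)
      exact ⟨hsub.continuousOn, tendsto_nhdsGT_zero hsub (by simp)⟩
    · simp only [eval_zero, mul_zero, sub_zero]
      exact ⟨hcont.continuousOn, tendsto_nhdsGT_zero hcont hodd.map_zero⟩
  | succ k ih =>
    have hdiff : Differentiable ℝ g := hg.differentiable (by simp)
    have hderiv : ContDiff ℝ k (deriv g) := by
      push_cast at hg
      exact (contDiff_succ_iff_deriv.1 hg).2.2
    refine ⟨fun heven => ?_, fun hodd => ?_⟩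
    · obtain ⟨q, hq⟩ := (ih hderiv).2 (odd_deriv_of_even heven)
      exact exists_isFlat_sub_eval_sq_of_deriv hdiff hq
    · obtain ⟨q, hq⟩ := (ih hderiv).1 (even_deriv_of_odd hodd)
      exact exists_isFlat_sub_mul_eval_sq_of_deriv hdiff hodd.map_zero hq

lemma radialMean_add {f g : ℝ → ℝ} (hf : Continuous f) (hg : Continuous g) (m : ℕ) (r : ℝ) :
    radialMean m (fun s => f s + g s) r = radialMean m f r + radialMean m g r := by
  have hint : ∀ {h : ℝ → ℝ}, Continuous h → IntervalIntegrable (fun s => s ^ m * h s) volume 0 r :=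
    fun hh => ((continuous_pow m).mul hh).intervalIntegrable _ _
  simp_rw [radialMean, mul_add]
  rw [intervalIntegral.integral_add (hint hf) (hint hg), add_div]

lemma exists_radialMean_eval_sq (m : ℕ) (q : ℝ[X]) :
    ∃ s : ℝ[X], ∀ r, 0 < r → radialMean m (fun s => q.eval (s ^ 2)) r = s.eval (r ^ 2) := by
  induction q using Polynomial.induction_on' with
  | add p q hp hq =>
    obtain ⟨s, hs⟩ := hp
    obtain ⟨t, ht⟩ := hq
    refine ⟨s + t, fun r hr => ?_⟩
    simp_rw [eval_add]
    rw [radialMean_add (continuous_eval_sq p) (continuous_eval_sq q), hs r hr, ht r hr]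
  | monomial n a =>
    refine ⟨monomial n (a / (m + 2 * n + 1)), fun r hr => ?_⟩
    have hintegrand : ∀ s : ℝ, s ^ m * (monomial n a).eval (s ^ 2) = a * s ^ (m + 2 * n) :=
      fun s => by rw [eval_monomial]; ring
    have : r ≠ 0 := hr.ne'
    have : (m + 2 * n + 1 : ℝ) ≠ 0 := by positivity
    simp_rw [radialMean, hintegrand]
    rw [intervalIntegral.integral_const_mul, integral_pow, eval_monomial,
      zero_pow (Nat.succ_ne_zero _), sub_zero]
    push_cast
    field_simp
    ring

/- Subtracting the polynomial solution for the right-hand side `q(r²)` leaves the flux of the flat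
remainder `f - q(r²)`, which is three orders flatter. -/
lemma exists_isFlat_add_four {k : ℕ} {U f : ℝ → ℝ} {b : ℝ} {q : ℝ[X]} (hU : Continuous U)
    (hf : Continuous f) (hderiv : ∀ r, 0 < r → HasDerivAt U (b * r + biharmonicFlux f r) r)
    (hq : IsFlat k fun r => f r - q.eval (r ^ 2)) :
    ∃ s : ℝ[X], s.eval 0 = U 0 ∧ IsFlat (k + 4) fun r => U r - s.eval (r ^ 2) := by
  have hmean : ∀ m, ∃ t : ℝ[X], ∀ r, 0 < r →
      radialMean m f r = radialMean m (fun r => f r - q.eval (r ^ 2)) r + t.eval (r ^ 2) :=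
    fun m => by
      obtain ⟨t, ht⟩ := exists_radialMean_eval_sq m q
      refine ⟨t, fun r hr => ?_⟩
      have hadd := radialMean_add (hf.sub (continuous_eval_sq q)) (continuous_eval_sq q) m r
      simp only [Pi.sub_apply, sub_add_cancel] at hadd
      rw [← ht r hr]
      exact hadd
  obtain ⟨q₁, hq₁⟩ := hmean 1
  obtain ⟨q₃, hq₃⟩ := hmean 3
  obtain ⟨q₅, hq₅⟩ := hmean 5
  obtain ⟨s, hs⟩ := derivative_surjective
    (C (1 / 2) * (C b + X * (C (1 / 2) * q₁ - q₃ + C (1 / 2) * q₅)))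
  refine ⟨s + C (U 0 - s.eval 0), by simp, IsFlat.of_deriv (fun r hr => ?_)
    (isFlat_biharmonicFlux hq)
    (tendsto_nhdsGT_zero (hU.sub (continuous_eval_sq _)) (by simp))⟩
  simp only [eval_add, eval_C]
  refine ((hderiv r hr).sub ((hasDerivAt_eval_sq s r).add_const _)).congr_deriv ?_
  rw [hs]
  unfold biharmonicFlux
  rw [hq₁ r hr, hq₃ r hr, hq₅ r hr]
  simp only [eval_add, eval_sub, eval_mul, eval_X, eval_C]
  ring

end EvenPolynomial

section RadialSmoothness

open Set Filter Topology Polynomial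

universe u

/-- `P` is a smooth angular factor: smooth away from the origin and constant along rays. -/
structure IsAngular {X F : Type*} [NormedAddCommGroup X] [NormedSpace ℝ X] [NormedAddCommGroup F]
    [NormedSpace ℝ F] (P : X → F) : Prop where
  contDiffOn : ContDiffOn ℝ ∞ P {0}ᶜ
  map_smul : ∀ {t : ℝ}, 0 < t → ∀ {x}, x ≠ 0 → P (t • x) = P x

open Classical in
/-- The product of a profile `E(|x|)` with an angular factor `P`, set to `0` at the origin. -/
noncomputable def radialProduct {X F : Type*} [NormedAddCommGroup X] [NormedAddCommGroup F]
    [NormedSpace ℝ F] (E : ℝ → ℝ) (P : X → F) (x : X) : F :=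
  if x = 0 then 0 else E ‖x‖ • P x

section Normed

variable {X F : Type*} [NormedAddCommGroup X] [NormedAddCommGroup F] [NormedSpace ℝ F]
  {E : ℝ → ℝ} {P : X → F} {x : X}

lemma radialProduct_of_ne (hx : x ≠ 0) : radialProduct E P x = E ‖x‖ • P x := if_neg hx

lemma radialProduct_zero (E : ℝ → ℝ) (P : X → F) : radialProduct E P 0 = 0 := if_pos rfl

lemma radialProduct_eventuallyEq (hx : x ≠ 0) :
    radialProduct E P =ᶠ[𝓝 x] fun y => E ‖y‖ • P y := by
  filter_upwards [isOpen_compl_singleton.mem_nhds hx] with y hy using radialProduct_of_ne hy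

lemma tendsto_comp_norm_mul (hE : Tendsto E (𝓝[>] 0) (𝓝 0)) (C : ℝ) :
    Tendsto (fun x : X => |E ‖x‖| * C) (𝓝[≠] 0) (𝓝 0) := by
  simpa using (hE.comp (tendsto_norm_nhdsNE_zero (E := X))).abs.mul_const C

variable [NormedSpace ℝ X]

lemma isAngular_const (v : F) : IsAngular fun _ : X => v := ⟨contDiffOn_const, fun _ _ _ => rfl⟩

lemma IsAngular.hasFDerivAt (hP : IsAngular P) (hx : x ≠ 0) :
    HasFDerivAt P (fderiv ℝ P x) x :=
  ((hP.contDiffOn.differentiableOn (by simp)).differentiableAt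
    (isOpen_compl_singleton.mem_nhds hx)).hasFDerivAt

lemma IsAngular.smul_fderiv_smul (hP : IsAngular P) {t : ℝ} (ht : 0 < t) (hx : x ≠ 0) :
    t • fderiv ℝ P (t • x) = fderiv ℝ P x := by
  rw [← fderiv_comp_smul]
  refine EventuallyEq.fderiv_eq ?_
  filter_upwards [isOpen_compl_singleton.mem_nhds hx] with y hy using hP.map_smul ht hy

lemma IsAngular.exists_bound [FiniteDimensional ℝ X] (hP : IsAngular P) :
    ∃ C, ∀ x, x ≠ 0 → ‖P x‖ ≤ C := by
  have hcont : ContinuousOn P (Metric.sphere (0 : X) 1) :=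
    hP.contDiffOn.continuousOn.mono fun x hx => ne_zero_of_mem_unit_sphere ⟨x, hx⟩
  obtain ⟨C, hC⟩ := (isCompact_sphere (0 : X) 1).exists_bound_of_continuousOn hcont
  refine ⟨C, fun x hx => ?_⟩
  rw [← hP.map_smul (inv_pos.2 (norm_pos_iff.2 hx)) hx]
  refine hC _ ?_
  rw [mem_sphere_zero_iff_norm, norm_smul, norm_inv, norm_norm,
    inv_mul_cancel₀ (norm_ne_zero_iff.2 hx)]

lemma continuous_radialProduct [FiniteDimensional ℝ X] (hE : IsFlat 0 E) (hP : IsAngular P) :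
    Continuous (radialProduct E P) := by
  obtain ⟨C, hC⟩ := hP.exists_bound
  refine continuous_iff_continuousAt.2 fun x => ?_
  by_cases hx : x = 0
  · subst hx
    rw [continuousAt_iff_punctured_nhds, radialProduct_zero]
    refine squeeze_zero_norm' ?_ (tendsto_comp_norm_mul (X := X) hE.2 C)
    filter_upwards [self_mem_nhdsWithin] with x hx
    rw [radialProduct_of_ne hx, norm_smul, Real.norm_eq_abs]
    exact mul_le_mul_of_nonneg_left (hC x hx) (abs_nonneg _)
  · refine ContinuousAt.congr ?_ (radialProduct_eventuallyEq hx).symm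
    exact ((hE.1.continuousAt (Ioi_mem_nhds (norm_pos_iff.2 hx))).comp
      continuous_norm.continuousAt).smul (hP.hasFDerivAt hx).continuousAt

lemma hasFDerivAt_radialProduct_zero [FiniteDimensional ℝ X]
    (hE : Tendsto (fun r => E r / r) (𝓝[>] 0) (𝓝 0)) (hP : IsAngular P) :
    HasFDerivAt (radialProduct E P) (0 : X →L[ℝ] F) 0 := by
  obtain ⟨C, hC⟩ := hP.exists_bound
  rw [hasFDerivAt_iff_isLittleO_nhds_zero]
  simp only [radialProduct_zero, zero_add, sub_zero, zero_apply]
  rw [Asymptotics.isLittleO_iff]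
  intro ε hε
  filter_upwards [eventually_nhdsWithin_iff.1
    ((tendsto_comp_norm_mul (X := X) hE C).eventually (gt_mem_nhds hε))] with x hlt
  rcases eq_or_ne x 0 with rfl | hx
  · simp [radialProduct_zero]
  · have hx_norm : 0 < ‖x‖ := norm_pos_iff.2 hx
    have hquot : |E ‖x‖| / ‖x‖ * C < ε := by simpa [abs_div] using hlt hx
    rw [radialProduct_of_ne hx, norm_smul, Real.norm_eq_abs]
    calc |E ‖x‖| * ‖P x‖ ≤ |E ‖x‖| * C := mul_le_mul_of_nonneg_left (hC x hx) (abs_nonneg _)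
      _ = |E ‖x‖| / ‖x‖ * C * ‖x‖ := by field_simp
      _ ≤ ε * ‖x‖ := mul_le_mul_of_nonneg_right hquot.le hx_norm.le

end Normed

section Inner

variable {X F : Type*} [NormedAddCommGroup X] [InnerProductSpace ℝ X] [NormedAddCommGroup F]
  [NormedSpace ℝ F] {E E' : ℝ → ℝ} {P : X → F} {x : X}

lemma contDiffOn_norm_compl_zero : ContDiffOn ℝ ∞ (fun x : X => ‖x‖) {0}ᶜ := fun _ hx =>
  (contDiffAt_norm ℝ hx).contDiffWithinAt

lemma isAngular_smulRight_fderiv_norm (hP : IsAngular P) :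
    IsAngular fun x => (fderiv ℝ (fun y : X => ‖y‖) x).smulRight (P x) where
  contDiffOn := ContDiffOn.smulRight
    (contDiffOn_norm_compl_zero.fderiv_of_isOpen isOpen_compl_singleton (by simp)) hP.contDiffOn
  map_smul ht _ hx := by rw [fderiv_norm_smul_pos ht, hP.map_smul ht hx]

lemma isAngular_norm_smul_fderiv (hP : IsAngular P) :
    IsAngular fun x => ‖x‖ • fderiv ℝ P x where
  contDiffOn := contDiffOn_norm_compl_zero.smul
    (hP.contDiffOn.fderiv_of_isOpen isOpen_compl_singleton (by simp))
  map_smul {t} ht x hx := by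
    rw [norm_smul, Real.norm_of_nonneg ht.le, mul_comm, mul_smul, hP.smul_fderiv_smul ht hx]

/- The derivative is again a sum of products of flat profiles with smooth angular factors, which
makes the smoothness of such products an induction on the flatness. -/
lemma hasFDerivAt_radialProduct [FiniteDimensional ℝ X]
    (hE : ∀ r, 0 < r → HasDerivAt E (E' r) r)
    (hE_div : Tendsto (fun r => E r / r) (𝓝[>] 0) (𝓝 0)) (hP : IsAngular P) (x : X) :
    HasFDerivAt (radialProduct E P)
      (radialProduct E' (fun x => (fderiv ℝ (fun y : X => ‖y‖) x).smulRight (P x)) x +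
        radialProduct (fun r => E r / r) (fun x => ‖x‖ • fderiv ℝ P x) x) x := by
  rcases eq_or_ne x 0 with rfl | hx
  · rw [radialProduct_zero, radialProduct_zero, add_zero]
    exact hasFDerivAt_radialProduct_zero hE_div hP
  · have hx_norm : 0 < ‖x‖ := norm_pos_iff.2 hx
    have hnorm : HasFDerivAt (fun y : X => ‖y‖) (fderiv ℝ (fun y : X => ‖y‖) x) x :=
      ((contDiffAt_norm ℝ hx (n := 1)).differentiableAt one_ne_zero).hasFDerivAt
    rw [radialProduct_of_ne hx, radialProduct_of_ne hx]
    refine ((((hE ‖x‖ hx_norm).comp_hasFDerivAt x hnorm).smul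
      (hP.hasFDerivAt hx)).congr_fderiv ?_).congr_of_eventuallyEq (radialProduct_eventuallyEq hx)
    ext v
    simp only [Function.comp_apply, add_apply, smul_apply, ContinuousLinearMap.smulRight_apply,
      smul_smul, smul_eq_mul]
    rw [div_mul_cancel₀ _ hx_norm.ne', add_comm]

end Inner

theorem contDiff_radialProduct {X F : Type u} [NormedAddCommGroup X] [InnerProductSpace ℝ X]
    [FiniteDimensional ℝ X] [NormedAddCommGroup F] [NormedSpace ℝ F] {k : ℕ} {E : ℝ → ℝ}
    {P : X → F} (hE : IsFlat k E) (hP : IsAngular P) : ContDiff ℝ k (radialProduct E P) := by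
  induction k generalizing E F with
  | zero => exact contDiff_zero.2 (continuous_radialProduct hE hP)
  | succ k ih =>
    obtain ⟨E', hderiv, hE', hE_div⟩ := hE
    push_cast
    exact contDiff_succ_iff_hasFDerivAt.2 ⟨_, (ih hE' (isAngular_smulRight_fderiv_norm hP)).add
      (ih hE_div (isAngular_norm_smul_fderiv hP)),
      hasFDerivAt_radialProduct hderiv hE_div.zero.2 hP⟩

lemma contDiff_comp_norm_of_isFlat_sub {X : Type} [NormedAddCommGroup X] [InnerProductSpace ℝ X]
    [FiniteDimensional ℝ X] {k : ℕ} {U : ℝ → ℝ} {s : ℝ[X]} (hs : s.eval 0 = U 0)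
    (h : IsFlat k fun r => U r - s.eval (r ^ 2)) : ContDiff ℝ k fun x : X => U ‖x‖ := by
  have hpoly : ContDiff ℝ k fun x : X => s.eval (‖x‖ ^ 2) := by
    have : ContDiff ℝ k fun t : ℝ => s.eval t := by
      simpa [Polynomial.coe_aeval_eq_eval] using s.contDiff_aeval (𝕜 := ℝ) (R := ℝ) k
    exact this.comp (contDiff_norm_sq ℝ)
  have heq : (fun x : X => U ‖x‖) = fun x => s.eval (‖x‖ ^ 2) +
      radialProduct (fun r => U r - s.eval (r ^ 2)) (fun _ => (1 : ℝ)) x := by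
    ext x
    rcases eq_or_ne x 0 with rfl | hx
    · simp [radialProduct_zero, hs]
    · simp [radialProduct_of_ne hx]
  rw [heq]
  exact hpoly.add (contDiff_radialProduct h (isAngular_const 1))

end RadialSmoothness

section RadialNormalRegularity

open Set Filter Topology

variable {Q U f : ℝ → ℝ}

lemma fluxKernel_div_mul_cube {r s : ℝ} (hr : 0 < r) (hs : 0 < s) :
    fluxKernel (r / s) * s ^ 3 = r ^ 2 / 2 * s -
      (Ioc 0 r).indicator (fun s => r ^ 2 / 2 * s + s ^ 5 / (2 * r ^ 2) - s ^ 3) s := by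
  rcases lt_or_ge r s with hrs | hsr
  · rw [indicator_of_notMem (fun h => absurd h.2 (not_le.2 hrs)), fluxKernel,
      if_pos ((div_le_one hs).2 hrs.le), sub_zero]
    field_simp
  · rw [indicator_of_mem (show s ∈ Ioc 0 r from ⟨hs, hsr⟩), fluxKernel]
    split_ifs with hle
    · obtain rfl : r = s := le_antisymm ((div_le_one hs).1 hle) hsr
      field_simp
      ring
    · field_simp
      ring

lemma integrableOn_mul_of_integrableOn_mul_cube (hf : Continuous f)
    (hint : IntegrableOn (fun s => f s * s ^ 3) (Ioi 0)) :
    IntegrableOn (fun s => s * f s) (Ioi 0) := by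
  have hcont : Continuous fun s => s * f s := continuous_id.mul hf
  rw [← Ioc_union_Ioi_eq_Ioi zero_le_one]
  refine IntegrableOn.union (hcont.integrableOn_Icc.mono_set Ioc_subset_Icc_self) ?_
  refine (hint.mono_set (Ioi_subset_Ioi zero_le_one)).norm.mono' hcont.aestronglyMeasurable ?_
  filter_upwards [ae_restrict_mem measurableSet_Ioi] with s hs
  have hs_one : 1 < s := hs
  rw [norm_mul, norm_mul _ (s ^ 3), mul_comm]
  refine mul_le_mul_of_nonneg_left ?_ (norm_nonneg _)
  rw [Real.norm_of_nonneg (by positivity), Real.norm_of_nonneg (by positivity)]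
  exact le_self_pow₀ hs_one.le (by norm_num)

lemma intervalIntegral_mul_eq_biharmonicFlux (hf : Continuous f) {r : ℝ} (hr : 0 < r) :
    ∫ s in (0 : ℝ)..r, f s * (r ^ 2 / 2 * s + s ^ 5 / (2 * r ^ 2) - s ^ 3) =
      r * biharmonicFlux f r := by
  have hint : ∀ m : ℕ, IntervalIntegrable (fun s => s ^ m * f s) volume 0 r := fun m =>
    ((continuous_pow m).mul hf).intervalIntegrable _ _
  calc
    _ = ∫ s in (0 : ℝ)..r, r ^ 2 / 2 * (s ^ 1 * f s) + s ^ 5 * f s / (2 * r ^ 2) - s ^ 3 * f s := by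
      congr 1
      ext s
      ring
    _ = r ^ 2 / 2 * (∫ s in (0 : ℝ)..r, s ^ 1 * f s) +
        (∫ s in (0 : ℝ)..r, s ^ 5 * f s) / (2 * r ^ 2) - ∫ s in (0 : ℝ)..r, s ^ 3 * f s := by
      rw [← intervalIntegral.integral_const_mul, ← intervalIntegral.integral_div,
        ← intervalIntegral.integral_add ((hint 1).const_mul _) ((hint 5).div_const _),
        ← intervalIntegral.integral_sub (((hint 1).const_mul _).add ((hint 5).div_const _))
          (hint 3)]
    _ = _ := by
      unfold biharmonicFlux radialMean
      field_simp
      ring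

/- Inside the ball the flux kernel differs from its outer branch `r² / 2 · s` by the polynomial that
defines `biharmonicFlux`. -/
lemma integral_fluxKernel_mul_eq (hf : Continuous f)
    (hint : IntegrableOn (fun s => f s * s ^ 3) (Ioi 0)) {r : ℝ} (hr : 0 < r) :
    ∫ s in Ioi 0, fluxKernel (r / s) * (f s * s ^ 3) =
      r ^ 2 / 2 * (∫ s in Ioi 0, s * f s) - r * biharmonicFlux f r := by
  set g : ℝ → ℝ := fun s => f s * (r ^ 2 / 2 * s + s ^ 5 / (2 * r ^ 2) - s ^ 3) with hg
  have hg_cont : Continuous g := by fun_prop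
  have hg_int : IntegrableOn g (Ioc 0 r) :=
    hg_cont.integrableOn_Icc.mono_set Ioc_subset_Icc_self
  have hindicator : ∫ s in Ioi 0, (Ioc 0 r).indicator g s = r * biharmonicFlux f r := by
    rw [setIntegral_indicator measurableSet_Ioc, inter_eq_right.2 Ioc_subset_Ioi_self,
      ← intervalIntegral.integral_of_le hr.le, intervalIntegral_mul_eq_biharmonicFlux hf hr]
  rw [← hindicator, ← integral_const_mul,
    ← integral_sub ((integrableOn_mul_of_integrableOn_mul_cube hf hint).const_mul _)
      ((integrable_indicator_iff measurableSet_Ioc).2 hg_int).integrableOn]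
  refine setIntegral_congr_fun measurableSet_Ioi fun s hs => ?_
  simp only [mul_left_comm _ (f s), fluxKernel_div_mul_cube hr hs, hg, indicator_mul_right]
  ring

lemma IsRadialNormal.exists_hasDerivAt (h : IsRadialNormal Q U) (hQ : Continuous Q) :
    ∃ b, ∀ r, 0 < r → HasDerivAt U
      (b * r + biharmonicFlux (fun s => Q s * Real.exp (4 * U s)) r) r := by
  have hf : Continuous fun s => Q s * Real.exp (4 * U s) :=
    hQ.mul (Real.continuous_exp.comp (continuous_const.mul h.continuous))
  obtain ⟨C, hC⟩ := h.exists_eq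
  refine ⟨-(1 / 2) * ∫ s in Ioi 0, s * (Q s * Real.exp (4 * U s)), fun r hr => ?_⟩
  have hU : HasDerivAt U (-((∫ s in Ioi 0, fluxKernel (r / s) * radialDensity Q U s) / r)) r := by
    refine ((hasDerivAt_integral_logKernel h.integrable (integrableOn_radialDensity_div hQ
      h.continuous h.integrable) hr).const_sub C).congr_of_eventuallyEq ?_
    filter_upwards [lt_mem_nhds hr] with x hx using hC x hx.le
  refine hU.congr_deriv ?_
  unfold radialDensity
  rw [integral_fluxKernel_mul_eq hf h.integrable hr]
  field_simp
  ring

variable {X : Type} [NormedAddCommGroup X] [InnerProductSpace ℝ X] [FiniteDimensional ℝ X]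

lemma IsRadialNormal.contDiff_add_four [Nontrivial X] (h : IsRadialNormal Q U) (hQ : Continuous Q)
    {k : ℕ} (hk : ContDiff ℝ k fun x : X => Q ‖x‖ * Real.exp (4 * U ‖x‖)) :
    ContDiff ℝ (k + 4 : ℕ) fun x : X => U ‖x‖ := by
  obtain ⟨b, hb⟩ := h.exists_hasDerivAt hQ
  obtain ⟨e, he⟩ := exists_norm_eq X zero_le_one
  have hline : ContDiff ℝ k fun t : ℝ => Q |t| * Real.exp (4 * U |t|) := by
    have hray : ContDiff ℝ k fun t : ℝ => t • e := contDiff_id.smul contDiff_const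
    convert hk.comp hray using 1
    ext t
    simp [norm_smul, he]
  obtain ⟨q, hq⟩ := (exists_isFlat_sub_eval_sq_and hline).1 fun x => by simp only [abs_neg]
  have hf : Continuous fun s => Q s * Real.exp (4 * U s) :=
    hQ.mul (Real.continuous_exp.comp (continuous_const.mul h.continuous))
  obtain ⟨s, hs_zero, hs⟩ := exists_isFlat_add_four h.continuous hf hb (q := q)
    (hq.congr fun r hr => by rw [abs_of_pos hr])
  exact contDiff_comp_norm_of_isFlat_sub hs_zero hs

lemma IsRadialNormal.contDiff_four [Nontrivial X] (h : IsRadialNormal Q U) (hQ : Continuous Q) :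
    ContDiff ℝ 4 fun x : X => U ‖x‖ := by
  have hcont : Continuous fun x : X => Q ‖x‖ * Real.exp (4 * U ‖x‖) :=
    (hQ.comp continuous_norm).mul
      (Real.continuous_exp.comp (continuous_const.mul (h.continuous.comp continuous_norm)))
  simpa using h.contDiff_add_four hQ (k := 0) (contDiff_zero.2 hcont)

lemma IsRadialNormal.contDiff_top [Nontrivial X] (h : IsRadialNormal Q U) (hQ : Continuous Q)
    (hQ_smooth : ContDiff ℝ ∞ fun x : X => Q ‖x‖) : ContDiff ℝ ∞ fun x : X => U ‖x‖ := by
  have hfour_mul : ∀ j : ℕ, ContDiff ℝ (4 * j : ℕ) fun x : X => U ‖x‖ := fun j => by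
    induction j with
    | zero => exact contDiff_zero.2 (h.continuous.comp continuous_norm)
    | succ j ih =>
      refine h.contDiff_add_four hQ ?_
      exact (hQ_smooth.of_le (by exact_mod_cast le_top)).mul
        (Real.contDiff_exp.comp (contDiff_const.mul ih))
  exact contDiff_infty.2 fun n => (hfour_mul n).of_le (by exact_mod_cast by omega)

end RadialNormalRegularity

section AngularIntegral

open Set Filter Topology

lemma integral_cos_int_mul_of_ne_zero {k : ℤ} (hk : k ≠ 0) :
    ∫ θ in (0 : ℝ)..Real.pi, Real.cos (k * θ) = 0 := by
  rw [intervalIntegral.integral_comp_mul_left (fun x => Real.cos x) (Int.cast_ne_zero.2 hk),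
    integral_cos, Real.sin_int_mul_pi]
  simp

lemma integral_sin_sq_mul_cos_nat_mul {n : ℕ} (hn : n ≠ 0) :
    ∫ θ in (0 : ℝ)..Real.pi, Real.sin θ ^ 2 * Real.cos (n * θ) =
      if n = 2 then -(Real.pi / 4) else 0 := by
  have hprod : ∀ θ : ℝ, Real.sin θ ^ 2 * Real.cos (n * θ) = 1 / 2 * Real.cos ((n : ℤ) * θ) -
      1 / 4 * Real.cos (((n : ℤ) - 2 : ℤ) * θ) - 1 / 4 * Real.cos (((n : ℤ) + 2 : ℤ) * θ) := by
    intro θ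
    push_cast
    rw [sub_mul, add_mul, Real.cos_sub, Real.cos_add, Real.sin_sq_eq_half_sub]
    ring
  have hint : ∀ k : ℤ, IntervalIntegrable (fun θ => Real.cos (k * θ)) volume 0 Real.pi := fun k =>
    (Real.continuous_cos.comp (continuous_const.mul continuous_id)).intervalIntegrable _ _
  simp_rw [hprod]
  rw [intervalIntegral.integral_sub (((hint _).const_mul _).sub ((hint _).const_mul _))
      ((hint _).const_mul _),
    intervalIntegral.integral_sub ((hint _).const_mul _) ((hint _).const_mul _),
    intervalIntegral.integral_const_mul, intervalIntegral.integral_const_mul,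
    intervalIntegral.integral_const_mul, integral_cos_int_mul_of_ne_zero (by exact_mod_cast hn),
    integral_cos_int_mul_of_ne_zero (by omega : (n : ℤ) + 2 ≠ 0)]
  split_ifs with hn_two
  · subst hn_two
    simp
    ring
  · rw [integral_cos_int_mul_of_ne_zero (by omega)]
    simp

lemma norm_one_sub_mul_exp_sq (q θ : ℝ) :
    ‖1 - (q : ℂ) * Complex.exp (θ * Complex.I)‖ ^ 2 = 1 - 2 * q * Real.cos θ + q ^ 2 := by
  have hre : (1 - (q : ℂ) * Complex.exp (θ * Complex.I)).re = 1 - q * Real.cos θ := by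
    rw [Complex.sub_re, Complex.one_re, Complex.re_ofReal_mul, Complex.exp_ofReal_mul_I_re]
  have him : (1 - (q : ℂ) * Complex.exp (θ * Complex.I)).im = -(q * Real.sin θ) := by
    rw [Complex.sub_im, Complex.one_im, Complex.im_ofReal_mul, Complex.exp_ofReal_mul_I_im,
      zero_sub]
  rw [← Complex.normSq_eq_norm_sq, Complex.normSq_apply, hre, him]
  linear_combination q ^ 2 * Real.sin_sq_add_cos_sq θ

variable {q : ℝ}

lemma one_sub_two_mul_cos_add_sq_pos (hq : |q| < 1) (θ : ℝ) :
    0 < 1 - 2 * q * Real.cos θ + q ^ 2 := by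
  rw [← norm_one_sub_mul_exp_sq]
  refine pow_pos (norm_pos_iff.2 fun hzero => hq.ne ?_) 2
  simpa using congr_arg norm (sub_eq_zero.1 hzero).symm

lemma hasSum_pow_mul_cos_div (hq : |q| < 1) (θ : ℝ) :
    HasSum (fun n : ℕ => q ^ n * Real.cos (n * θ) / n)
      (-(1 / 2) * Real.log (1 - 2 * q * Real.cos θ + q ^ 2)) := by
  set z : ℂ := q * Complex.exp (θ * Complex.I) with hz
  have hz_norm : ‖z‖ = |q| := by
    rw [hz, norm_mul, Complex.norm_exp_ofReal_mul_I, mul_one, Complex.norm_real, Real.norm_eq_abs]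
  have hterm : ∀ n : ℕ, (z ^ n / n).re = q ^ n * Real.cos (n * θ) / n := fun n => by
    rw [hz, mul_pow, ← Complex.exp_nat_mul, ← Complex.ofReal_pow, ← mul_assoc,
      ← Complex.ofReal_natCast, ← Complex.ofReal_mul, Complex.div_ofReal_re,
      Complex.re_ofReal_mul, Complex.exp_ofReal_mul_I_re]
  have hlog : (-Complex.log (1 - z)).re =
      -(1 / 2) * Real.log (1 - 2 * q * Real.cos θ + q ^ 2) := by
    rw [Complex.neg_re, Complex.log_re, ← norm_one_sub_mul_exp_sq, Real.log_pow]
    push_cast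
    ring
  rw [← hlog]
  exact (Complex.hasSum_re (Complex.hasSum_taylorSeries_neg_log (hz_norm.trans_lt hq))).congr_fun
    fun n => (hterm n).symm

lemma integral_sin_sq_mul_pow_mul_cos_div (q : ℝ) (n : ℕ) :
    ∫ θ in (0 : ℝ)..Real.pi, Real.sin θ ^ 2 * (q ^ n * Real.cos (n * θ) / n) =
      if n = 2 then -(Real.pi * q ^ 2 / 8) else 0 := by
  rcases eq_or_ne n 0 with rfl | hn
  · simp
  calc
    _ = ∫ θ in (0 : ℝ)..Real.pi, q ^ n / n * (Real.sin θ ^ 2 * Real.cos (n * θ)) := by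
      congr 1
      ext θ
      ring
    _ = _ := by
      rw [intervalIntegral.integral_const_mul, integral_sin_sq_mul_cos_nat_mul hn]
      split_ifs with hn_two
      · subst hn_two
        push_cast
        ring
      · rw [mul_zero]

lemma norm_sin_sq_mul_pow_mul_cos_div_le (q θ : ℝ) (n : ℕ) :
    ‖Real.sin θ ^ 2 * (q ^ n * Real.cos (n * θ) / n)‖ ≤ |q| ^ n := by
  rcases eq_or_ne n 0 with rfl | hn
  · simp
  have hn_one : (1 : ℝ) ≤ n := by exact_mod_cast Nat.one_le_iff_ne_zero.2 hn
  have hcos : ‖Real.cos (n * θ)‖ ≤ 1 := Real.abs_cos_le_one _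
  rw [norm_mul, norm_div, norm_mul, norm_pow q, Real.norm_of_nonneg (sq_nonneg (Real.sin θ)),
    Real.norm_natCast, Real.norm_eq_abs q]
  calc
    _ ≤ 1 * (|q| ^ n * 1 / 1) := by
      gcongr
      exact Real.sin_sq_le_one θ
    _ = |q| ^ n := by ring

lemma integral_sin_sq_mul_log (hq : |q| < 1) :
    ∫ θ in (0 : ℝ)..Real.pi, Real.sin θ ^ 2 * Real.log (1 - 2 * q * Real.cos θ + q ^ 2) =
      Real.pi * q ^ 2 / 4 := by
  have hsum := intervalIntegral.hasSum_integral_of_dominated_convergence (μ := volume) (a := 0)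
    (b := Real.pi) (F := fun (n : ℕ) θ => Real.sin θ ^ 2 * (q ^ n * Real.cos (n * θ) / n))
    (fun n _ => |q| ^ n) (fun n => Continuous.aestronglyMeasurable (by fun_prop))
    (fun n => Eventually.of_forall fun θ _ => norm_sin_sq_mul_pow_mul_cos_div_le q θ n)
    (Eventually.of_forall fun _ _ => summable_geometric_of_lt_one (abs_nonneg q) hq)
    intervalIntegrable_const
    (Eventually.of_forall fun θ _ => (hasSum_pow_mul_cos_div hq θ).mul_left _)
  simp_rw [integral_sin_sq_mul_pow_mul_cos_div, mul_left_comm _ (-(1 / 2) : ℝ)] at hsum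
  rw [intervalIntegral.integral_const_mul] at hsum
  linarith [hsum.unique (hasSum_ite_eq 2 (-(Real.pi * q ^ 2 / 8)))]

lemma integral_sin_sq_mul_sub_log (hq : |q| < 1) (c : ℝ) :
    ∫ θ in (0 : ℝ)..Real.pi, Real.sin θ ^ 2 *
      (c - 1 / 2 * Real.log (1 - 2 * q * Real.cos θ + q ^ 2)) =
      Real.pi / 2 * (c - q ^ 2 / 4) := by
  have hlog : Continuous fun θ => Real.log (1 - 2 * q * Real.cos θ + q ^ 2) :=
    Continuous.log (by fun_prop) fun θ => (one_sub_two_mul_cos_add_sq_pos hq θ).ne'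
  simp_rw [mul_sub, mul_left_comm _ (1 / 2 : ℝ)]
  rw [intervalIntegral.integral_sub (Continuous.intervalIntegrable (by fun_prop) _ _)
      (Continuous.intervalIntegrable (by fun_prop) _ _), intervalIntegral.integral_mul_const,
    intervalIntegral.integral_const_mul, integral_sin_sq_mul_log hq, integral_sin_sq]
  simp only [Real.sin_zero, Real.sin_pi, zero_mul, sub_zero, zero_add]
  ring

/- Factoring out the larger of `r` and `s` leaves `log |1 - q e^{iθ}|` with `q < 1`. -/
lemma integral_sin_sq_mul_log_ratio {r s : ℝ} (hr : 0 ≤ r) (hs : 0 < s) (hne : r ≠ s) :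
    ∫ θ in (0 : ℝ)..Real.pi, Real.sin θ ^ 2 *
      Real.log (s / √(r ^ 2 - 2 * r * s * Real.cos θ + s ^ 2)) =
      -(Real.pi / 2) * logKernel (r / s) := by
  rcases lt_or_gt_of_ne hne with hrs | hsr
  · have hq : |r / s| < 1 := by rwa [abs_of_nonneg (by positivity), div_lt_one hs]
    have hlog : ∀ θ, Real.log (s / √(r ^ 2 - 2 * r * s * Real.cos θ + s ^ 2)) =
        0 - 1 / 2 * Real.log (1 - 2 * (r / s) * Real.cos θ + (r / s) ^ 2) := fun θ => by
      have hfactor : r ^ 2 - 2 * r * s * Real.cos θ + s ^ 2 =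
          s ^ 2 * (1 - 2 * (r / s) * Real.cos θ + (r / s) ^ 2) := by field_simp; ring
      rw [hfactor, Real.sqrt_mul (sq_nonneg s), Real.sqrt_sq hs.le, ← div_div, div_self hs.ne',
        one_div, Real.log_inv, Real.log_sqrt (one_sub_two_mul_cos_add_sq_pos hq θ).le]
      ring
    simp_rw [hlog]
    rw [integral_sin_sq_mul_sub_log hq, logKernel, if_pos ((div_lt_one hs).2 hrs).le]
    ring
  · have hr_pos : 0 < r := hs.trans hsr
    have hq : |s / r| < 1 := by rwa [abs_of_nonneg (by positivity), div_lt_one hr_pos]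
    have hlog : ∀ θ, Real.log (s / √(r ^ 2 - 2 * r * s * Real.cos θ + s ^ 2)) =
        Real.log (s / r) - 1 / 2 * Real.log (1 - 2 * (s / r) * Real.cos θ + (s / r) ^ 2) :=
      fun θ => by
        have hpos := one_sub_two_mul_cos_add_sq_pos hq θ
        have hfactor : r ^ 2 - 2 * r * s * Real.cos θ + s ^ 2 =
            r ^ 2 * (1 - 2 * (s / r) * Real.cos θ + (s / r) ^ 2) := by field_simp
        rw [hfactor, Real.sqrt_mul (sq_nonneg r), Real.sqrt_sq hr, ← div_div,
          Real.log_div (by positivity) (Real.sqrt_ne_zero'.2 hpos), Real.log_sqrt hpos.le]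
        ring
    simp_rw [hlog]
    rw [integral_sin_sq_mul_sub_log hq, logKernel, if_neg (not_le.2 ((one_lt_div hs).2 hsr)),
      ← inv_div s r, Real.log_inv, inv_pow, inv_inv]
    ring

end AngularIntegral

section PolarCoordinates

open Set ENNReal Measure

lemma lintegral_fun_norm_addHaar {E : Type*} [NormedAddCommGroup E] [NormedSpace ℝ E]
    [FiniteDimensional ℝ E] [MeasurableSpace E] [BorelSpace E] [Nontrivial E] (μ : Measure E)
    [μ.IsAddHaarMeasure] {f : ℝ → ℝ≥0∞} (hf : Measurable f) :
    ∫⁻ x, f ‖x‖ ∂μ = μ.toSphere univ *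
      ∫⁻ r in Ioi (0 : ℝ), ENNReal.ofReal (r ^ (Module.finrank ℝ E - 1)) * f r := by
  have hf_Ioi : Measurable fun r : Ioi (0 : ℝ) => f r := hf.comp measurable_subtype_coe
  calc
    _ = ∫⁻ x : ({(0)}ᶜ : Set E), f ‖x.1‖ ∂(μ.comap (↑)) := by
      rw [lintegral_subtype_comap (measurableSet_singleton _).compl fun x => f ‖x‖,
        restrict_compl_singleton]
    _ = ∫⁻ x, f x.2 ∂μ.toSphere.prod (volumeIoiPow (Module.finrank ℝ E - 1)) := by
      simpa only [homeomorphUnitSphereProd_apply_snd_coe] using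
        μ.measurePreserving_homeomorphUnitSphereProd.lintegral_comp
          (f := fun x => f x.2) (hf_Ioi.comp measurable_snd)
    _ = ∫⁻ _ : Metric.sphere (0 : E) 1,
          (∫⁻ r : Ioi (0 : ℝ), f r ∂volumeIoiPow (Module.finrank ℝ E - 1)) ∂μ.toSphere :=
      lintegral_prod _ (hf_Ioi.comp measurable_snd).aemeasurable
    _ = μ.toSphere univ * ∫⁻ r : Ioi (0 : ℝ), f r ∂volumeIoiPow (Module.finrank ℝ E - 1) := by
      rw [lintegral_const, mul_comm]
    _ = _ := by
      rw [volumeIoiPow, lintegral_withDensity_eq_lintegral_mul _ (by fun_prop) hf_Ioi]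
      congr 1
      exact lintegral_subtype_comap measurableSet_Ioi
        fun r => ENNReal.ofReal (r ^ (Module.finrank ℝ E - 1)) * f r

/-- The isometry `ℝ⁴ → ℝ × ℝ³` splitting off the first coordinate. -/
noncomputable def splitFirst (y : EuclideanSpace ℝ (Fin 4)) : ℝ × EuclideanSpace ℝ (Fin 3) :=
  (y 0, WithLp.toLp 2 fun i => y i.succ)

lemma measurePreserving_splitFirst : MeasurePreserving splitFirst := by
  have htoLp : MeasurePreserving (Prod.map (id : ℝ → ℝ) (WithLp.toLp 2 : (Fin 3 → ℝ) → _)) :=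
    (MeasurePreserving.id volume).prod (PiLp.volume_preserving_toLp (Fin 3))
  exact htoLp.comp ((volume_preserving_piFinSuccAbove (fun _ : Fin 4 => ℝ) 0).comp
    (PiLp.volume_preserving_ofLp (Fin 4)))

/-- The cylindrical coordinates `(y₀, |(y₁, y₂, y₃)|)` of a point of `ℝ⁴`: a function of `y` that
is symmetric about the first axis factors through them. -/
noncomputable def cylindrical (y : EuclideanSpace ℝ (Fin 4)) : ℝ × ℝ :=
  ((splitFirst y).1, ‖(splitFirst y).2‖)

lemma measurable_cylindrical : Measurable cylindrical :=
  (measurable_fst.comp measurePreserving_splitFirst.measurable).prodMk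
    (measurable_norm.comp (measurable_snd.comp measurePreserving_splitFirst.measurable))

lemma cylindrical_sq_add_sq (y : EuclideanSpace ℝ (Fin 4)) :
    (cylindrical y).1 ^ 2 + (cylindrical y).2 ^ 2 = ‖y‖ ^ 2 := by
  simp only [cylindrical, splitFirst, EuclideanSpace.real_norm_sq_eq, Fin.sum_univ_succ]

lemma norm_single_sub_sq (r : ℝ) (y : EuclideanSpace ℝ (Fin 4)) :
    ‖EuclideanSpace.single 0 r - y‖ ^ 2 = (r - (cylindrical y).1) ^ 2 + (cylindrical y).2 ^ 2 := by
  simp [cylindrical, splitFirst, EuclideanSpace.real_norm_sq_eq, Fin.sum_univ_succ]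

/-- The measure `s³ sin² θ ds dθ` on polar coordinates `(s, θ)`, `0 < s`, `0 < θ < π`, of the half
plane of cylindrical coordinates. -/
noncomputable def polarMeasure : Measure (ℝ × ℝ) :=
  ((volume.restrict (Ioi 0)).prod (volume.restrict (Ioo 0 Real.pi))).withDensity
    fun z => ENNReal.ofReal (z.1 ^ 3 * Real.sin z.2 ^ 2)

/-- The area of the unit sphere of `ℝ³`, which relates Lebesgue measure on `ℝ⁴` to
`polarMeasure`. -/
noncomputable def polarConst : ℝ≥0∞ :=
  (volume : Measure (EuclideanSpace ℝ (Fin 3))).toSphere univ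

lemma polarConst_ne_top : polarConst ≠ ⊤ := measure_ne_top _ _

lemma polarConst_ne_zero : polarConst ≠ 0 :=
  Measure.measure_univ_ne_zero.2 (toSphere_ne_zero _)

variable {F : ℝ × ℝ → ℝ≥0∞}

lemma lintegral_comp_cylindrical (hF : Measurable F) :
    ∫⁻ y, F (cylindrical y) =
      polarConst * ∫⁻ w : ℝ × ℝ, (Ioi 0).indicator (fun ρ => ENNReal.ofReal (ρ ^ 2)) w.2 * F w := by
  have hF_norm : Measurable fun w : ℝ × EuclideanSpace ℝ (Fin 3) => F (w.1, ‖w.2‖) :=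
    hF.comp (measurable_fst.prodMk (measurable_norm.comp measurable_snd))
  have hF_weight : Measurable fun w : ℝ × ℝ =>
      (Ioi 0).indicator (fun ρ => ENNReal.ofReal (ρ ^ 2)) w.2 * F w :=
    ((Measurable.indicator (by fun_prop) measurableSet_Ioi).comp measurable_snd).mul hF
  calc
    _ = ∫⁻ w : ℝ × EuclideanSpace ℝ (Fin 3), F (w.1, ‖w.2‖) :=
      measurePreserving_splitFirst.lintegral_comp hF_norm
    _ = ∫⁻ a : ℝ, ∫⁻ z : EuclideanSpace ℝ (Fin 3), F (a, ‖z‖) := by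
      rw [volume_eq_prod, lintegral_prod _ hF_norm.aemeasurable]
    _ = ∫⁻ a : ℝ, polarConst * ∫⁻ ρ : ℝ,
          (Ioi 0).indicator (fun ρ => ENNReal.ofReal (ρ ^ 2)) ρ * F (a, ρ) := by
      refine lintegral_congr fun a => ?_
      rw [lintegral_fun_norm_addHaar _ (f := fun ρ => F (a, ρ))
          (hF.comp (measurable_const.prodMk measurable_id)),
        finrank_euclideanSpace_fin, polarConst, ← lintegral_indicator measurableSet_Ioi]
      simp only [indicator_mul_left]
    _ = _ := by
      rw [lintegral_const_mul _ hF_weight.lintegral_prod_right', volume_eq_prod,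
        lintegral_prod _ hF_weight.aemeasurable]

lemma indicator_polarCoord_target (F : ℝ × ℝ → ℝ≥0∞) (z : ℝ × ℝ) :
    polarCoord.target.indicator (fun z => ENNReal.ofReal z.1 •
      ((Ioi 0).indicator (fun ρ => ENNReal.ofReal (ρ ^ 2)) (polarCoord.symm z).2 *
        F (polarCoord.symm z))) z =
    (Ioi 0 ×ˢ Ioo 0 Real.pi).indicator (fun z => ENNReal.ofReal (z.1 ^ 3 * Real.sin z.2 ^ 2) *
      F (polarCoord.symm z)) z := by
  obtain ⟨s, θ⟩ := z
  simp only [polarCoord_target, polarCoord_symm_apply, indicator, mem_prod, mem_Ioi, mem_Ioo,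
    smul_eq_mul]
  by_cases hz : 0 < s ∧ 0 < θ ∧ θ < Real.pi
  · obtain ⟨hs, hθ_pos, hθ_lt⟩ := hz
    have hsin := Real.sin_pos_of_pos_of_lt_pi hθ_pos hθ_lt
    rw [if_pos ⟨hs, by linarith, hθ_lt⟩, if_pos (mul_pos hs hsin), if_pos ⟨hs, hθ_pos, hθ_lt⟩,
      ← mul_assoc, ← ENNReal.ofReal_mul hs.le]
    congr 2
    ring
  · rw [if_neg hz]
    split_ifs with htarget hsin
    · obtain ⟨hs, hθ_gt, hθ_lt⟩ := htarget
      have hθ : θ ≤ 0 := not_lt.1 fun hθ_pos => hz ⟨hs, hθ_pos, hθ_lt⟩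
      exact absurd (pos_of_mul_pos_right hsin hs.le)
        (Real.sin_nonpos_of_nonpos_of_neg_pi_le hθ hθ_gt.le).not_gt
    · simp
    · rfl

lemma lintegral_polarMeasure (hF : Measurable F) :
    ∫⁻ z, F (polarCoord.symm z) ∂polarMeasure =
      ∫⁻ w : ℝ × ℝ, (Ioi 0).indicator (fun ρ => ENNReal.ofReal (ρ ^ 2)) w.2 * F w := by
  rw [← lintegral_comp_polarCoord_symm, polarMeasure,
    lintegral_withDensity_eq_lintegral_mul _ (by fun_prop)
      (g := fun z => F (polarCoord.symm z))
      (hF.comp continuous_polarCoord_symm.measurable), prod_restrict, ← volume_eq_prod,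
    ← lintegral_indicator (measurableSet_Ioi.prod measurableSet_Ioo),
    ← lintegral_indicator polarCoord.open_target.measurableSet]
  exact lintegral_congr fun z => (indicator_polarCoord_target F z).symm

lemma map_cylindrical : (volume : Measure (EuclideanSpace ℝ (Fin 4))).map cylindrical =
    polarConst • polarMeasure.map polarCoord.symm := by
  refine Measure.ext_of_lintegral _ fun F hF => ?_
  rw [lintegral_map hF measurable_cylindrical, lintegral_smul_measure, smul_eq_mul,
    lintegral_map hF continuous_polarCoord_symm.measurable, lintegral_comp_cylindrical hF,
    lintegral_polarMeasure hF]

end PolarCoordinates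

section LogPotential

open Set Filter Topology

section Integrability

variable {E : Type*} [NormedAddCommGroup E]

lemma abs_log_div_le (a b : ℝ) : |Real.log (a / b)| ≤ |Real.log a| + |Real.log b| := by
  rcases eq_or_ne a 0 with rfl | ha
  · simp
  rcases eq_or_ne b 0 with rfl | hb
  · simp
  rw [Real.log_div ha hb]
  exact abs_sub _ _

lemma abs_log_norm_div_norm_sub_le {x y : E} (hxy : 2 * ‖x‖ ≤ ‖y‖) :
    |Real.log (‖y‖ / ‖x - y‖)| ≤ Real.log 2 := by
  rcases eq_or_ne y 0 with rfl | hy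
  · simpa using Real.log_nonneg one_le_two
  have hy_pos : 0 < ‖y‖ := norm_pos_iff.2 hy
  have hlower : ‖y‖ - ‖x‖ ≤ ‖x - y‖ := norm_sub_rev x y ▸ norm_sub_norm_le y x
  have hupper : ‖x - y‖ ≤ ‖x‖ + ‖y‖ := norm_sub_le x y
  have hsub_pos : 0 < ‖x - y‖ := by linarith
  rw [abs_le, ← Real.log_inv]
  constructor
  · refine Real.log_le_log (by norm_num) ?_
    rw [le_div_iff₀ hsub_pos]
    linarith
  · refine Real.log_le_log (by positivity) ?_
    rw [div_le_iff₀ hsub_pos]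
    linarith

variable [NormedSpace ℝ E] [FiniteDimensional ℝ E] [Nontrivial E] [MeasurableSpace E]
  [BorelSpace E] {μ : Measure E} [μ.IsAddHaarMeasure]

lemma integrableOn_ball_log_norm (R : ℝ) :
    IntegrableOn (fun y => Real.log ‖y‖) (Metric.ball 0 R) μ := by
  rw [integrableOn_fun_norm_addHaar]
  have hlog : IntegrableOn Real.log (Icc 0 R) := by
    rcases le_total 0 R with hR | hR
    · exact (intervalIntegrable_iff_integrableOn_Icc_of_le hR).1
        intervalIntegral.intervalIntegrable_log'
    · exact IntegrableOn.of_measure_zero (by simp [hR])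
  exact (hlog.continuousOn_mul (continuous_pow _).continuousOn isCompact_Icc).mono_set
    Ioo_subset_Icc_self

/- Far from `0` and `x` the kernel is bounded, and near them it is a difference of two locally
integrable logarithms. -/
lemma integrable_log_norm_div_mul {h : E → ℝ} (hh : Continuous h) (hint : Integrable h μ) (x : E) :
    Integrable (fun y => Real.log (‖y‖ / ‖x - y‖) * h y) μ := by
  set R := 3 * ‖x‖ + 1
  set ℓ : E → ℝ := (Metric.ball 0 R).indicator fun y => Real.log ‖y‖ with hℓ
  have hℓ_int : Integrable ℓ μ :=
    (integrable_indicator_iff measurableSet_ball).2 (integrableOn_ball_log_norm R)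
  obtain ⟨M, hM⟩ :=
    (isCompact_closedBall (0 : E) R).exists_bound_of_continuousOn hh.continuousOn
  have hM_nonneg : 0 ≤ M :=
    (norm_nonneg _).trans (hM 0 (Metric.mem_closedBall_self (by positivity)))
  refine (((hℓ_int.norm.add (hℓ_int.comp_sub_left x).norm).mul_const M).add
    (hint.norm.const_mul (Real.log 2))).mono' (Measurable.aestronglyMeasurable
      ((Real.measurable_log.comp (by fun_prop)).mul hh.measurable))
    (Eventually.of_forall fun y => ?_)
  have : 0 ≤ Real.log 2 := Real.log_nonneg one_le_two
  simp only [Pi.add_apply, norm_mul]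
  rcases le_total (2 * ‖x‖) ‖y‖ with hfar | hnear
  · exact (mul_le_mul_of_nonneg_right (abs_log_norm_div_norm_sub_le hfar) (norm_nonneg _)).trans
      (le_add_of_nonneg_left (by positivity))
  · have hy : y ∈ Metric.ball (0 : E) R := by
      rw [mem_ball_zero_iff]
      linarith [norm_nonneg x]
    have hxy : x - y ∈ Metric.ball (0 : E) R := by
      rw [mem_ball_zero_iff]
      linarith [norm_sub_le x y]
    refine le_trans ?_ (le_add_of_nonneg_right (by positivity))
    rw [hℓ, indicator_of_mem hy, indicator_of_mem hxy]
    exact mul_le_mul (abs_log_div_le _ _) (hM y (Metric.ball_subset_closedBall hy))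
      (norm_nonneg _) (by positivity)

end Integrability

lemma integral_comp_cylindrical {H : ℝ × ℝ → ℝ} (hH : Measurable H)
    (hint : Integrable fun y => H (cylindrical y)) :
    ∫ y, H (cylindrical y) = polarConst.toReal * ∫ s in Ioi (0 : ℝ), ∫ θ in (0 : ℝ)..Real.pi,
      s ^ 3 * Real.sin θ ^ 2 * H (s * Real.cos θ, s * Real.sin θ) := by
  have hweight : Measurable fun z : ℝ × ℝ => ENNReal.ofReal (z.1 ^ 3 * Real.sin z.2 ^ 2) := by
    fun_prop
  have hweight_lt_top : ∀ᵐ z ∂(volume.restrict (Ioi (0 : ℝ))).prod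
      (volume.restrict (Ioo 0 Real.pi)), ENNReal.ofReal (z.1 ^ 3 * Real.sin z.2 ^ 2) < ⊤ :=
    Eventually.of_forall fun _ => ENNReal.ofReal_lt_top
  have hpolar : Measurable (polarCoord.symm : ℝ × ℝ → ℝ × ℝ) :=
    continuous_polarCoord_symm.measurable
  have hH_map : Integrable H (polarMeasure.map polarCoord.symm) := by
    rw [← integrable_smul_measure polarConst_ne_zero polarConst_ne_top, ← map_cylindrical]
    exact (integrable_map_measure hH.aestronglyMeasurable measurable_cylindrical.aemeasurable).2
      hint
  have hH_polar := (integrable_map_measure hH.aestronglyMeasurable hpolar.aemeasurable).1 hH_map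
  rw [polarMeasure, integrable_withDensity_iff_integrable_smul' hweight hweight_lt_top] at hH_polar
  simp only [Function.comp_apply] at hH_polar
  rw [← integral_map measurable_cylindrical.aemeasurable hH.aestronglyMeasurable, map_cylindrical,
    integral_smul_measure, smul_eq_mul, integral_map hpolar.aemeasurable hH.aestronglyMeasurable,
    polarMeasure, integral_withDensity_eq_integral_toReal_smul hweight hweight_lt_top,
    integral_prod _ hH_polar]
  congr 1
  refine setIntegral_congr_fun measurableSet_Ioi fun s hs => ?_
  have hs_pos : 0 < s := hs
  simp only [smul_eq_mul, polarCoord_symm_apply]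
  rw [intervalIntegral.integral_of_le Real.pi_pos.le, integral_Ioc_eq_integral_Ioo]
  refine integral_congr_ae (Eventually.of_forall fun θ => ?_)
  simp only
  rw [ENNReal.toReal_ofReal (by positivity)]

/-- The constant `c` with `∫ h(|y|) dy = c ∫₀^∞ h(s) s³ ds` on `ℝ⁴`, that is, the area of the unit
sphere of `ℝ⁴`. -/
noncomputable def radialConst : ℝ := polarConst.toReal * (Real.pi / 2)

lemma radialConst_pos : 0 < radialConst :=
  mul_pos (ENNReal.toReal_pos polarConst_ne_zero polarConst_ne_top) (by positivity)

lemma sqrt_mul_cos_sq_add_mul_sin_sq {s : ℝ} (hs : 0 ≤ s) (θ : ℝ) :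
    √((s * Real.cos θ) ^ 2 + (s * Real.sin θ) ^ 2) = s := by
  rw [mul_pow, mul_pow, ← mul_add, Real.cos_sq_add_sin_sq, mul_one, Real.sqrt_sq hs]

lemma sqrt_cylindrical_sq_add_sq (y : EuclideanSpace ℝ (Fin 4)) :
    √((cylindrical y).1 ^ 2 + (cylindrical y).2 ^ 2) = ‖y‖ := by
  rw [cylindrical_sq_add_sq, Real.sqrt_sq (norm_nonneg y)]

variable {h : ℝ → ℝ}

lemma integrable_comp_norm_iff : Integrable (fun y : EuclideanSpace ℝ (Fin 4) => h ‖y‖) ↔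
    IntegrableOn (fun s => h s * s ^ 3) (Ioi 0) := by
  rw [integrable_fun_norm_addHaar, finrank_euclideanSpace_fin]
  simp only [smul_eq_mul, mul_comm, Nat.add_one_sub_one]

lemma integral_comp_norm (hh : Measurable h)
    (hint : Integrable fun y : EuclideanSpace ℝ (Fin 4) => h ‖y‖) :
    ∫ y : EuclideanSpace ℝ (Fin 4), h ‖y‖ = radialConst * ∫ s in Ioi (0 : ℝ), h s * s ^ 3 := by
  have hpolar := integral_comp_cylindrical (H := fun w => h √(w.1 ^ 2 + w.2 ^ 2))
    (hh.comp (by fun_prop)) (by simpa only [sqrt_cylindrical_sq_add_sq] using hint)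
  simp only [sqrt_cylindrical_sq_add_sq] at hpolar
  rw [hpolar, radialConst, mul_assoc, ← integral_const_mul (Real.pi / 2)]
  congr 1
  refine setIntegral_congr_fun measurableSet_Ioi fun s (hs : 0 < s) => ?_
  simp only [sqrt_mul_cos_sq_add_mul_sin_sq hs.le]
  rw [intervalIntegral.integral_mul_const, intervalIntegral.integral_const_mul, integral_sin_sq]
  simp only [Real.sin_zero, Real.sin_pi, zero_mul, sub_zero, zero_add]
  ring

lemma integral_log_norm_div_single_mul (hh : Continuous h)
    (hint : Integrable fun y : EuclideanSpace ℝ (Fin 4) => h ‖y‖) {r : ℝ} (hr : 0 ≤ r) :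
    ∫ y : EuclideanSpace ℝ (Fin 4),
        Real.log (‖y‖ / ‖EuclideanSpace.single 0 r - y‖) * h ‖y‖ =
      -(radialConst * ∫ s in Ioi (0 : ℝ), logKernel (r / s) * (h s * s ^ 3)) := by
  set H : ℝ × ℝ → ℝ := fun w => Real.log (√(w.1 ^ 2 + w.2 ^ 2) / √((r - w.1) ^ 2 + w.2 ^ 2)) *
    h √(w.1 ^ 2 + w.2 ^ 2) with hH
  have hH_meas : Measurable H :=
    (Real.measurable_log.comp (by fun_prop)).mul (hh.measurable.comp (by fun_prop))
  have hH_cylindrical : ∀ y : EuclideanSpace ℝ (Fin 4), H (cylindrical y) =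
      Real.log (‖y‖ / ‖EuclideanSpace.single 0 r - y‖) * h ‖y‖ := fun y => by
    simp only [hH]
    rw [sqrt_cylindrical_sq_add_sq, ← norm_single_sub_sq, Real.sqrt_sq (norm_nonneg _)]
  have hpolar := integral_comp_cylindrical hH_meas (by
    simpa only [hH_cylindrical, Function.comp_apply] using
      integrable_log_norm_div_mul (hh.comp continuous_norm) hint (EuclideanSpace.single 0 r))
  simp only [hH_cylindrical] at hpolar
  rw [hpolar, radialConst, mul_assoc, ← integral_const_mul (Real.pi / 2), ← mul_neg, ← integral_neg]
  congr 1
  refine integral_congr_ae ?_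
  filter_upwards [ae_restrict_mem measurableSet_Ioi,
    ae_restrict_of_ae (compl_mem_ae_iff.2 (measure_singleton r))] with s (hs : 0 < s) hsr
  have hH_polar : ∀ θ : ℝ, s ^ 3 * Real.sin θ ^ 2 * H (s * Real.cos θ, s * Real.sin θ) =
      (s ^ 3 * h s) * (Real.sin θ ^ 2 *
        Real.log (s / √(r ^ 2 - 2 * r * s * Real.cos θ + s ^ 2))) := fun θ => by
    have hdist : (r - s * Real.cos θ) ^ 2 + (s * Real.sin θ) ^ 2 =
        r ^ 2 - 2 * r * s * Real.cos θ + s ^ 2 := by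
      linear_combination s ^ 2 * Real.sin_sq_add_cos_sq θ
    simp only [hH]
    rw [sqrt_mul_cos_sq_add_mul_sin_sq hs.le, hdist]
    ring
  simp only [hH_polar]
  rw [intervalIntegral.integral_const_mul, integral_sin_sq_mul_log_ratio hr hs (Ne.symm hsr)]
  ring

/- A reflection carrying `x` to the first axis preserves Lebesgue measure and the density. -/
lemma integral_log_norm_div_mul (hh : Continuous h)
    (hint : Integrable fun y : EuclideanSpace ℝ (Fin 4) => h ‖y‖) (x : EuclideanSpace ℝ (Fin 4)) :
    ∫ y, Real.log (‖y‖ / ‖x - y‖) * h ‖y‖ =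
      -(radialConst * ∫ s in Ioi (0 : ℝ), logKernel (‖x‖ / s) * (h s * s ^ 3)) := by
  rw [← integral_log_norm_div_single_mul hh hint (norm_nonneg x)]
  set e : EuclideanSpace ℝ (Fin 4) := EuclideanSpace.single 0 ‖x‖ with he
  have hnorm : ‖x‖ = ‖e‖ := by simp [he]
  set T := (ℝ ∙ (x - e))ᗮ.reflection
  have hTx : T x = e := Submodule.reflection_sub hnorm
  rw [← T.measurePreserving.integral_comp T.toHomeomorph.measurableEmbedding]
  refine integral_congr_ae (Eventually.of_forall fun y => ?_)
  simp only
  rw [← hTx, T.norm_map, ← T.norm_map (x - T y), map_sub, Submodule.reflection_reflection]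

end LogPotential

section RadialNormalSolutions

open Set Filter Topology

lemma normalConst_four_pos : 0 < normalConst 4 := by
  have hsphere : 0 < sphereVolume 4 :=
    ENNReal.toReal_pos (Measure.measure_univ_ne_zero.2 (Measure.toSphere_ne_zero _))
      (measure_ne_top _ _)
  rw [normalConst]
  positivity

/-- The factor by which the curvature profile `Q` is multiplied when the equation for a radial
normal solution on `ℝ⁴` is written as a one-dimensional integral equation. -/
noncomputable def densityConst : ℝ := normalConst 4 * radialConst

lemma densityConst_pos : 0 < densityConst := mul_pos normalConst_four_pos radialConst_pos

lemma powerCurvature_four_eq (p : ℝ) :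
    powerCurvature 4 p = fun x => powerProfile p 1 1 ‖x‖ := by
  ext x
  simp [powerCurvature, powerProfile]

lemma const_mul_powerProfile_one_one (κ p : ℝ) :
    (fun s => κ * powerProfile p 1 1 s) = powerProfile p κ κ := by
  ext s
  rw [powerProfile, powerProfile]
  ring

lemma radialDensity_const_mul (κ : ℝ) (Q U : ℝ → ℝ) :
    radialDensity (fun s => κ * Q s) U = fun s => κ * (Q s * Real.exp (4 * U s) * s ^ 3) := by
  ext s
  rw [radialDensity]
  ring

variable {Q U : ℝ → ℝ}

lemma integrable_mul_exp_comp_norm_iff :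
    Integrable (fun x : EuclideanSpace ℝ (Fin 4) => Q ‖x‖ * Real.exp ((4 : ℕ) * U ‖x‖)) ↔
      IntegrableOn (radialDensity (fun s => densityConst * Q s) U) (Ioi 0) := by
  rw [integrable_comp_norm_iff (h := fun s => Q s * Real.exp ((4 : ℕ) * U s)),
    radialDensity_const_mul, IntegrableOn, IntegrableOn,
    integrable_const_mul_iff (isUnit_iff_ne_zero.2 densityConst_pos.ne')]
  rfl

lemma totalCurvature_comp_norm (hQ : Continuous Q) (hU : Continuous U)
    (hint : Integrable fun x : EuclideanSpace ℝ (Fin 4) => Q ‖x‖ * Real.exp ((4 : ℕ) * U ‖x‖)) :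
    totalCurvature 4 (fun x => Q ‖x‖) (fun x => U ‖x‖) =
      radialMass (fun s => densityConst * Q s) U := by
  rw [totalCurvature, integral_comp_norm (h := fun s => Q s * Real.exp ((4 : ℕ) * U s))
    (by fun_prop) hint, radialMass, radialDensity_const_mul, integral_const_mul, densityConst,
    mul_assoc]
  rfl

lemma normalConst_mul_integral_log_eq (hQ : Continuous Q) (hU : Continuous U)
    (hint : Integrable fun x : EuclideanSpace ℝ (Fin 4) => Q ‖x‖ * Real.exp ((4 : ℕ) * U ‖x‖))
    (x : EuclideanSpace ℝ (Fin 4)) :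
    normalConst 4 *
        (∫ y, Real.log (‖y‖ / ‖x - y‖) * (Q ‖y‖ * Real.exp ((4 : ℕ) * U ‖y‖))) =
      -∫ s in Ioi 0, logKernel (‖x‖ / s) * radialDensity (fun s => densityConst * Q s) U s := by
  rw [integral_log_norm_div_mul (h := fun s => Q s * Real.exp ((4 : ℕ) * U s)) (by fun_prop) hint,
    radialDensity_const_mul]
  simp only [mul_left_comm _ densityConst]
  rw [integral_const_mul, densityConst, mul_neg, mul_assoc]
  rfl

theorem isNormalSolution_comp_norm_iff (hQ : Continuous Q) (hU : Continuous U) :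
    IsNormalSolution 4 (fun x => Q ‖x‖) (fun x => U ‖x‖) ↔
      IsRadialNormal (fun s => densityConst * Q s) U := by
  constructor
  · rintro ⟨hint, C, hC⟩
    refine ⟨hU, integrable_mul_exp_comp_norm_iff.1 hint, C, fun r hr => ?_⟩
    have hray := hC (EuclideanSpace.single 0 r)
    rw [normalConst_mul_integral_log_eq hQ hU hint, neg_add_eq_sub] at hray
    simpa only [PiLp.norm_single, Real.norm_of_nonneg hr] using hray
  · rintro ⟨-, hint, C, hC⟩
    have hint_comp := integrable_mul_exp_comp_norm_iff.2 hint
    refine ⟨hint_comp, C, fun x => ?_⟩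
    rw [normalConst_mul_integral_log_eq hQ hU hint_comp, neg_add_eq_sub]
    exact hC _ (norm_nonneg x)

lemma IsRadial.exists_eq_comp_norm {n : ℕ} [NeZero n] {u : EuclideanSpace ℝ (Fin n) → ℝ}
    (hu : IsRadial u) (hu_cont : Continuous u) :
    ∃ U : ℝ → ℝ, Continuous U ∧ u = fun x => U ‖x‖ := by
  refine ⟨fun r => u (r • EuclideanSpace.single 0 1), by fun_prop, funext fun x => hu _ _ ?_⟩
  simp [norm_smul]

end RadialNormalSolutions

theorem mainTheorem6 (p : ℝ) (hp : 0 < p) (β : ℝ) :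
    (∃ u : EuclideanSpace ℝ (Fin 4) → ℝ,
      ContDiff ℝ 4 u ∧
      (ContDiff ℝ ∞ (powerCurvature 4 p) → ContDiff ℝ ∞ u) ∧
      IsRadial u ∧
      IsNormalSolution 4 (powerCurvature 4 p) u ∧
      totalCurvature 4 (powerCurvature 4 p) u = β) ↔
    (max 2 (2 * p) < β ∧ β < 2 + 2 * p) := by
  have hQ : Continuous (powerProfile p 1 1) := continuous_powerProfile hp.le 1 1
  have hκ := const_mul_powerProfile_one_one densityConst p
  rw [powerCurvature_four_eq]
  constructor
  · rintro ⟨u, hu, -, hu_radial, hu_normal, rfl⟩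
    obtain ⟨U, hU, rfl⟩ := hu_radial.exists_eq_comp_norm hu.continuous
    have hU_normal := hκ ▸ (isNormalSolution_comp_norm_iff hQ hU).1 hu_normal
    rw [totalCurvature_comp_norm hQ hU hu_normal.1, hκ,
      hU_normal.radialMass_eq densityConst_pos.le densityConst_pos.le]
    exact hU_normal.mass_mem_Ioo hp densityConst_pos densityConst_pos
  · intro hβ
    obtain ⟨U, hU_normal, hU_mass⟩ := exists_isRadialNormal_radialMass_eq hp densityConst_pos hβ
    rw [← hκ] at hU_normal hU_mass
    have hU := hU_normal.continuous
    have hu_normal := (isNormalSolution_comp_norm_iff hQ hU).2 hU_normal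
    have hκQ : Continuous fun s => densityConst * powerProfile p 1 1 s := continuous_const.mul hQ
    exact ⟨fun x => U ‖x‖, hU_normal.contDiff_four hκQ,
      fun hQ_smooth => hU_normal.contDiff_top hκQ (contDiff_const.mul hQ_smooth),
      fun x y hxy => congrArg U hxy, hu_normal,
      (totalCurvature_comp_norm hQ hU hu_normal.1).trans hU_mass⟩
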